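/- Setting. $\mathcal P_2(\mathbb R^d)$ is the set of Borel probability measures on $\mathbb R^d$ with finite second moment, with the Wasserstein distance $W_2(\mu,\nu)=\big(\inf_\pi\int\|x-y\|^2\,d\pi\big)^{1/2}$ (infimum over couplings $\pi$ of $\mu,\nu$); $\delta_0$ is the Dirac mass at the origin, and $\langle \mu,\nu\rangle_{L^2}=\int f_\mu f_\nu\,dx$ for measures with Lebesgue densities $f_\mu,f_\nu$. Given patterns $X_1,\dots,X_N$ and $\beta>0$, the log-sum-exp energy is $E(\xi)=-\frac1\beta\log\sum_{i=1}^N e^{-\beta W_2^2(X_i,\xi)}$, and the associated update operator is $\Phi(\xi)=\big(\sum_{i=1}^N w_i(\xi)T_i\big)_\#\xi$, where $T_i$ is the optimal transport map from $\xi$ to $X_i$ and $w_i(\xi)=e^{-\beta W_2^2(X_i,\xi)}/\sum_{j}e^{-\beta W_2^2(X_j,\xi)}$. Given a ball $B_i$ around each $X_i$, the pattern $X_i$ is *stored* if $\Phi$ has exactly one Gaussian fixed point $X_i^\ast$ in $B_i$, $W_2(\Phi^n(\xi),X_i^\ast)\to0$ for every Gaussian $\xi\in B_i$, and $B_i\cap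 B_j=\emptyset$ for all $j\ne i$. Write $M_W=\max_i W_2(\delta_0,X_i)$. Sampling. For $0<\lambda_{\min}<\lambda_{\max}<\infty$, $R>0$ and an orthogonal matrix $U$, draw independently for $i=1,\dots,N$ a vector $\lambda^{(i)}$ uniformly from the polytope $\{\lambda\in\mathbb R^d:\sum_k\lambda_k=R^2/2,\ \lambda_{\min}\le\lambda_k\le\lambda_{\max}\}$ and, independently of it, a vector $\mu_i$ uniformly from the sphere $\{\|\mu\|=R/\sqrt2\}$, and put $X_i=\mathcal N(\mu_i,U\,\mathrm{diag}(\lambda^{(i)})\,U^T)$. **Theorem.** Let $0<p<1$ and $0<\lambda_{\min}<\lambda_{\max}<\infty$; put $\gamma=\lambda_{\max}/\lambda_{\min}$ and $\alpha=1-2\log\gamma$, and assume $\gamma<\sqrt e$. Then there is $d_0\in\mathbb N$, depending only on $p,\lambda_{\min},\lambda_{\max}$, such that for all $d>d_0$ and every orthogonal $d\times d$ matrix $U$ the following holds with $R=\sqrt{d(\lambda_{\max}+\lambda_{\min})}$ and $N=\big\lfloor\sqrt{p/2}\,\exp(d\alpha^2/16)\big\rfloor$. The sampling procedure is well defined, and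 almost surely $X_1,\dots,X_N$ are Gaussian measures with pairwise commuting covariances, with all covariance eigenvalues in $[\lambda_{\min},\lambda_{\max}]$ and with $W_2(\delta_0,X_i)=R$. Moreover, for every $\beta>3\alpha/\lambda_{\min}$: almost surely $$\beta>\frac{e^2}{\big(4M_W^2+2d(\lambda_{\max}+\lambda_{\min})\big)N^3},$$ and with probability at least $1-p$ one has both, for all $i\neq j$, $$-\log\langle X_i,X_j\rangle_{L^2}\ \ge\ \frac d2\log(4\pi\lambda_{\max})+\frac1{\beta\lambda_{\min}}\log\Big(N^3\beta\big(4M_W^2+2d(\lambda_{\max}+\lambda_{\min})\big)\Big),$$ and that all $N$ patterns $X_1,\dots,X_N$ are stored, with respect to the balls $B_i=\{\nu\in\mathcal P_2(\mathbb R^d):W_2(X_i,\nu)<1/\sqrt{\beta N}\}$. In particular the log-sum-exp energy stores exponentially many patterns in $d$ with probability at least $1-p$. -/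

import Mathlib

open MeasureTheory ProbabilityTheory Filter Topology
open scoped ENNReal Matrix

namespace WDAM

/-- The Euclidean space `ℝ^d`. -/
abbrev Vec (d : ℕ) : Type := EuclideanSpace ℝ (Fin d)

/-! ### Wasserstein distance, optimal transport maps, `L²` inner product -/

/-- `π` is a coupling of `μ` and `ν`. -/
def IsCoupling {d : ℕ} (μ ν : Measure (Vec d)) (π : Measure (Vec d × Vec d)) : Prop :=
  π.map Prod.fst = μ ∧ π.map Prod.snd = ν

/-- The `2`-Wasserstein distance, as an extended nonnegative number. -/
noncomputable def W2 {d : ℕ} (μ ν : Measure (Vec d)) : ℝ≥0∞ :=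
  (⨅ (π : Measure (Vec d × Vec d)) (_ : IsCoupling μ ν π),
    ∫⁻ z, ‖z.1 - z.2‖ₑ ^ 2 ∂π) ^ (1 / 2 : ℝ)

/-- `T` is an optimal transport map from `μ` to `ν` for the quadratic cost. -/
def IsOptimalMap {d : ℕ} (μ ν : Measure (Vec d)) (T : Vec d → Vec d) : Prop :=
  Measurable T ∧ μ.map T = ν ∧ ∫⁻ x, ‖x - T x‖ₑ ^ 2 ∂μ = W2 μ ν ^ 2

open Classical in
/-- The optimal transport map from `μ` to `ν`. Where it is unique `μ`-almost everywhere (e.g. from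
a nondegenerate Gaussian measure to a Gaussian measure), push-forwards of `μ` by it, or by linear
combinations of such maps, do not depend on the choice. If there is none, the value is `id`. -/
noncomputable def otMap {d : ℕ} (μ ν : Measure (Vec d)) : Vec d → Vec d :=
  if h : ∃ T, IsOptimalMap μ ν T then h.choose else id

/-- The `L²` inner product of (the Lebesgue densities of) two measures. -/
noncomputable def l2Inner {d : ℕ} (μ ν : Measure (Vec d)) : ℝ :=
  ∫ x, (μ.rnDeriv volume x).toReal * (ν.rnDeriv volume x).toReal

/-! ### The log-sum-exp energy and its update operator -/

/-- The log-sum-exp energy `E(ξ) = -β⁻¹ log ∑ i, exp (-β W₂²(X i, ξ))`. -/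
noncomputable def energy {d N : ℕ} (β : ℝ) (X : Fin N → Measure (Vec d))
    (ξ : Measure (Vec d)) : ℝ :=
  -(1 / β) * Real.log (∑ i, Real.exp (-β * (W2 (X i) ξ).toReal ^ 2))

/-- The softmax weights `w_i(ξ)`. -/
noncomputable def weight {d N : ℕ} (β : ℝ) (X : Fin N → Measure (Vec d))
    (ξ : Measure (Vec d)) (i : Fin N) : ℝ :=
  Real.exp (-β * (W2 (X i) ξ).toReal ^ 2) / ∑ j, Real.exp (-β * (W2 (X j) ξ).toReal ^ 2)

/-- The weights are the Gibbs weights of the energy. -/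
theorem weight_eq_exp_energy {d N : ℕ} {β : ℝ} (hβ : β ≠ 0) (X : Fin N → Measure (Vec d))
    (ξ : Measure (Vec d)) (i : Fin N) :
    weight β X ξ i = Real.exp (β * (energy β X ξ - (W2 (X i) ξ).toReal ^ 2)) := by
  have hpos : 0 < ∑ j, Real.exp (-β * (W2 (X j) ξ).toReal ^ 2) :=
    Finset.sum_pos (fun j _ => Real.exp_pos _) ⟨i, Finset.mem_univ i⟩
  have h : β * (energy β X ξ - (W2 (X i) ξ).toReal ^ 2)
      = -β * (W2 (X i) ξ).toReal ^ 2
        - Real.log (∑ j, Real.exp (-β * (W2 (X j) ξ).toReal ^ 2)) := by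
    unfold energy
    field_simp
    ring
  rw [h, Real.exp_sub, Real.exp_log hpos, weight]

/-- The update operator `Φ(ξ) = (∑ i, w_i(ξ) T_i)_# ξ`, where `T_i` is the optimal transport map
from `ξ` to `X i`. (The map `∑ i, w_i(ξ) T_i` is `id` plus half the Wasserstein gradient
`2 ∑ i, w_i(ξ) (T_i - id)` attached to the energy.) -/
noncomputable def update {d N : ℕ} (β : ℝ) (X : Fin N → Measure (Vec d))
    (ξ : Measure (Vec d)) : Measure (Vec d) :=
  ξ.map (fun x => ∑ i, weight β X ξ i • otMap ξ (X i) x)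

/-! ### Storage -/

/-- The open Wasserstein ball in `𝒫₂(ℝ^d)` of radius `r` about `μ`. -/
def wBall {d : ℕ} (μ : Measure (Vec d)) (r : ℝ) : Set (Measure (Vec d)) :=
  {ν | IsProbabilityMeasure ν ∧ ∫⁻ x, ‖x‖ₑ ^ 2 ∂ν < ∞ ∧ W2 μ ν < ENNReal.ofReal r}

/-- The pattern `X i` is stored, relative to given balls `B j` around the patterns: among the
Gaussian measures in `B i` there is exactly one fixed point of the update operator, the iterates
of the update operator started at any Gaussian measure in `B i` converge to it in `W₂`, and `B i`
is disjoint from the other balls. -/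
def IsStored {d N : ℕ} (β : ℝ) (X : Fin N → Measure (Vec d))
    (B : Fin N → Set (Measure (Vec d))) (i : Fin N) : Prop :=
  (∃ Y ∈ B i, IsGaussian Y ∧ update β X Y = Y ∧
    (∀ Z ∈ B i, IsGaussian Z → update β X Z = Z → Z = Y) ∧
    (∀ ξ ∈ B i, IsGaussian ξ →
      Tendsto (fun n : ℕ => W2 ((update β X)^[n] ξ) Y) atTop (𝓝 0))) ∧
  ∀ j, j ≠ i → Disjoint (B i) (B j)

/-! ### The Wasserstein sphere, separation condition and constraint on `β` -/

/-- The measures `X i` are Gaussian measures with pairwise commuting covariance matrices, all of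
whose eigenvalues lie in `[lmin, lmax]`, at `W₂`-distance `R` from the Dirac mass at the origin. -/
def OnWassersteinSphere {d N : ℕ} (lmin lmax R : ℝ) (X : Fin N → Measure (Vec d)) : Prop :=
  ∃ (m : Fin N → Vec d) (S : Fin N → Matrix (Fin d) (Fin d) ℝ),
    (∀ i, (S i).PosSemidef ∧ spectrum ℝ (S i) ⊆ Set.Icc lmin lmax ∧
      X i = multivariateGaussian (m i) (S i) ∧
      W2 (Measure.dirac 0) (X i) = ENNReal.ofReal R) ∧
    ∀ i j, Commute (S i) (S j)

/-- `M_W = max_i W₂(δ₀, X i)`. -/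
noncomputable def MW {d N : ℕ} (X : Fin N → Measure (Vec d)) : ℝ :=
  ⨆ i, (W2 (Measure.dirac 0) (X i)).toReal

/-- The separation condition. -/
def Separated {d N : ℕ} (lmin lmax β : ℝ) (X : Fin N → Measure (Vec d)) : Prop :=
  ∀ i j, j ≠ i →
    (d : ℝ) / 2 * Real.log (4 * Real.pi * lmax)
      + 1 / (β * lmin) *
        Real.log ((N : ℝ) ^ 3 * β * (4 * MW X ^ 2 + 2 * (d : ℝ) * (lmax + lmin)))
      ≤ -Real.log (l2Inner (X i) (X j))

/-- The constraint on `β`. -/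
def BetaConstraint {d N : ℕ} (lmin lmax β : ℝ) (X : Fin N → Measure (Vec d)) : Prop :=
  Real.exp 2 / ((4 * MW X ^ 2 + 2 * (d : ℝ) * (lmax + lmin)) * (N : ℝ) ^ 3) < β

/-! ### The sampling algorithm -/

/-- The polytope of admissible spectra. -/
def spectrumPolytope (d : ℕ) (lmin lmax R : ℝ) : Set (Vec d) :=
  {l | ∑ k, l k = R ^ 2 / 2 ∧ ∀ k, lmin ≤ l k ∧ l k ≤ lmax}

/-- The uniform distribution on the polytope of spectra: normalized `(d-1)`-dimensional Hausdorff
measure. -/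
noncomputable def uniformPolytope (d : ℕ) (lmin lmax R : ℝ) : Measure (Vec d) :=
  ProbabilityTheory.cond (Measure.hausdorffMeasure ((d : ℝ) - 1)) (spectrumPolytope d lmin lmax R)

/-- The uniform distribution on the unit sphere of `ℝ^d`: normalized surface measure. -/
noncomputable def uniformUnitSphere (d : ℕ) : Measure (Metric.sphere (0 : Vec d) 1) :=
  ((volume : Measure (Vec d)).toSphere Set.univ)⁻¹ • (volume : Measure (Vec d)).toSphere

/-- The uniform distribution on the sphere of radius `ρ` about `0` in `ℝ^d`. -/
noncomputable def uniformSphere (d : ℕ) (ρ : ℝ) : Measure (Vec d) :=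
  (uniformUnitSphere d).map (fun u : Metric.sphere (0 : Vec d) 1 => ρ • (u : Vec d))

/-- The joint law of the `N` independent pairs (spectrum, mean vector) drawn by the algorithm; the
spectrum and the mean vector are independent as well. -/
noncomputable def sampleLaw (d N : ℕ) (lmin lmax R : ℝ) : Measure (Fin N → Vec d × Vec d) :=
  Measure.pi (fun _ => (uniformPolytope d lmin lmax R).prod (uniformSphere d (R / √2)))

/-- The output of the algorithm: `X i = 𝒩(μ_i, U diag(λ_i) Uᵀ)` for the sample `s i = (λ_i, μ_i)`. -/
noncomputable def patterns {d N : ℕ} (U : Matrix (Fin d) (Fin d) ℝ)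
    (s : Fin N → Vec d × Vec d) : Fin N → Measure (Vec d) :=
  fun i => multivariateGaussian (s i).2
    (U * Matrix.diagonal (fun k => (s i).1 k) * Uᵀ)

end WDAM

/-!
The update operator preserves Gaussian measures, so storage is a question about a map on the pairs
of mean and covariance. Between nondegenerate Gaussian measures the optimal map is affine with
linear part the positive definite solution `A` of `A Q A = S` (`transport`). It is found and shown
to be unique almost everywhere by an exact duality identity (`lintegral_cost_eq`): the cost of a
coupling equals that of the affine map plus the integral of a positive definite quadratic form.
This identity also gives the formula for `W₂` (`W2_sq_multivariateGaussian`), and the update becomes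
`(m, Q) ↦ (∑ w_j m_j, Ā Q Ā)` with `Ā = ∑ w_j A_j` (`update_gauss`).

Near the pattern `i` the weights of all other patterns are at most `exp (-β d lmin / 2)`, because
the means are at squared distance at least `d lmin` while the Wasserstein ball is small. If these
foreign weights vanished, the update would send everything to the pattern, as `A_i Q A_i = S_i`.
As they are exponentially small in `β d`, whereas all other constants are polynomial in `N`, `d`
and `β`, the update maps the Gaussian measures in the ball into a smaller norm ball of parameters
around the pattern and is `1/2`-Lipschitz there (`exists_contraction`), for the operator norm on
covariances. Banach's fixed point theorem yields existence, uniqueness and convergence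
(`exists_isStored_of_separated`). Gaussian measures in the ball, even if not known to be
nondegenerate, have covariances comparable with that of the pattern (`inner_op_le_of_W2_lt`).

The random part is a union bound. A spherical cap at height `t` has measure at most
`exp (-d t² / 2)`, since the cone over it fits in a ball of radius `√(1 - t²)`
(`uniformSphere_cap_le`). With `t = α / 2` and `N² ≤ (p / 2) exp (d α² / 8)`, all pairs of mean
vectors are separated, `‖m_i - m_j‖² ≥ R² (1 - α / 2)`, with probability at least `1 - p`
(`le_sampleLaw_goodEvent`). As the covariances share an eigenbasis, the overlap of two patterns is
a product of one-dimensional Gaussian densities (`l2Inner_eq_prod`), and the separation of the means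
turns into the lower bound for its negative logarithm (`separated_patterns`). Large `d` absorbs the
logarithmic and polynomial terms; these conditions depend on `β` only through `β d`, which exceeds
`3 α d / lmin`, so the threshold for `d` is uniform in `β`.
-/

namespace WDAM

/-! ### Symmetric matrices and the transport matrix -/

section LinearAlgebra

open scoped Matrix.Norms.L2Operator MatrixOrder RealInnerProductSpace

variable {d : ℕ}

/-- The operator of a square matrix on Euclidean space. -/
noncomputable abbrev op (S : Matrix (Fin d) (Fin d) ℝ) : Vec d →L[ℝ] Vec d :=
  Matrix.toEuclideanCLM (n := Fin d) (𝕜 := ℝ) S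

theorem op_mul_apply (A B : Matrix (Fin d) (Fin d) ℝ) (v : Vec d) :
    op (A * B) v = op A (op B v) := by
  simp [op, map_mul]

theorem norm_op_apply_le (A : Matrix (Fin d) (Fin d) ℝ) (v : Vec d) :
    ‖op A v‖ ≤ ‖A‖ * ‖v‖ := by
  rw [Matrix.cstar_norm_def]; exact ContinuousLinearMap.le_opNorm _ _

theorem inner_op_left (A : Matrix (Fin d) (Fin d) ℝ) (u v : Vec d) :
    ⟪op A u, v⟫ = ⟪u, op Aᵀ v⟫ := by
  rw [real_inner_comm, Matrix.inner_toEuclideanCLM, Matrix.inner_toEuclideanCLM,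
    Matrix.dotProduct_mulVec, ← Matrix.mulVec_transpose, dotProduct_comm]

theorem IsHermitian.inner_op {A : Matrix (Fin d) (Fin d) ℝ} (hA : A.IsHermitian) (u v : Vec d) :
    ⟪op A u, v⟫ = ⟪u, op A v⟫ := by
  rw [inner_op_left, ← Matrix.conjTranspose_eq_transpose_of_trivial, hA.eq]

/-- The matrix `S` is symmetric and its quadratic form lies between `a` and `b` times the squared
norm. -/
structure SpecIn (a b : ℝ) (S : Matrix (Fin d) (Fin d) ℝ) : Prop where
  herm : S.IsHermitian
  lower : ∀ v : Vec d, a * ‖v‖ ^ 2 ≤ ⟪v, op S v⟫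
  upper : ∀ v : Vec d, ⟪v, op S v⟫ ≤ b * ‖v‖ ^ 2

/-- For symmetric matrices, `SpecIn` says that the spectrum lies in `[a, b]`; the quadratic form
is the more convenient description for perturbations and congruences. -/
theorem specIn_iff {a b : ℝ} {S : Matrix (Fin d) (Fin d) ℝ} :
    SpecIn a b S ↔ S.IsHermitian ∧ spectrum ℝ S ⊆ Set.Icc a b := by
  constructor
  · intro h
    refine ⟨h.herm, ?_⟩
    rw [h.herm.spectrum_real_eq_range_eigenvalues]
    rintro _ ⟨i, rfl⟩
    have hv : op S (h.herm.eigenvectorBasis i)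
        = h.herm.eigenvalues i • h.herm.eigenvectorBasis i := by
      apply (WithLp.equiv 2 _).injective
      simpa using h.herm.mulVec_eigenvectorBasis i
    have h1 := h.lower (h.herm.eigenvectorBasis i)
    have h2 := h.upper (h.herm.eigenvectorBasis i)
    have hn : ‖h.herm.eigenvectorBasis i‖ = 1 := h.herm.eigenvectorBasis.norm_eq_one i
    rw [hv, inner_smul_right, real_inner_self_eq_norm_sq, hn] at h1 h2
    exact ⟨by simpa using h1, by simpa using h2⟩
  · rintro ⟨h, hs⟩
    have hsa : IsSelfAdjoint S := h
    have h1 : algebraMap ℝ _ a ≤ S := algebraMap_le_of_le_spectrum (fun x hx => (hs hx).1)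
    have h2 : S ≤ algebraMap ℝ _ b := le_algebraMap_of_spectrum_le (fun x hx => (hs hx).2)
    rw [Matrix.le_iff] at h1 h2
    refine ⟨h, fun v => ?_, fun v => ?_⟩
    · have := h1.re_dotProduct_nonneg (WithLp.ofLp v)
      have h3 : ⟪v, op (S - algebraMap ℝ _ a) v⟫ = ⟪v, op S v⟫ - a * ‖v‖ ^ 2 := by
        simp [op, map_sub, inner_sub_right, Algebra.algebraMap_eq_smul_one, inner_smul_right]
      rw [Matrix.inner_toEuclideanCLM] at h3
      simp only [star_trivial, RCLike.re_to_real] at this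
      linarith
    · have := h2.re_dotProduct_nonneg (WithLp.ofLp v)
      have h3 : ⟪v, op (algebraMap ℝ _ b - S) v⟫ = b * ‖v‖ ^ 2 - ⟪v, op S v⟫ := by
        simp [op, map_sub, inner_sub_right, Algebra.algebraMap_eq_smul_one, inner_smul_right]
      rw [Matrix.inner_toEuclideanCLM] at h3
      simp only [star_trivial, RCLike.re_to_real] at this
      linarith

theorem norm_le_of_spectrum {c : ℝ} (hc : 0 ≤ c) {D : Matrix (Fin d) (Fin d) ℝ}
    (hD : D.IsHermitian) (h : ∀ x ∈ spectrum ℝ D, |x| ≤ c) : ‖D‖ ≤ c := by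
  have hsa : IsSelfAdjoint D := hD
  have := norm_cfc_le (f := fun x : ℝ => x) (a := D) hc (by simpa using h)
  rwa [cfc_id' ℝ D] at this

theorem SpecIn.norm_le {a b : ℝ} {S : Matrix (Fin d) (Fin d) ℝ} (h : SpecIn a b S) (ha : 0 ≤ a)
    (hb : 0 ≤ b) : ‖S‖ ≤ b := by
  refine norm_le_of_spectrum hb h.herm fun x hx => ?_
  have := (specIn_iff.1 h).2 hx
  rw [abs_of_nonneg (ha.trans this.1)]
  exact this.2

theorem SpecIn.mono {a b a' b' : ℝ} {S : Matrix (Fin d) (Fin d) ℝ} (h : SpecIn a b S)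
    (ha : a' ≤ a) (hb : b ≤ b') : SpecIn a' b' S :=
  ⟨h.herm, fun v => (by gcongr : a' * ‖v‖ ^ 2 ≤ a * ‖v‖ ^ 2).trans (h.lower v),
    fun v => (h.upper v).trans (by gcongr)⟩

theorem SpecIn.posSemidef {a b : ℝ} {S : Matrix (Fin d) (Fin d) ℝ} (h : SpecIn a b S)
    (ha : 0 ≤ a) : S.PosSemidef := by
  rw [Matrix.posSemidef_iff_isHermitian_and_spectrum_nonneg]
  exact ⟨h.herm, fun x hx => ha.trans ((specIn_iff.1 h).2 hx).1⟩

theorem SpecIn.isUnit {a b : ℝ} {S : Matrix (Fin d) (Fin d) ℝ} (h : SpecIn a b S)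
    (ha : 0 < a) : IsUnit S := by
  rw [← spectrum.zero_notMem_iff ℝ]
  exact fun h0 => absurd ((specIn_iff.1 h).2 h0).1 (not_le.2 ha)

theorem SpecIn.posDef {a b : ℝ} {S : Matrix (Fin d) (Fin d) ℝ} (h : SpecIn a b S)
    (ha : 0 < a) : S.PosDef :=
  ((h.posSemidef ha.le).posDef_iff_isUnit).2 (h.isUnit ha)

theorem SpecIn.sqrt {a b : ℝ} {S : Matrix (Fin d) (Fin d) ℝ} (h : SpecIn a b S) (ha : 0 ≤ a) :
    SpecIn (√a) (√b) (CFC.sqrt S) := by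
  have hS : 0 ≤ S := (h.posSemidef ha).nonneg
  have hsa : IsSelfAdjoint S := h.herm
  rw [specIn_iff]
  refine ⟨(CFC.sqrt_nonneg S).isSelfAdjoint, ?_⟩
  have hsp : spectrum ℝ (cfc Real.sqrt S) = Real.sqrt '' spectrum ℝ S :=
    cfc_map_spectrum Real.sqrt S
  rw [CFC.sqrt_eq_real_sqrt S, cfcₙ_eq_cfc, hsp]
  rintro _ ⟨x, hx, rfl⟩
  have := (specIn_iff.1 h).2 hx
  exact ⟨Real.sqrt_le_sqrt this.1, Real.sqrt_le_sqrt this.2⟩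

theorem SpecIn.mul_norm_le {a b : ℝ} {S : Matrix (Fin d) (Fin d) ℝ} (h : SpecIn a b S)
    (v : Vec d) : a * ‖v‖ ≤ ‖op S v‖ := by
  rcases (norm_nonneg v).eq_or_lt with hv | hv
  · rw [← hv]; simp
  · have := (h.lower v).trans (real_inner_le_norm _ _)
    nlinarith

theorem SpecIn.norm_inv_le {a b : ℝ} {S : Matrix (Fin d) (Fin d) ℝ} (h : SpecIn a b S)
    (ha : 0 < a) : ‖S⁻¹‖ ≤ a⁻¹ := by
  rw [Matrix.cstar_norm_def]
  refine ContinuousLinearMap.opNorm_le_bound _ (by positivity) fun v => ?_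
  have h1 := h.mul_norm_le (op S⁻¹ v)
  rw [← op_mul_apply, Matrix.mul_nonsing_inv _ ((Matrix.isUnit_iff_isUnit_det _).1 (h.isUnit ha))]
    at h1
  simp only [op, map_one, one_apply_eq_self] at h1
  rw [inv_mul_eq_div, le_div_iff₀ ha, mul_comm]
  exact h1

/-- Squaring is expanding on matrices bounded below: for an eigenvector `v` of `P - Q` with
eigenvalue `μ`, one has `⟪v, (P² - Q²) v⟫ = μ (⟪v, P v⟫ + ⟪v, Q v⟫)`. -/
theorem SpecIn.norm_sub_le {c b b' : ℝ} (hc : 0 < c) {P Q : Matrix (Fin d) (Fin d) ℝ}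
    (hP : SpecIn c b P) (hQ : SpecIn c b' Q) : ‖P - Q‖ ≤ ‖P * P - Q * Q‖ / (2 * c) := by
  have hD : (P - Q).IsHermitian := hP.herm.sub hQ.herm
  refine norm_le_of_spectrum (by positivity) hD ?_
  rw [hD.spectrum_real_eq_range_eigenvalues]
  rintro _ ⟨i, rfl⟩
  set μ := hD.eigenvalues i
  set v := hD.eigenvectorBasis i
  have hv : op (P - Q) v = μ • v := by
    apply (WithLp.equiv 2 _).injective
    rw [WithLp.equiv_apply, WithLp.equiv_apply, Matrix.ofLp_toEuclideanCLM]
    exact hD.mulVec_eigenvectorBasis i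
  have hn : ‖v‖ = 1 := hD.eigenvectorBasis.norm_eq_one i
  have e : P * P - Q * Q = P * (P - Q) + (P - Q) * Q := by noncomm_ring
  have h1 : ⟪v, op (P * P - Q * Q) v⟫ = μ * (⟪v, op P v⟫ + ⟪v, op Q v⟫) := by
    rw [e]
    simp only [map_add, add_apply, inner_add_right]
    rw [op_mul_apply, op_mul_apply, hv, ← IsHermitian.inner_op hD, hv, map_smul, inner_smul_right,
      real_inner_smul_left]
    ring
  have h2 : |⟪v, op (P * P - Q * Q) v⟫| ≤ ‖P * P - Q * Q‖ := by
    refine (abs_real_inner_le_norm _ _).trans ?_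
    have := norm_op_apply_le (P * P - Q * Q) v
    rw [hn] at this ⊢
    simpa using this
  have hp := hP.lower v
  have hq := hQ.lower v
  rw [hn] at hp hq
  rw [h1, abs_mul, abs_of_nonneg (by nlinarith : 0 ≤ ⟪v, op P v⟫ + ⟪v, op Q v⟫)] at h2
  rw [le_div_iff₀ (by positivity)]
  refine le_trans ?_ h2
  gcongr
  nlinarith

/-- The matrix `A` of the optimal transport map between centred Gaussians with covariances `Q`
and `S`: the positive definite solution of `A Q A = S`. -/
noncomputable def transport (Q S : Matrix (Fin d) (Fin d) ℝ) : Matrix (Fin d) (Fin d) ℝ :=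
  CFC.sqrt S * (CFC.sqrt (CFC.sqrt S * Q * CFC.sqrt S))⁻¹ * CFC.sqrt S

variable {a b : ℝ} {Q Q' S : Matrix (Fin d) (Fin d) ℝ}

theorem SpecIn.conj_sqrt (ha : 0 < a) (hb : 0 ≤ b) (hQ : SpecIn a b Q) (hS : SpecIn a b S) :
    SpecIn (a ^ 2) (b ^ 2) (CFC.sqrt S * Q * CFC.sqrt S) := by
  have hr := hS.sqrt ha.le
  have hrr : CFC.sqrt S * CFC.sqrt S = S := CFC.sqrt_mul_sqrt_self S (hS.posSemidef ha.le).nonneg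
  have hn : ∀ v : Vec d, ‖op (CFC.sqrt S) v‖ ^ 2 = ⟪v, op S v⟫ := fun v => by
    rw [← real_inner_self_eq_norm_sq, IsHermitian.inner_op hr.herm, ← op_mul_apply, hrr]
  have hi : ∀ v : Vec d, ⟪v, op (CFC.sqrt S * Q * CFC.sqrt S) v⟫
      = ⟪op (CFC.sqrt S) v, op Q (op (CFC.sqrt S) v)⟫ := fun v => by
    rw [op_mul_apply, op_mul_apply, ← IsHermitian.inner_op hr.herm]
  refine ⟨?_, fun v => ?_, fun v => ?_⟩
  · have := Matrix.isHermitian_mul_mul_conjTranspose (CFC.sqrt S) hQ.herm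
    rwa [hr.herm.eq] at this
  · rw [hi]
    refine le_trans ?_ (hQ.lower _)
    rw [hn]
    have := hS.lower v
    nlinarith
  · rw [hi]
    refine (hQ.upper _).trans ?_
    rw [hn]
    have := hS.upper v
    nlinarith

theorem SpecIn.sqrt_conj_sqrt (ha : 0 < a) (hb : 0 ≤ b) (hQ : SpecIn a b Q) (hS : SpecIn a b S) :
    SpecIn a b (CFC.sqrt (CFC.sqrt S * Q * CFC.sqrt S)) := by
  have := (hQ.conj_sqrt ha hb hS).sqrt (by positivity)
  rwa [Real.sqrt_sq ha.le, Real.sqrt_sq hb] at this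

theorem SpecIn.norm_sqrt_mul (ha : 0 ≤ a) (hb : 0 ≤ b) (hS : SpecIn a b S) :
    ‖CFC.sqrt S‖ * ‖CFC.sqrt S‖ ≤ b := by
  have := (hS.sqrt ha).norm_le (Real.sqrt_nonneg a) (Real.sqrt_nonneg b)
  calc _ ≤ √b * √b := by gcongr
    _ = b := Real.mul_self_sqrt hb

theorem transport_posDef (ha : 0 < a) (hb : 0 ≤ b) (hQ : SpecIn a b Q) (hS : SpecIn a b S) :
    (transport Q S).PosDef := by
  have hr := hS.sqrt ha.le
  have hP := ((hQ.sqrt_conj_sqrt ha hb hS).posDef ha).inv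
  have hu := hr.isUnit (Real.sqrt_pos.2 ha)
  have := hP.mul_mul_conjTranspose_same (B := CFC.sqrt S)
    (Matrix.vecMul_injective_of_isUnit hu)
  rwa [hr.herm.eq] at this

theorem transport_mul_mul (ha : 0 < a) (hb : 0 ≤ b) (hQ : SpecIn a b Q) (hS : SpecIn a b S) :
    transport Q S * Q * transport Q S = S := by
  have hrr : CFC.sqrt S * CFC.sqrt S = S := CFC.sqrt_mul_sqrt_self S (hS.posSemidef ha.le).nonneg
  have hP := (hQ.sqrt_conj_sqrt ha hb hS)
  have hPP : CFC.sqrt (CFC.sqrt S * Q * CFC.sqrt S) * CFC.sqrt (CFC.sqrt S * Q * CFC.sqrt S)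
      = CFC.sqrt S * Q * CFC.sqrt S :=
    CFC.sqrt_mul_sqrt_self _ ((hQ.conj_sqrt ha hb hS).posSemidef (by positivity)).nonneg
  have hdet := (Matrix.isUnit_iff_isUnit_det _).1 (hP.isUnit ha)
  unfold transport
  set r := CFC.sqrt S
  set P := CFC.sqrt (r * Q * r)
  calc r * P⁻¹ * r * Q * (r * P⁻¹ * r) = r * P⁻¹ * (r * Q * r) * P⁻¹ * r := by
        simp only [mul_assoc]
    _ = r * (P⁻¹ * P) * (P * P⁻¹) * r := by rw [← hPP]; simp only [mul_assoc]
    _ = S := by rw [Matrix.nonsing_inv_mul _ hdet, Matrix.mul_nonsing_inv _ hdet]; simp [hrr]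

theorem norm_transport_le (ha : 0 < a) (hb : 0 ≤ b) (hQ : SpecIn a b Q) (hS : SpecIn a b S) :
    ‖transport Q S‖ ≤ b / a := by
  have hP := (hQ.sqrt_conj_sqrt ha hb hS).norm_inv_le ha
  have hr := hS.norm_sqrt_mul ha.le hb
  unfold transport
  set r := CFC.sqrt S
  set P := CFC.sqrt (r * Q * r)
  calc _ ≤ ‖r‖ * ‖P⁻¹‖ * ‖r‖ := (norm_mul_le _ _).trans (by gcongr; exact norm_mul_le _ _)
    _ = (‖r‖ * ‖r‖) * ‖P⁻¹‖ := by ring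
    _ ≤ b * a⁻¹ := by gcongr
    _ = b / a := rfl

/-- The transport matrix is a Lipschitz function of `Q`, since `P ↦ P⁻¹` and the square root are
Lipschitz on matrices bounded below. -/
theorem norm_transport_sub_le (ha : 0 < a) (hb : 0 ≤ b) (hQ : SpecIn a b Q) (hQ' : SpecIn a b Q')
    (hS : SpecIn a b S) :
    ‖transport Q S - transport Q' S‖ ≤ b ^ 2 / (2 * a ^ 3) * ‖Q - Q'‖ := by
  have hP := hQ.sqrt_conj_sqrt ha hb hS
  have hP' := hQ'.sqrt_conj_sqrt ha hb hS
  have hr := hS.norm_sqrt_mul ha.le hb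
  have hPP : CFC.sqrt (CFC.sqrt S * Q * CFC.sqrt S) * CFC.sqrt (CFC.sqrt S * Q * CFC.sqrt S)
      = CFC.sqrt S * Q * CFC.sqrt S :=
    CFC.sqrt_mul_sqrt_self _ ((hQ.conj_sqrt ha hb hS).posSemidef (by positivity)).nonneg
  have hPP' : CFC.sqrt (CFC.sqrt S * Q' * CFC.sqrt S) * CFC.sqrt (CFC.sqrt S * Q' * CFC.sqrt S)
      = CFC.sqrt S * Q' * CFC.sqrt S :=
    CFC.sqrt_mul_sqrt_self _ ((hQ'.conj_sqrt ha hb hS).posSemidef (by positivity)).nonneg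
  have hdet := (Matrix.isUnit_iff_isUnit_det _).1 (hP.isUnit ha)
  have hdet' := (Matrix.isUnit_iff_isUnit_det _).1 (hP'.isUnit ha)
  have hsub := hP.norm_sub_le ha hP'
  have hi := hP.norm_inv_le ha
  have hi' := hP'.norm_inv_le ha
  rw [hPP, hPP'] at hsub
  unfold transport
  set r := CFC.sqrt S
  set P := CFC.sqrt (r * Q * r)
  set P' := CFC.sqrt (r * Q' * r)
  have e1 : r * Q * r - r * Q' * r = r * (Q - Q') * r := by noncomm_ring
  have e2 : r * P⁻¹ * r - r * P'⁻¹ * r = r * (P⁻¹ * (P' - P) * P'⁻¹) * r := by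
    rw [mul_sub, sub_mul, Matrix.nonsing_inv_mul _ hdet, mul_assoc P⁻¹,
      Matrix.mul_nonsing_inv _ hdet']
    noncomm_ring
  have h3 : ∀ X : Matrix (Fin d) (Fin d) ℝ, ‖r * X * r‖ ≤ b * ‖X‖ := fun X =>
    calc _ ≤ ‖r‖ * ‖X‖ * ‖r‖ := (norm_mul_le _ _).trans (by gcongr; exact norm_mul_le _ _)
      _ = (‖r‖ * ‖r‖) * ‖X‖ := by ring
      _ ≤ b * ‖X‖ := by gcongr
  rw [e1] at hsub
  rw [e2]
  have h4 : ‖P' - P‖ ≤ b * ‖Q - Q'‖ / (2 * a) := by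
    rw [norm_sub_rev]
    exact hsub.trans (by gcongr; exact h3 _)
  calc _ ≤ b * ‖P⁻¹ * (P' - P) * P'⁻¹‖ := h3 _
    _ ≤ b * (‖P⁻¹‖ * ‖P' - P‖ * ‖P'⁻¹‖) := by
      gcongr; exact (norm_mul_le _ _).trans (by gcongr; exact norm_mul_le _ _)
    _ ≤ b * (a⁻¹ * (b * ‖Q - Q'‖ / (2 * a)) * a⁻¹) := by gcongr
    _ = b ^ 2 / (2 * a ^ 3) * ‖Q - Q'‖ := by field_simp

/-- The trace is bounded by the dimension times the operator norm. -/
theorem abs_trace_le (A : Matrix (Fin d) (Fin d) ℝ) : |A.trace| ≤ d * ‖A‖ := by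
  rw [Matrix.trace]
  refine (Finset.abs_sum_le_sum_abs _ _).trans ?_
  have : ∀ i, |A i i| ≤ ‖A‖ := fun i => by
    have h1 : A i i = ⟪EuclideanSpace.single i (1 : ℝ), op A (EuclideanSpace.single i 1)⟫ := by
      rw [Matrix.inner_toEuclideanCLM]; simp
    rw [h1]
    refine (abs_real_inner_le_norm _ _).trans ?_
    have := norm_op_apply_le A (EuclideanSpace.single i 1)
    simpa using this
  calc _ ≤ ∑ _i : Fin d, ‖A‖ := Finset.sum_le_sum fun i _ => by simpa using this i
    _ = _ := by simp

/-- The spectral window is stable under perturbations of the matrix. -/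
theorem SpecIn.of_norm_sub_le {ε : ℝ} (hS : SpecIn a b S) (hQ : Q.IsHermitian)
    (h : ‖Q - S‖ ≤ ε) : SpecIn (a - ε) (b + ε) Q := by
  have key : ∀ v : Vec d, |⟪v, op Q v⟫ - ⟪v, op S v⟫| ≤ ε * ‖v‖ ^ 2 := fun v => by
    rw [← inner_sub_right, ← sub_apply, ← map_sub]
    refine (abs_real_inner_le_norm _ _).trans ?_
    have := norm_op_apply_le (Q - S) v
    have h0 := norm_nonneg v
    nlinarith [mul_le_mul_of_nonneg_right h h0]
  refine ⟨hQ, fun v => ?_, fun v => ?_⟩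
  · have := hS.lower v
    have := abs_le.1 (key v)
    linarith
  · have := hS.upper v
    have := abs_le.1 (key v)
    linarith

end LinearAlgebra

/-! ### Gaussian measures on Euclidean space -/

section Gaussian

open scoped Matrix.Norms.L2Operator MatrixOrder RealInnerProductSpace

variable {d : ℕ}

theorem memLp_two_multivariateGaussian (m : Vec d) (S : Matrix (Fin d) (Fin d) ℝ) :
    MemLp (fun x => x) 2 (multivariateGaussian m S) := IsGaussian.memLp_two_id

/-- Every Gaussian measure on Euclidean space is given by a mean vector and a positive semidefinite
covariance matrix. -/
theorem exists_eq_multivariateGaussian (ξ : Measure (Vec d)) [IsGaussian ξ] :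
    ∃ (m : Vec d) (Q : Matrix (Fin d) (Fin d) ℝ), Q.PosSemidef ∧ ξ = multivariateGaussian m Q := by
  classical
  set b := EuclideanSpace.basisFun (Fin d) ℝ
  set Q : Matrix (Fin d) (Fin d) ℝ := Matrix.of fun i j => covarianceBilin ξ (b i) (b j)
  have hq : ∀ x y : Vec d, covarianceBilin ξ x y = x ⬝ᵥ Q *ᵥ y := fun x y => by
    conv_lhs => rw [← b.sum_repr x, ← b.sum_repr y]
    simp only [map_sum, map_smul, sum_apply, smul_apply,
      dotProduct, Matrix.mulVec, Q, Matrix.of_apply, smul_eq_mul, Finset.mul_sum]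
    rw [Finset.sum_comm]
    refine Finset.sum_congr rfl fun i _ => Finset.sum_congr rfl fun j _ => ?_
    simp [b]
    ring
  have hQ : Q.PosSemidef := by
    refine Matrix.PosSemidef.of_dotProduct_mulVec_nonneg ?_ fun x => ?_
    · ext i j
      simp [Q, covarianceBilin_comm]
    · have := covarianceBilin_self_nonneg (μ := ξ) (WithLp.toLp 2 x)
      rw [hq] at this
      simpa using this
  refine ⟨∫ x, x ∂ξ, Q, hQ, IsGaussian.ext (by simp) ?_⟩
  ext x y
  rw [covarianceBilin_multivariateGaussian hQ, hq]

theorem map_affine_multivariateGaussian {Q : Matrix (Fin d) (Fin d) ℝ} (hQ : Q.PosSemidef)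
    (m m' : Vec d) (A : Matrix (Fin d) (Fin d) ℝ) :
    (multivariateGaussian m Q).map (fun x => m' + op A (x - m))
      = multivariateGaussian m' (A * Q * Aᵀ) := by
  have hQ' : (A * Q * Aᵀ).PosSemidef := by
    have := hQ.mul_mul_conjTranspose_same A
    rwa [Matrix.conjTranspose_eq_transpose_of_trivial] at this
  have e : (fun x => m' + op A (x - m)) = (fun x => (m' - op A m) + x) ∘ (op A) := by
    ext1 x; simp [map_sub]; abel
  rw [e, ← Measure.map_map (measurable_const_add _) (op A).measurable]
  refine IsGaussian.ext ?_ ?_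
  · rw [integral_id_multivariateGaussian', integral_map (by fun_prop) (by fun_prop)]
    simp only [id]
    rw [integral_map (by fun_prop) (by fun_prop),
      integral_add (integrable_const _)
        ((op A).integrable_comp (IsGaussian.integrable_fun_id)),
      (op A).integral_comp_comm IsGaussian.integrable_fun_id]
    simp
  · ext x y
    have hadj : (op A).adjoint = op Aᵀ := by
      rw [← ContinuousLinearMap.star_eq_adjoint, ← map_star, Matrix.star_eq_conjTranspose,
        Matrix.conjTranspose_eq_transpose_of_trivial]
    rw [covarianceBilin_map_const_add, covarianceBilin_map IsGaussian.memLp_two_id, hadj,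
      covarianceBilin_multivariateGaussian hQ, covarianceBilin_multivariateGaussian hQ',
      ← Matrix.inner_toEuclideanCLM, ← Matrix.inner_toEuclideanCLM, mul_assoc]
    change _ = ⟪x, op (A * (Q * Aᵀ)) y⟫
    rw [op_mul_apply, op_mul_apply, inner_op_left, Matrix.transpose_transpose]

theorem integrable_inner_of_memLp {Ω E : Type*} [MeasurableSpace Ω] {μ : Measure Ω}
    [NormedAddCommGroup E] [InnerProductSpace ℝ E] {f g : Ω → E}
    (hf : MemLp f 2 μ) (hg : MemLp g 2 μ) : Integrable (fun x => ⟪f x, g x⟫) μ := by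
  have h1 : Integrable (fun x => ‖f x + g x‖ ^ 2) μ := (hf.add hg).integrable_norm_pow two_ne_zero
  have h2 : Integrable (fun x => ‖f x - g x‖ ^ 2) μ := (hf.sub hg).integrable_norm_pow two_ne_zero
  refine ((h1.sub h2).div_const 4).congr (ae_of_all _ fun x => ?_)
  simp only [Pi.sub_apply]
  rw [norm_add_sq_real, norm_sub_sq_real]
  ring

theorem lintegral_enorm_sq {Ω E : Type*} [MeasurableSpace Ω] {μ : Measure Ω}
    [NormedAddCommGroup E] {f : Ω → E} (hf : MemLp f 2 μ) :
    ∫⁻ x, ‖f x‖ₑ ^ 2 ∂μ = ENNReal.ofReal (∫ x, ‖f x‖ ^ 2 ∂μ) := by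
  rw [ofReal_integral_eq_lintegral_ofReal (hf.integrable_norm_pow two_ne_zero)
    (ae_of_all _ fun _ => by positivity)]
  refine lintegral_congr fun x => ?_
  rw [ENNReal.ofReal_pow (norm_nonneg _), ofReal_norm]

theorem integral_norm_sq_multivariateGaussian {S : Matrix (Fin d) (Fin d) ℝ} (hS : S.PosSemidef)
    (m : Vec d) : ∫ x, ‖x‖ ^ 2 ∂(multivariateGaussian m S) = ‖m‖ ^ 2 + S.trace := by
  have hL : MemLp (fun x : Vec d => x) 2 (multivariateGaussian m S) :=
    memLp_two_multivariateGaussian m S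
  have hk : ∀ k, MemLp (fun x : Vec d => x k) 2 (multivariateGaussian m S) := fun k =>
    hL.continuousLinearMap_comp (EuclideanSpace.proj k : Vec d →L[ℝ] ℝ)
  simp_rw [EuclideanSpace.real_norm_sq_eq]
  rw [integral_finsetSum _ fun k _ => (hk k).integrable_sq, Matrix.trace, ← Finset.sum_add_distrib]
  refine Finset.sum_congr rfl fun k _ => ?_
  have h1 := variance_eval_multivariateGaussian (μ := m) hS k
  rw [variance_eq_sub (hk k)] at h1
  have h2 : ∫ x : Vec d, x k ∂(multivariateGaussian m S) = m k := by
    have := (EuclideanSpace.proj k : Vec d →L[ℝ] ℝ).integral_comp_comm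
      (IsGaussian.integrable_fun_id (μ := multivariateGaussian m S))
    simpa using this
  rw [h2] at h1
  simp only [Matrix.diag_apply, ← h1, Pi.pow_apply]
  ring

theorem integral_inner_sq_multivariateGaussian {S : Matrix (Fin d) (Fin d) ℝ} (hS : S.PosSemidef)
    (m v : Vec d) : ∫ x, ⟪v, x - m⟫ ^ 2 ∂(multivariateGaussian m S) = ⟪v, op S v⟫ := by
  have := covarianceBilin_apply (μ := multivariateGaussian m S) IsGaussian.memLp_two_id v v
  rw [integral_id_multivariateGaussian', covarianceBilin_multivariateGaussian hS,
    ← Matrix.inner_toEuclideanCLM] at this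
  simp_rw [this, sq]

/-! ### Wasserstein distance between Gaussian measures -/

theorem W2_sq (μ ν : Measure (Vec d)) : W2 μ ν ^ 2
    = ⨅ (π : Measure (Vec d × Vec d)) (_ : IsCoupling μ ν π), ∫⁻ z, ‖z.1 - z.2‖ₑ ^ 2 ∂π := by
  rw [W2, ← ENNReal.rpow_natCast, ← ENNReal.rpow_mul]
  norm_num

theorem W2_sq_le {μ ν : Measure (Vec d)} {π : Measure (Vec d × Vec d)} (hπ : IsCoupling μ ν π) :
    W2 μ ν ^ 2 ≤ ∫⁻ z, ‖z.1 - z.2‖ₑ ^ 2 ∂π := by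
  rw [W2_sq]; exact iInf₂_le π hπ

theorem IsCoupling.swap {μ ν : Measure (Vec d)} {π : Measure (Vec d × Vec d)}
    (hπ : IsCoupling μ ν π) : IsCoupling ν μ (π.map Prod.swap) := by
  refine ⟨?_, ?_⟩
  · rw [Measure.map_map measurable_fst measurable_swap]; exact hπ.2
  · rw [Measure.map_map measurable_snd measurable_swap]; exact hπ.1

theorem IsCoupling.isProbabilityMeasure {μ ν : Measure (Vec d)} {π : Measure (Vec d × Vec d)}
    [IsProbabilityMeasure μ] (hπ : IsCoupling μ ν π) : IsProbabilityMeasure π := by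
  refine ⟨?_⟩
  have : (π.map Prod.fst) Set.univ = 1 := by rw [hπ.1]; exact measure_univ
  rwa [Measure.map_apply measurable_fst MeasurableSet.univ] at this

theorem lintegral_swap_cost (π : Measure (Vec d × Vec d)) :
    ∫⁻ z, ‖z.1 - z.2‖ₑ ^ 2 ∂(π.map Prod.swap) = ∫⁻ z, ‖z.1 - z.2‖ₑ ^ 2 ∂π := by
  rw [lintegral_map (by fun_prop) measurable_swap]
  refine lintegral_congr fun z => ?_
  simp only [Prod.fst_swap, Prod.snd_swap]
  rw [← neg_sub, enorm_neg]

theorem W2_comm (μ ν : Measure (Vec d)) : W2 μ ν = W2 ν μ := by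
  have key : ∀ μ ν : Measure (Vec d), W2 μ ν ^ 2 ≤ W2 ν μ ^ 2 := fun μ ν => by
    rw [W2_sq ν μ]
    refine le_iInf₂ fun π hπ => ?_
    rw [← lintegral_swap_cost]
    exact W2_sq_le hπ.swap
  have h := le_antisymm (key μ ν) (key ν μ)
  exact (ENNReal.pow_right_strictMono two_ne_zero).injective h

theorem isCoupling_map {μ ν : Measure (Vec d)} {T : Vec d → Vec d} (hT : Measurable T)
    (h : μ.map T = ν) : IsCoupling μ ν (μ.map fun x => (x, T x)) := by
  refine ⟨?_, ?_⟩
  · rw [Measure.map_map measurable_fst (by fun_prop)]; exact Measure.map_id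
  · rw [Measure.map_map measurable_snd (by fun_prop)]; exact h

theorem lintegral_cost_map {μ : Measure (Vec d)} {T : Vec d → Vec d} (hT : Measurable T) :
    ∫⁻ z, ‖z.1 - z.2‖ₑ ^ 2 ∂(μ.map fun x => (x, T x)) = ∫⁻ x, ‖x - T x‖ₑ ^ 2 ∂μ := by
  rw [lintegral_map (by fun_prop) (by fun_prop)]

theorem W2_self (μ : Measure (Vec d)) : W2 μ μ = 0 := by
  have h := W2_sq_le (isCoupling_map (μ := μ) measurable_id Measure.map_id)
  rw [lintegral_cost_map measurable_id] at h
  simpa using h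

theorem IsCoupling.memLp {μ ν : Measure (Vec d)} {π : Measure (Vec d × Vec d)}
    (hπ : IsCoupling μ ν π) (hμ : MemLp (fun x => x) 2 μ) (hν : MemLp (fun x => x) 2 ν) :
    MemLp Prod.fst 2 π ∧ MemLp Prod.snd 2 π := by
  obtain ⟨rfl, rfl⟩ := hπ
  exact ⟨(memLp_map_measure_iff (g := fun x => x) (by fun_prop) (by fun_prop)).1 hμ,
    (memLp_map_measure_iff (g := fun x => x) (by fun_prop) (by fun_prop)).1 hν⟩

/-- Every coupling with a Dirac mass at `0` has the second moment as its cost. -/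
theorem W2_dirac_sq {S : Matrix (Fin d) (Fin d) ℝ} (hS : S.PosSemidef) (m : Vec d) :
    W2 (Measure.dirac 0) (multivariateGaussian m S) ^ 2
      = ENNReal.ofReal (‖m‖ ^ 2 + S.trace) := by
  have key : ∀ π, IsCoupling (Measure.dirac 0) (multivariateGaussian m S) π →
      ∫⁻ z, ‖z.1 - z.2‖ₑ ^ 2 ∂π = ENNReal.ofReal (‖m‖ ^ 2 + S.trace) := fun π hπ => by
    have h0 : ∀ᵐ z ∂π, z.1 = 0 := by
      have : ∀ᵐ x ∂(π.map Prod.fst), x = 0 := by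
        rw [hπ.1, ae_dirac_eq]; rfl
      exact ae_of_ae_map (by fun_prop) this
    rw [← integral_norm_sq_multivariateGaussian hS,
      ← lintegral_enorm_sq (memLp_two_multivariateGaussian m S), ← hπ.2,
      lintegral_map (by fun_prop) measurable_snd]
    refine lintegral_congr_ae ?_
    filter_upwards [h0] with z hz
    rw [hz, zero_sub, enorm_neg]
  rw [W2_sq]
  refine le_antisymm ?_ (le_iInf₂ fun π hπ => (key π hπ).ge)
  have hπ : IsCoupling (Measure.dirac (0 : Vec d)) (multivariateGaussian m S)
      ((Measure.dirac 0).prod (multivariateGaussian m S)) := by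
    refine ⟨?_, ?_⟩ <;> simp
  exact iInf₂_le_of_le _ hπ (key _ hπ).le

/-- The affine map sending the mean `m` to `m'` with linear part `A`. -/
noncomputable def affineMap (m m' : Vec d) (A : Matrix (Fin d) (Fin d) ℝ) (x : Vec d) : Vec d :=
  m' + op A (x - m)

theorem continuous_affineMap (m m' : Vec d) (A : Matrix (Fin d) (Fin d) ℝ) :
    Continuous (affineMap m m' A) := by unfold affineMap; fun_prop

variable {a b : ℝ} {Q S : Matrix (Fin d) (Fin d) ℝ}

theorem map_transport (ha : 0 < a) (hb : 0 ≤ b) (hQ : SpecIn a b Q) (hS : SpecIn a b S)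
    (m m' : Vec d) :
    (multivariateGaussian m Q).map (affineMap m m' (transport Q S))
      = multivariateGaussian m' S := by
  unfold affineMap
  rw [map_affine_multivariateGaussian (hQ.posSemidef ha.le)]
  have h1 : (transport Q S)ᵀ = transport Q S := by
    rw [← Matrix.conjTranspose_eq_transpose_of_trivial]
    exact (transport_posDef ha hb hQ hS).1.eq
  rw [h1, transport_mul_mul ha hb hQ hS]

/-- Kantorovich duality for two nondegenerate Gaussian measures in quantitative form: the cost of
any coupling exceeds that of the affine map `T` with linear part `A = transport Q S` by the
integral of `⟪A⁻¹ (y - T x), y - T x⟫`. Indeed `‖x - y‖² - ‖x - T x‖² - ⟪A⁻¹ (y - T x), y - T x⟫`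
has the form `g y - g (T x)`, whose integral vanishes. -/
theorem lintegral_cost_eq (ha : 0 < a) (hb : 0 ≤ b) (hQ : SpecIn a b Q) (hS : SpecIn a b S)
    (m m' : Vec d) {π : Measure (Vec d × Vec d)}
    (hπ : IsCoupling (multivariateGaussian m Q) (multivariateGaussian m' S) π) :
    ∫⁻ z, ‖z.1 - z.2‖ₑ ^ 2 ∂π
      = ∫⁻ x, ‖x - affineMap m m' (transport Q S) x‖ₑ ^ 2 ∂(multivariateGaussian m Q)
        + ∫⁻ z, ENNReal.ofReal ⟪op (transport Q S)⁻¹ (z.2 - affineMap m m' (transport Q S) z.1),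
            z.2 - affineMap m m' (transport Q S) z.1⟫ ∂π := by
  have hA := transport_posDef ha hb hQ hS
  have hmap := map_transport ha hb hQ hS m m'
  set A := transport Q S
  have hdet : IsUnit A.det := (Matrix.isUnit_iff_isUnit_det _).1 hA.isUnit
  set T := affineMap m m' A with hTdef
  have hTm : Measurable T := (continuous_affineMap m m' A).measurable
  have hB : (A⁻¹).PosDef := hA.inv
  set B := A⁻¹
  have hBA : ∀ v, op B (op A v) = v := fun v => by
    rw [← op_mul_apply, Matrix.nonsing_inv_mul _ hdet]; simp [op]
  have := hπ.isProbabilityMeasure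
  obtain ⟨hx, hy⟩ := hπ.memLp (memLp_two_multivariateGaussian m Q)
    (memLp_two_multivariateGaussian m' S)
  have hTx : MemLp (fun z : Vec d × Vec d => T z.1) 2 π :=
    (memLp_const m').add ((hx.sub (memLp_const m)).continuousLinearMap_comp (op A))
  have hr : MemLp (fun z : Vec d × Vec d => z.2 - T z.1) 2 π := hy.sub hTx
  have hBr : MemLp (fun z : Vec d × Vec d => op B (z.2 - T z.1)) 2 π :=
    hr.continuousLinearMap_comp (op B)
  have i1 : Integrable (fun z : Vec d × Vec d => ‖z.1 - z.2‖ ^ 2) π :=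
    (hx.sub hy).integrable_norm_pow two_ne_zero
  have i2 : Integrable (fun z : Vec d × Vec d => ‖z.1 - T z.1‖ ^ 2) π :=
    (hx.sub hTx).integrable_norm_pow two_ne_zero
  have i3 := integrable_inner_of_memLp hBr hr
  have hBnn : ∀ v : Vec d, 0 ≤ ⟪op B v, v⟫ := fun v => by
    rw [real_inner_comm, Matrix.inner_toEuclideanCLM]
    simpa using hB.posSemidef.re_dotProduct_nonneg (WithLp.ofLp v)
  -- the dual potential that makes the pointwise identity `hpt` hold
  set g : Vec d → ℝ := fun y => ‖y‖ ^ 2 - ⟪op B (y - m'), y - m'⟫ - 2 * ⟪m, y⟫ with hg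
  have hgi : Integrable g (multivariateGaussian m' S) := by
    have hid := memLp_two_multivariateGaussian m' S
    have h1 : MemLp (fun y : Vec d => y - m') 2 (multivariateGaussian m' S) :=
      hid.sub (memLp_const m')
    refine ((hid.integrable_norm_pow two_ne_zero).sub (integrable_inner_of_memLp
      (h1.continuousLinearMap_comp (op B)) h1)).sub ?_
    exact (integrable_inner_of_memLp (memLp_const m) hid).const_mul 2
  have hpt : ∀ z : Vec d × Vec d, ‖z.1 - z.2‖ ^ 2 - ‖z.1 - T z.1‖ ^ 2
      - ⟪op B (z.2 - T z.1), z.2 - T z.1⟫ = g z.2 - g (T z.1) := fun z => by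
    obtain ⟨x, y⟩ := z
    have e1 : T x - m' = op A (x - m) := by simp [hTdef, affineMap]
    have e2 : y - T x = (y - m') - op A (x - m) := by rw [← e1]; abel
    have e3 : ⟪op B (y - m'), op A (x - m)⟫ = ⟪y - m', x - m⟫ := by
      rw [IsHermitian.inner_op hB.1, hBA]
    have e4 : T x = m' + op A (x - m) := rfl
    simp only [hg]
    rw [e1, e2, map_sub, hBA]
    simp only [inner_sub_left, inner_sub_right, norm_sub_sq_real] at e3 ⊢
    rw [e4]
    simp only [norm_add_sq_real, inner_add_right, map_sub, inner_sub_left, inner_sub_right] at e3 ⊢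
    simp only [real_inner_comm x y, real_inner_comm m y] at e3 ⊢
    have c1 := real_inner_comm x m'
    have c2 := real_inner_comm m m'
    linarith
  have hint : ∫ z, ‖z.1 - z.2‖ ^ 2 ∂π - ∫ z, ‖z.1 - T z.1‖ ^ 2 ∂π
      - ∫ z, ⟪op B (z.2 - T z.1), z.2 - T z.1⟫ ∂π = 0 := by
    have hπT : π.map (fun z => T z.1) = multivariateGaussian m' S := by
      rw [← hmap, ← hπ.1, Measure.map_map hTm measurable_fst]; rfl
    have j1 : Integrable (fun z : Vec d × Vec d => g z.2) π := by
      rw [← hπ.2] at hgi; exact hgi.comp_measurable measurable_snd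
    have j2 : Integrable (fun z : Vec d × Vec d => g (T z.1)) π := by
      rw [← hπT] at hgi; exact hgi.comp_measurable (by fun_prop)
    have k1 : ∫ z, g z.2 ∂π = ∫ y, g y ∂(multivariateGaussian m' S) := by
      rw [← hπ.2, integral_map (by fun_prop) (by fun_prop)]
    have k2 : ∫ z, g (T z.1) ∂π = ∫ y, g y ∂(multivariateGaussian m' S) := by
      rw [← hπT, integral_map (by fun_prop) (by fun_prop)]
    have i12 : Integrable (fun z : Vec d × Vec d => ‖z.1 - z.2‖ ^ 2 - ‖z.1 - T z.1‖ ^ 2) π :=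
      i1.sub i2
    rw [← integral_sub i1 i2, ← integral_sub i12 i3]
    calc _ = ∫ z, (g z.2 - g (T z.1)) ∂π := integral_congr_ae (ae_of_all _ hpt)
      _ = 0 := by rw [integral_sub j1 j2, k1, k2, sub_self]
  have l2 : ∫⁻ x, ‖x - T x‖ₑ ^ 2 ∂(multivariateGaussian m Q)
      = ENNReal.ofReal (∫ z, ‖z.1 - T z.1‖ ^ 2 ∂π) := by
    have := lintegral_enorm_sq (hx.sub hTx)
    simp only [Pi.sub_apply] at this
    rw [← this, ← hπ.1, lintegral_map (by fun_prop) measurable_fst]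
  have l1 : ∫⁻ z, ‖z.1 - z.2‖ₑ ^ 2 ∂π = ENNReal.ofReal (∫ z, ‖z.1 - z.2‖ ^ 2 ∂π) :=
    lintegral_enorm_sq (hx.sub hy)
  rw [l1, l2, ← ofReal_integral_eq_lintegral_ofReal i3 (ae_of_all _ fun z => hBnn _),
    ← ENNReal.ofReal_add (integral_nonneg fun _ => by positivity)
      (integral_nonneg fun _ => hBnn _)]
  congr 1
  linarith

theorem isOptimalMap_transport (ha : 0 < a) (hb : 0 ≤ b) (hQ : SpecIn a b Q) (hS : SpecIn a b S)
    (m m' : Vec d) :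
    IsOptimalMap (multivariateGaussian m Q) (multivariateGaussian m' S)
      (affineMap m m' (transport Q S)) := by
  have hTm : Measurable (affineMap m m' (transport Q S)) := (continuous_affineMap _ _ _).measurable
  have hmap := map_transport ha hb hQ hS m m'
  refine ⟨hTm, hmap, le_antisymm ?_ ?_⟩
  · rw [W2_sq]
    refine le_iInf₂ fun π hπ => ?_
    rw [lintegral_cost_eq ha hb hQ hS m m' hπ]
    exact le_self_add
  · rw [← lintegral_cost_map hTm]
    exact W2_sq_le (isCoupling_map hTm hmap)

theorem lintegral_cost_transport (ha : 0 < a) (hb : 0 ≤ b) (hQ : SpecIn a b Q)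
    (hS : SpecIn a b S) (m m' : Vec d) :
    ∫⁻ x, ‖x - affineMap m m' (transport Q S) x‖ₑ ^ 2 ∂(multivariateGaussian m Q)
      = ENNReal.ofReal
        (‖m - m'‖ ^ 2 + Q.trace + S.trace - 2 * (transport Q S * Q).trace) := by
  set A := transport Q S
  have hAt : Aᵀ = A := by
    rw [← Matrix.conjTranspose_eq_transpose_of_trivial]
    exact (transport_posDef ha hb hQ hS).1.eq
  have hAQA : A * Q * A = S := transport_mul_mul ha hb hQ hS
  have e : (fun x => x - affineMap m m' A x) = fun x => (m - m') + op (1 - A) (x - m) := by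
    ext1 x
    simp only [affineMap, op, map_sub, map_one, sub_apply,
      one_apply_eq_self]
    abel
  have hP := hQ.posSemidef ha.le
  have hmap := map_affine_multivariateGaussian hP m (m - m') (1 - A)
  have hP' : ((1 - A) * Q * (1 - A)ᵀ).PosSemidef := by
    have := hP.mul_mul_conjTranspose_same (1 - A)
    rwa [Matrix.conjTranspose_eq_transpose_of_trivial] at this
  have h1 : ∫⁻ x, ‖x - affineMap m m' A x‖ₑ ^ 2 ∂(multivariateGaussian m Q)
      = ∫⁻ y, ‖y‖ₑ ^ 2 ∂(multivariateGaussian (m - m') ((1 - A) * Q * (1 - A)ᵀ)) := by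
    rw [← hmap, ← e, lintegral_map (by fun_prop)]
    exact measurable_id.sub (continuous_affineMap _ _ _).measurable
  rw [h1, lintegral_enorm_sq (memLp_two_multivariateGaussian _ _),
    integral_norm_sq_multivariateGaussian hP']
  congr 1
  rw [Matrix.transpose_sub, Matrix.transpose_one, hAt]
  have : (1 - A) * Q * (1 - A) = Q - A * Q - Q * A + S := by
    rw [← hAQA]; noncomm_ring
  rw [this, Matrix.trace_add, Matrix.trace_sub, Matrix.trace_sub, Matrix.trace_mul_comm Q A]
  ring

/-- The squared Bures-Wasserstein distance of `𝒩(m, Q)` and `𝒩(m', S)`, written with the transport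
matrix. -/
noncomputable def bures (m : Vec d) (Q : Matrix (Fin d) (Fin d) ℝ) (m' : Vec d)
    (S : Matrix (Fin d) (Fin d) ℝ) : ℝ :=
  ‖m - m'‖ ^ 2 + Q.trace + S.trace - 2 * (transport Q S * Q).trace

theorem W2_sq_multivariateGaussian (ha : 0 < a) (hb : 0 ≤ b) (hQ : SpecIn a b Q)
    (hS : SpecIn a b S) (m m' : Vec d) :
    W2 (multivariateGaussian m Q) (multivariateGaussian m' S) ^ 2
      = ENNReal.ofReal (bures m Q m' S) := by
  rw [← (isOptimalMap_transport ha hb hQ hS m m').2.2, lintegral_cost_transport ha hb hQ hS]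
  rfl

/-- Optimal maps between nondegenerate Gaussian measures are unique almost everywhere: the excess
cost in `lintegral_cost_eq` is a positive definite form in `T x - (affine map) x`. -/
theorem IsOptimalMap.ae_eq_transport (ha : 0 < a) (hb : 0 ≤ b) (hQ : SpecIn a b Q)
    (hS : SpecIn a b S) {m m' : Vec d} {T : Vec d → Vec d}
    (hT : IsOptimalMap (multivariateGaussian m Q) (multivariateGaussian m' S) T) :
    T =ᵐ[multivariateGaussian m Q] affineMap m m' (transport Q S) := by
  have h := lintegral_cost_eq ha hb hQ hS m m' (isCoupling_map hT.1 hT.2.1)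
  have hB : ((transport Q S)⁻¹).PosDef := (transport_posDef ha hb hQ hS).inv
  have hA := (continuous_affineMap m m' (transport Q S)).measurable
  rw [lintegral_cost_map hT.1, hT.2.2, (isOptimalMap_transport ha hb hQ hS m m').2.2] at h
  have hfin : W2 (multivariateGaussian m Q) (multivariateGaussian m' S) ^ 2 ≠ ∞ := by
    rw [W2_sq_multivariateGaussian ha hb hQ hS]; exact ENNReal.ofReal_ne_top
  have h0 := (ENNReal.add_right_inj hfin).1 (h.symm.trans (add_zero _).symm)
  rw [lintegral_map (by fun_prop) (by have := hT.1; fun_prop),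
    lintegral_eq_zero_iff (by have := hT.1; fun_prop)] at h0
  filter_upwards [h0] with x hx
  by_contra hne
  have hv : T x - affineMap m m' (transport Q S) x ≠ 0 := sub_ne_zero.2 hne
  set v := T x - affineMap m m' (transport Q S) x
  have hpos : 0 < ⟪op (transport Q S)⁻¹ v, v⟫ := by
    rw [real_inner_comm, Matrix.inner_toEuclideanCLM]
    have := hB.re_dotProduct_pos (x := WithLp.ofLp v) (by simpa using hv)
    simpa using this
  simp only [Pi.zero_apply, ENNReal.ofReal_eq_zero] at hx
  linarith

theorem otMap_ae_eq (ha : 0 < a) (hb : 0 ≤ b) (hQ : SpecIn a b Q)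
    (hS : SpecIn a b S) (m m' : Vec d) :
    otMap (multivariateGaussian m Q) (multivariateGaussian m' S)
      =ᵐ[multivariateGaussian m Q] affineMap m m' (transport Q S) := by
  have hex : ∃ T, IsOptimalMap (multivariateGaussian m Q) (multivariateGaussian m' S) T :=
    ⟨_, isOptimalMap_transport ha hb hQ hS m m'⟩
  have : IsOptimalMap (multivariateGaussian m Q) (multivariateGaussian m' S)
      (otMap (multivariateGaussian m Q) (multivariateGaussian m' S)) := by
    rw [otMap, dif_pos hex]; exact hex.choose_spec
  exact this.ae_eq_transport ha hb hQ hS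

end Gaussian

/-! ### Perturbation bounds for softmax weights, averages and the Bures distance -/

/-- The softmax weights of a vector of energies `e` at inverse temperature `β`. -/
noncomputable def softmax {N : ℕ} (β : ℝ) (e : Fin N → ℝ) (j : Fin N) : ℝ :=
  Real.exp (-β * e j) / ∑ k, Real.exp (-β * e k)

section Softmax

variable {N : ℕ} {β : ℝ} {e e' : Fin N → ℝ}

theorem softmax_denom_pos (i : Fin N) : 0 < ∑ k, Real.exp (-β * e k) :=
  Finset.sum_pos (fun _ _ => Real.exp_pos _) ⟨i, Finset.mem_univ i⟩

theorem softmax_pos (j : Fin N) : 0 < softmax β e j :=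
  div_pos (Real.exp_pos _) (softmax_denom_pos j)

theorem sum_softmax (i : Fin N) : ∑ j, softmax β e j = 1 := by
  unfold softmax
  rw [← Finset.sum_div, div_self (softmax_denom_pos i).ne']

theorem softmax_le_exp (i j : Fin N) : softmax β e j ≤ Real.exp (-β * (e j - e i)) := by
  unfold softmax
  rw [div_le_iff₀ (softmax_denom_pos j)]
  have : Real.exp (-β * e i) ≤ ∑ k, Real.exp (-β * e k) :=
    Finset.single_le_sum (f := fun k => Real.exp (-β * e k))
      (fun k _ => (Real.exp_pos _).le) (Finset.mem_univ i)
  calc Real.exp (-β * e j) = Real.exp (-β * (e j - e i)) * Real.exp (-β * e i) := by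
        rw [← Real.exp_add]; ring_nf
    _ ≤ _ := by gcongr

theorem softmax_le_mul_exp (hβ : 0 ≤ β) {η : ℝ} (h : ∀ k, |e k - e' k| ≤ η) (j : Fin N) :
    softmax β e' j ≤ softmax β e j * Real.exp (2 * β * η) := by
  have hk := fun k => abs_le.1 (h k)
  unfold softmax
  rw [div_mul_eq_mul_div, div_le_div_iff₀ (softmax_denom_pos j) (softmax_denom_pos j)]
  have h1 : ∑ k, Real.exp (-β * e k) ≤ Real.exp (β * η) * ∑ k, Real.exp (-β * e' k) := by
    rw [Finset.mul_sum]
    refine Finset.sum_le_sum fun k _ => ?_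
    rw [← Real.exp_add]
    apply Real.exp_le_exp.2
    nlinarith [(hk k).1]
  have h2 : Real.exp (-β * e' j) ≤ Real.exp (β * η) * Real.exp (-β * e j) := by
    rw [← Real.exp_add]
    apply Real.exp_le_exp.2
    nlinarith [(hk j).2]
  calc _ ≤ (Real.exp (β * η) * Real.exp (-β * e j))
        * (Real.exp (β * η) * ∑ k, Real.exp (-β * e' k)) := by gcongr
    _ = Real.exp (-β * e j) * (Real.exp (β * η) * Real.exp (β * η))
        * ∑ k, Real.exp (-β * e' k) := by ring
    _ = _ := by rw [← Real.exp_add]; ring_nf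

/-- Small softmax weights change little: the bound is relative to the size of the weight. -/
theorem abs_softmax_sub_le (hβ : 0 ≤ β) {η W : ℝ} (h : ∀ k, |e k - e' k| ≤ η) (j : Fin N)
    (hj : softmax β e j ≤ W) (hj' : softmax β e' j ≤ W) :
    |softmax β e j - softmax β e' j| ≤ W * (2 * β * η) := by
  have key : ∀ u v : ℝ, 0 < u → u ≤ W → u ≤ v * Real.exp (2 * β * η) →
      u - v ≤ W * (2 * β * η) := fun u v hu huW huv => by
    have hη : 0 ≤ 2 * β * η := by have := (abs_nonneg _).trans (h j); positivity
    have h1 : u * Real.exp (-(2 * β * η)) ≤ v := by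
      rw [Real.exp_neg, ← div_eq_mul_inv, div_le_iff₀ (Real.exp_pos _)]; exact huv
    have h2 := Real.add_one_le_exp (-(2 * β * η))
    nlinarith
  rw [abs_le]
  have h' : ∀ k, |e' k - e k| ≤ η := fun k => by rw [abs_sub_comm]; exact h k
  have h1 := key _ _ (softmax_pos j) hj (softmax_le_mul_exp hβ h' j)
  have h2 := key _ _ (softmax_pos j) hj' (softmax_le_mul_exp hβ h j)
  constructor <;> linarith

end Softmax

section WeightedSum

variable {N : ℕ} {V : Type*} [NormedAddCommGroup V] [NormedSpace ℝ V] {w w' : Fin N → ℝ}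
  {u u' : Fin N → V} {i : Fin N} {W U ℓ θ : ℝ}

/-- Only the foreign weights `w j`, `j ≠ i`, contribute to `∑ j, w j • (u j - u i)`. -/
theorem norm_sum_smul_sub_le (hw : ∀ j, j ≠ i → |w j| ≤ W) (hW : 0 ≤ W) (hU : 0 ≤ U)
    (hu : ∀ j, ‖u j - u i‖ ≤ U) : ‖∑ j, w j • (u j - u i)‖ ≤ N * (W * U) := by
  have : ∀ j ∈ Finset.univ, ‖w j • (u j - u i)‖ ≤ W * U := fun j _ => by
    by_cases hj : j = i
    · subst hj; simp only [sub_self, smul_zero, norm_zero]; positivity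
    · rw [norm_smul, Real.norm_eq_abs]
      gcongr
      · exact hw j hj
      · exact hu j
  simpa using norm_sum_le_of_le _ this

theorem norm_sum_smul_sub_sub_le (hw' : ∀ j, j ≠ i → |w' j| ≤ W) (hW : 0 ≤ W) (hU : 0 ≤ U)
    (hθ : 0 ≤ θ) (hℓ : 0 ≤ ℓ)
    (hww : ∀ j, j ≠ i → |w j - w' j| ≤ θ)
    (hu : ∀ j, ‖u j - u i‖ ≤ U) (huu : ∀ j, ‖u j - u' j‖ ≤ ℓ) :
    ‖∑ j, w j • (u j - u i) - ∑ j, w' j • (u' j - u' i)‖ ≤ N * (θ * U + W * (2 * ℓ)) := by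
  rw [← Finset.sum_sub_distrib]
  have : ∀ j ∈ Finset.univ, ‖w j • (u j - u i) - w' j • (u' j - u' i)‖
      ≤ θ * U + W * (2 * ℓ) := fun j _ => by
    by_cases hj : j = i
    · subst hj; simp only [sub_self, smul_zero, norm_zero]; positivity
    · have e : w j • (u j - u i) - w' j • (u' j - u' i)
          = (w j - w' j) • (u j - u i) + w' j • ((u j - u' j) - (u i - u' i)) := by
        module
      rw [e]
      refine (norm_add_le _ _).trans ?_
      rw [norm_smul, norm_smul, Real.norm_eq_abs, Real.norm_eq_abs]
      have h3 : ‖(u j - u' j) - (u i - u' i)‖ ≤ 2 * ℓ := by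
        refine (norm_sub_le _ _).trans ?_
        linarith [huu j, huu i]
      gcongr
      · exact hww j hj
      · exact hu j
      · exact hw' j hj
  have h := norm_sum_le_of_le _ this
  rwa [Finset.sum_const, Finset.card_univ, Fintype.card_fin, nsmul_eq_mul] at h

theorem sum_smul_eq_add (hw : ∑ j, w j = 1) : ∑ j, w j • u j = u i + ∑ j, w j • (u j - u i) := by
  simp_rw [smul_sub]
  rw [Finset.sum_sub_distrib, ← Finset.sum_smul, hw]
  module

end WeightedSum

section Perturbation

theorem norm_mul3_sub_le {𝓐 : Type*} [NormedRing 𝓐] {x x' y y' z z' : 𝓐} {X Y Z α β γ : ℝ}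
    (hx' : ‖x'‖ ≤ X) (hy : ‖y‖ ≤ Y) (hy' : ‖y'‖ ≤ Y) (hz : ‖z‖ ≤ Z)
    (hxx : ‖x - x'‖ ≤ α) (hyy : ‖y - y'‖ ≤ β) (hzz : ‖z - z'‖ ≤ γ) :
    ‖x * y * z - x' * y' * z'‖ ≤ α * Y * Z + X * β * Z + X * Y * γ := by
  have e : x * y * z - x' * y' * z'
      = (x - x') * y * z + x' * (y - y') * z + x' * y' * (z - z') := by noncomm_ring
  have h3 : ∀ p q r : 𝓐, ‖p * q * r‖ ≤ ‖p‖ * ‖q‖ * ‖r‖ := fun p q r =>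
    (norm_mul_le _ _).trans (by gcongr; exact norm_mul_le _ _)
  have hX := (norm_nonneg _).trans hx'
  have hY := (norm_nonneg _).trans hy
  have hZ := (norm_nonneg _).trans hz
  have hα := (norm_nonneg _).trans hxx
  have hβ := (norm_nonneg _).trans hyy
  have hγ := (norm_nonneg _).trans hzz
  rw [e]
  refine (norm_add_le _ _).trans (add_le_add ((norm_add_le _ _).trans (add_le_add ?_ ?_)) ?_)
  · exact (h3 _ _ _).trans (by gcongr)
  · exact (h3 _ _ _).trans (by gcongr)
  · exact (h3 _ _ _).trans (by gcongr)

open scoped Matrix.Norms.L2Operator MatrixOrder RealInnerProductSpace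

variable {d : ℕ} {a b : ℝ} {Q Q' S : Matrix (Fin d) (Fin d) ℝ}

/-- The squared Bures-Wasserstein distance is Lipschitz in its first argument, as long as the means
stay within distance `D`. The factor `d` comes from comparing the trace with the operator norm. -/
theorem abs_bures_sub_le (ha : 0 < a) (hb : 0 ≤ b) (hQ : SpecIn a b Q) (hQ' : SpecIn a b Q')
    (hS : SpecIn a b S) {m m' p : Vec d} {D : ℝ} (hm : ‖m - p‖ ≤ D) (hm' : ‖m' - p‖ ≤ D) :
    |bures m Q p S - bures m' Q' p S|
      ≤ 2 * D * ‖m - m'‖ + d * (1 + 2 * (b / a) + b ^ 3 / a ^ 3) * ‖Q - Q'‖ := by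
  have h1 : |‖m - p‖ ^ 2 - ‖m' - p‖ ^ 2| ≤ 2 * D * ‖m - m'‖ := by
    have h := abs_norm_sub_norm_le (m - p) (m' - p)
    rw [sub_sub_sub_cancel_right] at h
    rw [sq_sub_sq, abs_mul, abs_of_nonneg (by positivity)]
    have hD : 0 ≤ D := (norm_nonneg _).trans hm
    gcongr
    linarith
  have h2 : |Q.trace - Q'.trace| ≤ d * ‖Q - Q'‖ := by
    rw [← Matrix.trace_sub]; exact abs_trace_le _
  have h3 : |(transport Q S * Q).trace - (transport Q' S * Q').trace|
      ≤ d * ((b / a + b ^ 3 / (2 * a ^ 3)) * ‖Q - Q'‖) := by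
    rw [← Matrix.trace_sub]
    refine (abs_trace_le _).trans ?_
    gcongr
    have e : transport Q S * Q - transport Q' S * Q'
        = transport Q S * (Q - Q') + (transport Q S - transport Q' S) * Q' := by noncomm_ring
    rw [e]
    calc _ ≤ ‖transport Q S‖ * ‖Q - Q'‖ + ‖transport Q S - transport Q' S‖ * ‖Q'‖ :=
          (norm_add_le _ _).trans (add_le_add (norm_mul_le _ _) (norm_mul_le _ _))
      _ ≤ b / a * ‖Q - Q'‖ + (b ^ 2 / (2 * a ^ 3) * ‖Q - Q'‖) * b := by
          gcongr
          · exact norm_transport_le ha hb hQ hS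
          · exact norm_transport_sub_le ha hb hQ hQ' hS
          · exact hQ'.norm_le ha.le hb
      _ = _ := by field_simp
  have e : bures m Q p S - bures m' Q' p S = (‖m - p‖ ^ 2 - ‖m' - p‖ ^ 2) + (Q.trace - Q'.trace)
      - 2 * ((transport Q S * Q).trace - (transport Q' S * Q').trace) := by
    unfold bures; ring
  have e2 : (d : ℝ) * (1 + 2 * (b / a) + b ^ 3 / a ^ 3) * ‖Q - Q'‖ = d * ‖Q - Q'‖
      + 2 * (d * ((b / a + b ^ 3 / (2 * a ^ 3)) * ‖Q - Q'‖)) := by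
    field_simp
    ring
  rw [e, e2]
  rw [abs_le] at *
  constructor <;> linarith

/-- The remaining part of the squared distance is the trace of `(1 - A) Q (1 - A)`, where `A` is
the transport matrix. -/
theorem norm_sq_le_bures (ha : 0 < a) (hb : 0 ≤ b) (hQ : SpecIn a b Q) (hS : SpecIn a b S)
    (m p : Vec d) : ‖m - p‖ ^ 2 ≤ bures m Q p S := by
  have hAt : (transport Q S)ᵀ = transport Q S := by
    rw [← Matrix.conjTranspose_eq_transpose_of_trivial]
    exact (transport_posDef ha hb hQ hS).1.eq
  have hAQA : transport Q S * Q * transport Q S = S := transport_mul_mul ha hb hQ hS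
  have h0 := ((hQ.posSemidef ha.le).mul_mul_conjTranspose_same (1 - transport Q S)).trace_nonneg
  rw [Matrix.conjTranspose_eq_transpose_of_trivial, Matrix.transpose_sub, Matrix.transpose_one,
    hAt] at h0
  have e : (1 - transport Q S) * Q * (1 - transport Q S)
      = Q - transport Q S * Q - Q * transport Q S + transport Q S * Q * transport Q S := by
    noncomm_ring
  rw [e, hAQA, Matrix.trace_add, Matrix.trace_sub, Matrix.trace_sub,
    Matrix.trace_mul_comm Q (transport Q S)] at h0
  unfold bures
  linarith

end Perturbation

/-! ### Couplings of Wasserstein-close measures -/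

section Couplings

open scoped Matrix.Norms.L2Operator MatrixOrder RealInnerProductSpace

variable {d : ℕ}

theorem exists_coupling_of_W2_lt {μ ν : Measure (Vec d)} {r : ℝ} (hr : 0 ≤ r)
    (h : W2 μ ν < ENNReal.ofReal r) :
    ∃ π, IsCoupling μ ν π ∧ ∫⁻ z, ‖z.1 - z.2‖ₑ ^ 2 ∂π < ENNReal.ofReal (r ^ 2) := by
  have h2 : W2 μ ν ^ 2 < ENNReal.ofReal (r ^ 2) := by
    rw [ENNReal.ofReal_pow hr]
    exact ENNReal.pow_right_strictMono two_ne_zero h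
  rw [W2_sq] at h2
  simpa [iInf_lt_iff] using h2

theorem norm_integral_sq_le {Ω : Type*} [MeasurableSpace Ω] {μ : Measure Ω}
    [IsProbabilityMeasure μ] {f : Ω → Vec d} (hf : MemLp f 2 μ) :
    ‖∫ x, f x ∂μ‖ ^ 2 ≤ ∫ x, ‖f x‖ ^ 2 ∂μ := by
  set c := ∫ x, f x ∂μ with hc
  have hfi : Integrable f μ := hf.integrable (by norm_num)
  have h1 : ∫ x, (2 * ⟪c, f x⟫ - ‖c‖ ^ 2) ∂μ = ‖c‖ ^ 2 := by
    rw [integral_sub ((integrable_inner_of_memLp (memLp_const c) hf).const_mul 2)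
      (integrable_const _), integral_const_mul, integral_inner hfi, ← hc,
      real_inner_self_eq_norm_sq]
    simp
    ring
  rw [← h1]
  refine integral_mono (((integrable_inner_of_memLp (memLp_const c) hf).const_mul 2).sub
      (integrable_const _)) (hf.integrable_norm_pow two_ne_zero) fun x => ?_
  have := norm_sub_sq_real (f x) c
  have h0 : 0 ≤ ‖f x - c‖ ^ 2 := by positivity
  rw [real_inner_comm] at this
  simp only
  linarith

/-- The Wasserstein distance dominates the distance of the means. -/
theorem norm_mean_sub_lt {μ ν : Measure (Vec d)} [IsProbabilityMeasure μ]
    (hμ : MemLp (fun x => x) 2 μ) (hν : MemLp (fun x => x) 2 ν) {r : ℝ} (hr : 0 ≤ r)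
    (h : W2 μ ν < ENNReal.ofReal r) : ‖∫ x, x ∂μ - ∫ x, x ∂ν‖ < r := by
  obtain ⟨π, hπ, hc⟩ := exists_coupling_of_W2_lt hr h
  have := hπ.isProbabilityMeasure
  obtain ⟨hx, hy⟩ := hπ.memLp hμ hν
  have h1 : ∫ z, z.1 ∂π = ∫ x, x ∂μ := by
    rw [← hπ.1, integral_map (by fun_prop) (by fun_prop)]
  have h2 : ∫ z, z.2 ∂π = ∫ x, x ∂ν := by
    rw [← hπ.2, integral_map (by fun_prop) (by fun_prop)]
  have h3 := norm_integral_sq_le (hx.sub hy)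
  have h4 := lintegral_enorm_sq (hx.sub hy)
  simp only [Pi.sub_apply] at h3 h4
  rw [integral_sub (hx.integrable (by norm_num)) (hy.integrable (by norm_num)), h1, h2] at h3
  rw [h4] at hc
  have h5 := (ENNReal.ofReal_lt_ofReal_iff_of_nonneg (integral_nonneg fun _ => by positivity)).1 hc
  exact lt_of_pow_lt_pow_left₀ 2 hr (h3.trans_lt h5)

/-- Variances of Wasserstein-close Gaussian measures are comparable; no nondegeneracy is needed, so
that Gaussian measures close to a nondegenerate one can be shown to be nondegenerate. -/
theorem inner_op_le_of_W2_lt {Q S : Matrix (Fin d) (Fin d) ℝ} (hQ : Q.PosSemidef)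
    (hS : S.PosSemidef) {m p : Vec d} {r : ℝ} (hr : 0 ≤ r)
    (h : W2 (multivariateGaussian m Q) (multivariateGaussian p S) < ENNReal.ofReal r)
    (v : Vec d) : ⟪v, op S v⟫ ≤ 2 * ⟪v, op Q v⟫ + 8 * r ^ 2 * ‖v‖ ^ 2 := by
  have hm := norm_mean_sub_lt (memLp_two_multivariateGaussian m Q)
    (memLp_two_multivariateGaussian p S) hr h
  rw [integral_id_multivariateGaussian, integral_id_multivariateGaussian] at hm
  obtain ⟨π, hπ, hc⟩ := exists_coupling_of_W2_lt hr h
  have := hπ.isProbabilityMeasure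
  obtain ⟨hx, hy⟩ := hπ.memLp (memLp_two_multivariateGaussian m Q)
    (memLp_two_multivariateGaussian p S)
  have h4 := lintegral_enorm_sq (hx.sub hy)
  simp only [Pi.sub_apply] at h4
  rw [h4] at hc
  have h5 := (ENNReal.ofReal_lt_ofReal_iff_of_nonneg (integral_nonneg fun _ => by positivity)).1 hc
  have e1 : ∫ z, ⟪v, z.1 - m⟫ ^ 2 ∂π = ⟪v, op Q v⟫ := by
    rw [← integral_inner_sq_multivariateGaussian hQ m, ← hπ.1,
      integral_map (by fun_prop) (by fun_prop)]
  have e2 : ∫ z, ⟪v, z.2 - p⟫ ^ 2 ∂π = ⟪v, op S v⟫ := by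
    rw [← integral_inner_sq_multivariateGaussian hS p, ← hπ.2,
      integral_map (by fun_prop) (by fun_prop)]
  have hi : ∀ {f : Vec d × Vec d → Vec d}, MemLp f 2 π → Integrable (fun z => ⟪v, f z⟫ ^ 2) π :=
    fun hf => (hf.continuousLinearMap_comp (innerSL ℝ v)).integrable_sq
  have i1 : Integrable (fun z : Vec d × Vec d => ⟪v, z.1 - m⟫ ^ 2) π :=
    hi (hx.sub (memLp_const m))
  have i2 : Integrable (fun z : Vec d × Vec d => ⟪v, z.2 - p⟫ ^ 2) π :=
    hi (hy.sub (memLp_const p))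
  have i3 : Integrable (fun z : Vec d × Vec d => ‖z.1 - z.2‖ ^ 2) π :=
    (hx.sub hy).integrable_norm_pow two_ne_zero
  have hmono : ∫ z, ⟪v, z.2 - p⟫ ^ 2 ∂π ≤ ∫ z, (2 * ⟪v, z.1 - m⟫ ^ 2
      + (4 * ‖v‖ ^ 2 * ‖z.1 - z.2‖ ^ 2 + 4 * ‖v‖ ^ 2 * ‖m - p‖ ^ 2)) ∂π := by
    refine integral_mono i2 ((i1.const_mul 2).add ((i3.const_mul _).add (integrable_const _)))
      fun z => ?_
    have k1 : ⟪v, z.2 - p⟫ = ⟪v, z.1 - m⟫ - ⟪v, z.1 - z.2⟫ + ⟪v, m - p⟫ := by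
      simp only [inner_sub_right]; ring
    have k2 : ⟪v, z.1 - z.2⟫ ^ 2 ≤ ‖v‖ ^ 2 * ‖z.1 - z.2‖ ^ 2 := by
      rw [← mul_pow, ← sq_abs]; gcongr; exact abs_real_inner_le_norm _ _
    have k3 : ⟪v, m - p⟫ ^ 2 ≤ ‖v‖ ^ 2 * ‖m - p‖ ^ 2 := by
      rw [← mul_pow, ← sq_abs]; gcongr; exact abs_real_inner_le_norm _ _
    simp only
    rw [k1]
    -- `(x + y)² ≤ 2 x² + 2 y²`, used twice
    nlinarith [sq_nonneg (⟪v, z.1 - m⟫ - (⟪v, m - p⟫ - ⟪v, z.1 - z.2⟫)),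
      sq_nonneg (⟪v, m - p⟫ + ⟪v, z.1 - z.2⟫)]
  have i4 : Integrable (fun z : Vec d × Vec d => 4 * ‖v‖ ^ 2 * ‖z.1 - z.2‖ ^ 2
      + 4 * ‖v‖ ^ 2 * ‖m - p‖ ^ 2) π := (i3.const_mul _).add (integrable_const _)
  rw [integral_add (i1.const_mul 2) i4, integral_add (i3.const_mul _) (integrable_const _),
    integral_const_mul, integral_const_mul, e1, e2] at hmono
  simp only [integral_const, probReal_univ, one_smul] at hmono
  have hm2 : ‖m - p‖ ^ 2 ≤ r ^ 2 := by gcongr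
  have hv : 0 ≤ ‖v‖ ^ 2 := by positivity
  nlinarith [mul_le_mul_of_nonneg_left h5.le hv, mul_le_mul_of_nonneg_left hm2 hv]

theorem multivariateGaussian_injective {m m' : Vec d} {Q Q' : Matrix (Fin d) (Fin d) ℝ}
    (hQ : Q.PosSemidef) (hQ' : Q'.PosSemidef)
    (h : multivariateGaussian m Q = multivariateGaussian m' Q') : m = m' ∧ Q = Q' := by
  constructor
  · rw [← integral_id_multivariateGaussian (μ := m) (S := Q), h, integral_id_multivariateGaussian]
  · ext i j
    rw [← covariance_eval_multivariateGaussian (μ := m) hQ, h,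
      covariance_eval_multivariateGaussian hQ']

end Couplings

/-! ### The update operator on mean and covariance -/

section Storage

open scoped Matrix.Norms.L2Operator MatrixOrder RealInnerProductSpace

variable {d N : ℕ}

/-- The squared Bures-Wasserstein distances of `𝒩(z)` to the patterns. -/
noncomputable def energies (m : Fin N → Vec d) (S : Fin N → Matrix (Fin d) (Fin d) ℝ)
    (z : Vec d × Matrix (Fin d) (Fin d) ℝ) (j : Fin N) : ℝ :=
  bures z.1 z.2 (m j) (S j)

/-- The weighted average of the transport matrices to the patterns. -/
noncomputable def avgTransport (β : ℝ) (m : Fin N → Vec d)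
    (S : Fin N → Matrix (Fin d) (Fin d) ℝ) (z : Vec d × Matrix (Fin d) (Fin d) ℝ) :
    Matrix (Fin d) (Fin d) ℝ :=
  ∑ j, softmax β (energies m S z) j • transport z.2 (S j)

/-- The update operator in terms of mean and covariance. The parameter space carries the maximum of
the Euclidean norm of the mean and the `L²` operator norm of the covariance. -/
noncomputable def updateParam (β : ℝ) (m : Fin N → Vec d)
    (S : Fin N → Matrix (Fin d) (Fin d) ℝ) (z : Vec d × Matrix (Fin d) (Fin d) ℝ) :
    Vec d × Matrix (Fin d) (Fin d) ℝ :=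
  (∑ j, softmax β (energies m S z) j • m j,
    avgTransport β m S z * z.2 * avgTransport β m S z)

/-- The Gaussian measure with given mean and covariance. -/
noncomputable abbrev gauss (z : Vec d × Matrix (Fin d) (Fin d) ℝ) : Measure (Vec d) :=
  multivariateGaussian z.1 z.2

variable {a b β : ℝ} {m : Fin N → Vec d} {S : Fin N → Matrix (Fin d) (Fin d) ℝ}

theorem bures_nonneg (ha : 0 < a) (hb : 0 ≤ b) {Q Q' : Matrix (Fin d) (Fin d) ℝ}
    (hQ : SpecIn a b Q) (hQ' : SpecIn a b Q') (p p' : Vec d) : 0 ≤ bures p Q p' Q' :=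
  (sq_nonneg _).trans (norm_sq_le_bures ha hb hQ hQ' p p')

theorem weight_gauss (ha : 0 < a) (hb : 0 ≤ b) (hS : ∀ j, SpecIn a b (S j))
    {z : Vec d × Matrix (Fin d) (Fin d) ℝ} (hz : SpecIn a b z.2) (j : Fin N) :
    weight β (fun j => multivariateGaussian (m j) (S j)) (gauss z) j
      = softmax β (energies m S z) j := by
  have h : ∀ k, (W2 (multivariateGaussian (m k) (S k)) (gauss z)).toReal ^ 2
      = energies m S z k := fun k => by
    rw [W2_comm, ← ENNReal.toReal_pow, W2_sq_multivariateGaussian ha hb hz (hS k),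
      ENNReal.toReal_ofReal (bures_nonneg ha hb hz (hS k) _ _)]
    rfl
  simp only [weight, softmax, h]

theorem avgTransport_transpose (ha : 0 < a) (hb : 0 ≤ b) (hS : ∀ j, SpecIn a b (S j))
    {z : Vec d × Matrix (Fin d) (Fin d) ℝ} (hz : SpecIn a b z.2) :
    (avgTransport β m S z)ᵀ = avgTransport β m S z := by
  unfold avgTransport
  rw [Matrix.transpose_sum]
  refine Finset.sum_congr rfl fun j _ => ?_
  rw [Matrix.transpose_smul, ← Matrix.conjTranspose_eq_transpose_of_trivial,
    (transport_posDef ha hb hz (hS j)).1.eq]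

theorem update_gauss (ha : 0 < a) (hb : 0 ≤ b) (hS : ∀ j, SpecIn a b (S j))
    {z : Vec d × Matrix (Fin d) (Fin d) ℝ} (hz : SpecIn a b z.2) :
    update β (fun j => multivariateGaussian (m j) (S j)) (gauss z)
      = gauss (updateParam β m S z) := by
  have hae : ∀ᵐ x ∂(gauss z), ∀ j, otMap (gauss z) (multivariateGaussian (m j) (S j)) x
      = affineMap z.1 (m j) (transport z.2 (S j)) x :=
    ae_all_iff.2 fun j => otMap_ae_eq ha hb hz (hS j) z.1 (m j)
  have h1 : (fun x => ∑ j, weight β (fun j => multivariateGaussian (m j) (S j)) (gauss z) j •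
      otMap (gauss z) (multivariateGaussian (m j) (S j)) x) =ᵐ[gauss z]
      fun x => (updateParam β m S z).1 + op (avgTransport β m S z) (x - z.1) := by
    filter_upwards [hae] with x hx
    simp only [hx, weight_gauss ha hb hS hz, updateParam, avgTransport, affineMap, smul_add,
      Finset.sum_add_distrib, op, map_sum, map_smul, sum_apply, smul_apply]
  rw [update, Measure.map_congr h1, gauss, map_affine_multivariateGaussian (hz.posSemidef ha.le),
    avgTransport_transpose ha hb hS hz]
  rfl

/-- The parameter `z` is close to the pattern `i`: its covariance has spectrum in `[a, b]`, all
softmax weights of other patterns are at most `W`, and its mean is within `D` of all patterns. -/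
structure Near (a b β W D : ℝ) (m : Fin N → Vec d) (S : Fin N → Matrix (Fin d) (Fin d) ℝ)
    (i : Fin N) (z : Vec d × Matrix (Fin d) (Fin d) ℝ) : Prop where
  spec : SpecIn a b z.2
  weight_le : ∀ j, j ≠ i → softmax β (energies m S z) j ≤ W
  dist_le : ∀ j, ‖z.1 - m j‖ ≤ D

variable {W D U : ℝ} {i : Fin N} {z z' : Vec d × Matrix (Fin d) (Fin d) ℝ}

theorem Near.abs_weight_le (h : Near a b β W D m S i z) (j : Fin N) (hj : j ≠ i) :
    |softmax β (energies m S z) j| ≤ W := by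
  rw [abs_of_pos (softmax_pos j)]; exact h.weight_le j hj

theorem Near.abs_energies_sub_le (ha : 0 < a) (hb : 0 ≤ b) (hS : ∀ j, SpecIn a b (S j))
    (h : Near a b β W D m S i z) (h' : Near a b β W D m S i z') (j : Fin N) :
    |energies m S z j - energies m S z' j|
      ≤ (2 * D + d * (1 + 2 * (b / a) + b ^ 3 / a ^ 3)) * ‖z - z'‖ := by
  refine (abs_bures_sub_le ha hb h.spec h'.spec (hS j) (h.dist_le j) (h'.dist_le j)).trans ?_
  have h1 : ‖z.1 - z'.1‖ ≤ ‖z - z'‖ := norm_fst_le (z - z')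
  have h2 : ‖z.2 - z'.2‖ ≤ ‖z - z'‖ := norm_snd_le (z - z')
  have hD : 0 ≤ D := (norm_nonneg _).trans (h.dist_le j)
  rw [add_mul]
  gcongr

theorem Near.norm_sub_transport_le (ha : 0 < a) (hb : 0 ≤ b) (hS : ∀ j, SpecIn a b (S j))
    (h : Near a b β W D m S i z) (j : Fin N) :
    ‖transport z.2 (S j) - transport z.2 (S i)‖ ≤ 2 * (b / a) := by
  refine (norm_sub_le _ _).trans ?_
  have h1 := norm_transport_le ha hb h.spec (hS j)
  have h2 := norm_transport_le ha hb h.spec (hS i)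
  linarith

/-- The average differs from the transport matrix to the pattern `i` only by foreign weights. -/
theorem avgTransport_eq (β : ℝ) (m : Fin N → Vec d) (S : Fin N → Matrix (Fin d) (Fin d) ℝ)
    (i : Fin N) (z : Vec d × Matrix (Fin d) (Fin d) ℝ) :
    avgTransport β m S z = transport z.2 (S i) + ∑ j, softmax β (energies m S z) j •
      (transport z.2 (S j) - transport z.2 (S i)) :=
  sum_smul_eq_add (sum_softmax i)

/-- If all foreign weights are small, then the update moves the parameters close to those of
the pattern. For the covariance this uses `A Q A = S i` for the transport matrix `A` to the
pattern `i`. -/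
theorem Near.updateParam_sub_le (ha : 0 < a) (hb : 0 ≤ b) (hS : ∀ j, SpecIn a b (S j))
    (hW : 0 ≤ W) (hm : ∀ j, ‖m j - m i‖ ≤ U) (h : Near a b β W D m S i z)
    (hε : N * (W * (2 * (b / a))) ≤ 1) :
    ‖(updateParam β m S z).1 - m i‖ ≤ N * (W * U) ∧
    ‖(updateParam β m S z).2 - S i‖ ≤ N * (W * (2 * (b / a))) * (b * (2 * (b / a) + 1)) := by
  have hU : 0 ≤ U := (norm_nonneg _).trans (hm i)
  constructor
  · have e : (updateParam β m S z).1 = m i + ∑ j, softmax β (energies m S z) j • (m j - m i) :=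
      sum_smul_eq_add (sum_softmax i)
    rw [e, add_sub_cancel_left]
    exact norm_sum_smul_sub_le h.abs_weight_le hW hU hm
  · have hE := norm_sum_smul_sub_le (u := fun j => transport z.2 (S j)) h.abs_weight_le hW
      (by positivity : 0 ≤ 2 * (b / a)) (h.norm_sub_transport_le ha hb hS)
    have hA := norm_transport_le ha hb h.spec (hS i)
    have hAQA := transport_mul_mul ha hb h.spec (hS i)
    have hQ := h.spec.norm_le ha.le hb
    simp only [updateParam, avgTransport_eq β m S i z]
    set E := ∑ j, softmax β (energies m S z) j • (transport z.2 (S j) - transport z.2 (S i))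
    set A := transport z.2 (S i)
    set ε := N * (W * (2 * (b / a)))
    have e : (A + E) * z.2 * (A + E) - S i = A * z.2 * E + E * z.2 * (A + E) := by
      rw [← hAQA]; noncomm_ring
    have h3 : ∀ p q r : Matrix (Fin d) (Fin d) ℝ, ‖p * q * r‖ ≤ ‖p‖ * ‖q‖ * ‖r‖ := fun p q r =>
      (norm_mul_le _ _).trans (by gcongr; exact norm_mul_le _ _)
    have hAE : ‖A + E‖ ≤ b / a + 1 := (norm_add_le _ _).trans (by linarith)
    have hε0 : 0 ≤ ε := (norm_nonneg _).trans hE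
    rw [e]
    calc _ ≤ b / a * b * ε + ε * b * (b / a + 1) := by
          refine (norm_add_le _ _).trans (add_le_add ?_ ?_)
          · exact (h3 _ _ _).trans (by gcongr)
          · exact (h3 _ _ _).trans (by gcongr)
      _ = _ := by ring

/-- If all foreign weights are small, then the update is Lipschitz with a small constant: the main
term `A Q A = S i` of the updated covariance does not depend on `Q`. -/
theorem Near.updateParam_sub_updateParam_le (ha : 0 < a) (hb : 0 ≤ b) (hβ : 0 ≤ β)
    (hS : ∀ j, SpecIn a b (S j)) (hW : 0 ≤ W) (hm : ∀ j, ‖m j - m i‖ ≤ U)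
    (h : Near a b β W D m S i z) (h' : Near a b β W D m S i z')
    (hε : N * (W * (2 * (b / a))) ≤ 1) {κ ℓ : ℝ}
    (hκ : 2 * D + d * (1 + 2 * (b / a) + b ^ 3 / a ^ 3) ≤ κ) (hℓ : b ^ 2 / (2 * a ^ 3) ≤ ℓ) :
    ‖(updateParam β m S z).1 - (updateParam β m S z').1‖
      ≤ N * (W * (2 * β * κ) * U) * ‖z - z'‖ ∧
    ‖(updateParam β m S z).2 - (updateParam β m S z').2‖
      ≤ (N * (W * (2 * (b / a))) * (2 * ℓ * b + 2 * (b / a) + 1)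
        + N * (W * (2 * β * κ) * (2 * (b / a)) + W * (2 * ℓ)) * (2 * (b / a) * b + 2 * b))
        * ‖z - z'‖ := by
  have hU : 0 ≤ U := (norm_nonneg _).trans (hm i)
  have hℓ0 : 0 ≤ ℓ := le_trans (by positivity) hℓ
  have hD : 0 ≤ D := (norm_nonneg _).trans (h.dist_le i)
  have hκ0 : 0 ≤ κ := le_trans (by positivity) hκ
  set δ := ‖z - z'‖
  have hδ0 : 0 ≤ δ := norm_nonneg _
  have hg : 0 ≤ b / a := by positivity
  have hen : ∀ j, |energies m S z j - energies m S z' j| ≤ κ * δ := fun j =>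
    (h.abs_energies_sub_le ha hb hS h' j).trans (by gcongr)
  have hww : ∀ j, j ≠ i → |softmax β (energies m S z) j - softmax β (energies m S z') j|
      ≤ W * (2 * β * (κ * δ)) := fun j hj =>
    abs_softmax_sub_le hβ hen j (h.weight_le j hj) (h'.weight_le j hj)
  constructor
  · have e : ∀ z : Vec d × Matrix (Fin d) (Fin d) ℝ, (updateParam β m S z).1
        = m i + ∑ j, softmax β (energies m S z) j • (m j - m i) := fun z =>
      sum_smul_eq_add (sum_softmax i)
    rw [e, e, add_sub_add_left_eq_sub]
    refine (norm_sum_smul_sub_sub_le (ℓ := 0) (θ := W * (2 * β * (κ * δ))) h'.abs_weight_le hW hU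
      (by positivity) le_rfl hww hm (fun j => by simp)).trans (le_of_eq ?_)
    ring
  · have hQQ : ‖z.2 - z'.2‖ ≤ δ := norm_snd_le (z - z')
    have hAA : ∀ j, ‖transport z.2 (S j) - transport z'.2 (S j)‖ ≤ ℓ * δ := fun j =>
      (norm_transport_sub_le ha hb h.spec h'.spec (hS j)).trans (by gcongr)
    have hE := norm_sum_smul_sub_le (u := fun j => transport z.2 (S j)) h.abs_weight_le hW
      (by positivity : 0 ≤ 2 * (b / a)) (h.norm_sub_transport_le ha hb hS)
    have hE' := norm_sum_smul_sub_le (u := fun j => transport z'.2 (S j)) h'.abs_weight_le hW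
      (by positivity : 0 ≤ 2 * (b / a)) (h'.norm_sub_transport_le ha hb hS)
    have hEE := norm_sum_smul_sub_sub_le (u := fun j => transport z.2 (S j))
      (u' := fun j => transport z'.2 (S j)) (ℓ := ℓ * δ) (θ := W * (2 * β * (κ * δ)))
      h'.abs_weight_le hW (by positivity : 0 ≤ 2 * (b / a)) (by positivity) (by positivity) hww
      (h.norm_sub_transport_le ha hb hS) hAA
    have hA := norm_transport_le ha hb h.spec (hS i)
    have hA' := norm_transport_le ha hb h'.spec (hS i)
    have hAQA := transport_mul_mul ha hb h.spec (hS i)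
    have hAQA' := transport_mul_mul ha hb h'.spec (hS i)
    have hQ := h.spec.norm_le ha.le hb
    have hQ' := h'.spec.norm_le ha.le hb
    have hAi := hAA i
    simp only [updateParam, avgTransport_eq β m S i]
    set E := ∑ j, softmax β (energies m S z) j • (transport z.2 (S j) - transport z.2 (S i))
    set E' := ∑ j, softmax β (energies m S z') j • (transport z'.2 (S j) - transport z'.2 (S i))
    set A := transport z.2 (S i)
    set A' := transport z'.2 (S i)
    set ε := N * (W * (2 * (b / a)))
    set τ := N * (W * (2 * β * κ) * (2 * (b / a)) + W * (2 * ℓ)) with hτ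
    have hEE' : ‖E - E'‖ ≤ τ * δ := hEE.trans (le_of_eq (by rw [hτ]; ring))
    have hε0 : 0 ≤ ε := (norm_nonneg _).trans hE
    have hτ0 : 0 ≤ τ := by positivity
    have hAE : ‖A + E‖ ≤ b / a + 1 := (norm_add_le _ _).trans (by linarith)
    have hAEs : ‖(A + E) - (A' + E')‖ ≤ ℓ * δ + τ * δ := by
      rw [add_sub_add_comm]; exact (norm_add_le _ _).trans (add_le_add hAi hEE')
    have e : (A + E) * z.2 * (A + E) - (A' + E') * z'.2 * (A' + E')
        = (A * z.2 * E - A' * z'.2 * E')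
          + (E * z.2 * (A + E) - E' * z'.2 * (A' + E')) := by
      have e1 : (A + E) * z.2 * (A + E) = S i + A * z.2 * E + E * z.2 * (A + E) := by
        rw [← hAQA]; noncomm_ring
      have e2 : (A' + E') * z'.2 * (A' + E') = S i + A' * z'.2 * E' + E' * z'.2 * (A' + E') := by
        rw [← hAQA']; noncomm_ring
      rw [e1, e2]; abel
    have k1 := norm_mul3_sub_le hA' hQ hQ' hE hAi hQQ hEE'
    have k2 := norm_mul3_sub_le hE' hQ hQ' hAE hEE' hQQ hAEs
    rw [e]
    refine (norm_add_le _ _).trans ((add_le_add k1 k2).trans ?_)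
    have k3 := mul_le_mul_of_nonneg_right hε (by positivity : 0 ≤ b * τ * δ)
    linarith

/-- Under a smallness condition on the foreign weights, the update is a contraction near a
pattern whose values are close to the pattern. The constant does not depend on `d`, `N` or
`β`. -/
theorem exists_contraction {a b c₀ c₁ K : ℝ} (ha : 0 < a) (hb : 0 ≤ b) (hc₀ : 0 ≤ c₀)
    (hc₁ : 0 ≤ c₁) (hK : 0 < K) :
    ∃ C : ℝ, 0 < C ∧ ∀ (d N : ℕ) (β W : ℝ) (m : Fin N → Vec d)
      (S : Fin N → Matrix (Fin d) (Fin d) ℝ) (i : Fin N), 1 ≤ d → 0 < β → 0 ≤ W →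
      (∀ j, SpecIn a b (S j)) → (∀ j, ‖m j - m i‖ ≤ d * c₀) →
      C * (N ^ 2 * (1 + β * d) * d * W) ≤ 1 →
      (∀ z z', Near a b β W (d * c₁) m S i z → Near a b β W (d * c₁) m S i z' →
        ‖updateParam β m S z - updateParam β m S z'‖ ≤ 1 / 2 * ‖z - z'‖) ∧
      ∀ z, Near a b β W (d * c₁) m S i z →
        ‖updateParam β m S z - (m i, S i)‖ ≤ 1 / (K * (β * N * d)) := by
  set g := b / a
  have hg0 : 0 ≤ g := by positivity
  set ℓ := b ^ 2 / (2 * a ^ 3)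
  have hℓ0 : 0 ≤ ℓ := by positivity
  set κ := 2 * c₁ + (1 + 2 * g + b ^ 3 / a ^ 3) with hκ
  have hκ0 : 0 ≤ κ := by positivity
  set C₁ := 2 * g with hC₁
  set C₂ := 4 * κ * c₀ with hC₂
  set C₃ := 2 * (2 * g * (2 * ℓ * b + 2 * g + 1)
    + (4 * κ * g + 2 * ℓ) * (2 * g * b + 2 * b)) with hC₃
  set C₄ := K * c₀ with hC₄
  set C₅ := K * (2 * g * (b * (2 * g + 1))) with hC₅
  have h1 : 0 ≤ C₁ := by positivity
  have h2 : 0 ≤ C₂ := by positivity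
  have h3 : 0 ≤ C₃ := by positivity
  have h4 : 0 ≤ C₄ := by positivity
  have h5 : 0 ≤ C₅ := by positivity
  refine ⟨1 + C₁ + C₂ + C₃ + C₄ + C₅, by positivity, ?_⟩
  intro d N β W m S i hd hβ hW hS hm hsmall
  have hd1 : (1 : ℝ) ≤ d := by exact_mod_cast hd
  have hN1 : (1 : ℝ) ≤ N := by exact_mod_cast (Fin.pos i)
  have hβd : 0 < β * d := by positivity
  set t := (N : ℝ) ^ 2 * (1 + β * d) * d * W with ht
  have ht0 : 0 ≤ t := by positivity
  have hc : ∀ c, c ≤ 1 + C₁ + C₂ + C₃ + C₄ + C₅ → c * t ≤ 1 := fun c hc =>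
    (mul_le_mul_of_nonneg_right hc ht0).trans hsmall
  have t1 : N * W * (1 + β * d) * d ≤ t := by
    rw [ht]
    have : (N : ℝ) ≤ N ^ 2 := by nlinarith
    calc _ = (N : ℝ) * (1 + β * d) * d * W := by ring
      _ ≤ _ := by gcongr
  have t2 : N * W * (1 + β * d) ≤ t := by
    refine le_trans ?_ t1
    exact le_mul_of_one_le_right (by positivity) hd1
  have t3 : N * W ≤ t := le_trans (le_mul_of_one_le_right (by positivity) (by linarith)) t2
  have t4 : (N : ℝ) ^ 2 * W * (β * d) * d ≤ t := by
    rw [ht]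
    have : β * d ≤ 1 + β * d := by linarith
    calc _ = (N : ℝ) ^ 2 * (β * d) * d * W := by ring
      _ ≤ _ := by gcongr
  have t5 : (N : ℝ) ^ 2 * W * (β * d) ≤ t :=
    le_trans (le_mul_of_one_le_right (by positivity) hd1) t4
  have hε : N * (W * (2 * g)) ≤ 1 := by
    calc _ = C₁ * (N * W) := by rw [hC₁]; ring
      _ ≤ C₁ * t := by gcongr
      _ ≤ 1 := hc _ (by linarith)
  constructor
  · intro z z' hz hz'
    have hκ' : 2 * (d * c₁) + d * (1 + 2 * g + b ^ 3 / a ^ 3) ≤ d * κ := by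
      rw [hκ]; exact le_of_eq (by ring)
    obtain ⟨l1, l2⟩ := hz.updateParam_sub_updateParam_le ha hb hβ.le hS hW hm hz' hε hκ' le_rfl
    refine max_le ?_ ?_
    · refine l1.trans ?_
      gcongr
      have : C₂ * (N * W * (1 + β * d) * d) ≤ 1 :=
        (mul_le_mul_of_nonneg_left t1 h2).trans (hc _ (by linarith))
      have e : (N : ℝ) * (W * (2 * β * (d * κ)) * (d * c₀))
          = 1 / 2 * (C₂ * (N * W * (β * d) * d)) := by rw [hC₂]; ring
      rw [e]
      have : C₂ * (N * W * (β * d) * d) ≤ C₂ * (N * W * (1 + β * d) * d) := by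
        gcongr; linarith
      linarith
    · refine l2.trans ?_
      gcongr
      have : C₃ * (N * W * (1 + β * d)) ≤ 1 :=
        (mul_le_mul_of_nonneg_left t2 h3).trans (hc _ (by linarith))
      have e : N * (W * (2 * g)) * (2 * ℓ * b + 2 * g + 1)
          + N * (W * (2 * β * (d * κ)) * (2 * g) + W * (2 * ℓ)) * (2 * g * b + 2 * b)
          ≤ 1 / 2 * (C₃ * (N * W * (1 + β * d))) := by
        have e1 : 1 / 2 * (C₃ * (N * W * (1 + β * d)))
            - (N * (W * (2 * g)) * (2 * ℓ * b + 2 * g + 1)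
              + N * (W * (2 * β * (d * κ)) * (2 * g) + W * (2 * ℓ)) * (2 * g * b + 2 * b))
            = N * W * (β * d) * (2 * g * (2 * ℓ * b + 2 * g + 1))
              + N * W * (4 * κ * g) * (2 * g * b + 2 * b)
              + N * W * (β * d) * (2 * ℓ) * (2 * g * b + 2 * b) := by
          rw [hC₃]; ring
        have e2 : 0 ≤ N * W * (β * d) * (2 * g * (2 * ℓ * b + 2 * g + 1))
              + N * W * (4 * κ * g) * (2 * g * b + 2 * b)
              + N * W * (β * d) * (2 * ℓ) * (2 * g * b + 2 * b) := by positivity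
        linarith
      linarith
  · intro z hz
    obtain ⟨l1, l2⟩ := hz.updateParam_sub_le ha hb hS hW hm hε
    have hN0 : 0 < (N : ℝ) := by linarith
    refine max_le ?_ ?_
    · refine l1.trans ?_
      rw [le_div_iff₀ (by positivity)]
      calc _ = C₄ * ((N : ℝ) ^ 2 * W * (β * d) * d) := by rw [hC₄]; ring
        _ ≤ C₄ * t := by gcongr
        _ ≤ 1 := hc _ (by linarith)
    · refine l2.trans ?_
      rw [le_div_iff₀ (by positivity)]
      calc _ = C₅ * ((N : ℝ) ^ 2 * W * (β * d)) := by rw [hC₅]; ring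
        _ ≤ C₅ * t := by gcongr
        _ ≤ 1 := hc _ (by linarith)

end Storage

/-! ### Storage of separated patterns -/

section Storage

open scoped Matrix.Norms.L2Operator MatrixOrder RealInnerProductSpace

variable {d N : ℕ} {β l L r : ℝ} {m : Fin N → Vec d} {S : Fin N → Matrix (Fin d) (Fin d) ℝ}
  {i : Fin N} {z : Vec d × Matrix (Fin d) (Fin d) ℝ}

/-- In the ball around a pattern, the weights of the other patterns are exponentially small in the
dimension. -/
theorem near_of_bures_lt (hl : 0 < l) (hL : 0 ≤ L) (hd : 1 ≤ d) (hβ : 0 < β) (hr : 0 ≤ r)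
    (hrl : r ^ 2 ≤ l / 16) (hS : ∀ j, SpecIn (l / 4) (4 * L) (S j))
    (hU : ∀ j k, ‖m j - m k‖ ≤ d * (1 + 4 * L))
    (hsep : ∀ j k, j ≠ k → d * l ≤ ‖m j - m k‖ ^ 2)
    (hz : SpecIn (l / 4) (4 * L) z.2) (hlt : bures z.1 z.2 (m i) (S i) < r ^ 2) :
    Near (l / 4) (4 * L) β (Real.exp (-(β * (d * l / 2)))) (d * (1 + 4 * L + 1 + l)) m S i z := by
  have hd1 : (1 : ℝ) ≤ d := by exact_mod_cast hd
  have h0 : ‖z.1 - m i‖ ≤ r := by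
    have := (norm_sq_le_bures (by positivity) (by positivity) hz (hS i) z.1 (m i)).trans hlt.le
    exact le_of_sq_le_sq this hr
  refine ⟨hz, fun j hj => ?_, fun j => ?_⟩
  · refine (softmax_le_exp i j).trans (Real.exp_le_exp.2 ?_)
    have h1 := norm_sq_le_bures (by positivity) (by positivity) hz (hS j) z.1 (m j)
    have h2 := hsep j i hj
    have h3 : ‖m j - m i‖ ≤ ‖z.1 - m j‖ + r := by
      calc ‖m j - m i‖ = ‖(z.1 - m i) - (z.1 - m j)‖ := by congr 1; abel
        _ ≤ ‖z.1 - m i‖ + ‖z.1 - m j‖ := norm_sub_le _ _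
        _ ≤ _ := by linarith
    set x := ‖m j - m i‖
    have hx0 : 0 ≤ x := norm_nonneg _
    have h4 : 4 * r ≤ x := by
      refine le_of_sq_le_sq ?_ hx0
      nlinarith
    have h5 : (x - r) ^ 2 ≤ ‖z.1 - m j‖ ^ 2 := by
      have : 0 ≤ x - r := by linarith
      gcongr
      linarith
    have h6 : d * l / 2 ≤ energies m S z j - energies m S z i := by
      unfold energies
      nlinarith
    nlinarith
  · have h1 : ‖z.1 - m j‖ ≤ r + d * (1 + 4 * L) := by
      calc ‖z.1 - m j‖ = ‖(z.1 - m i) + (m i - m j)‖ := by congr 1; abel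
        _ ≤ ‖z.1 - m i‖ + ‖m i - m j‖ := norm_add_le _ _
        _ ≤ _ := add_le_add h0 (hU i j)
    have h2 : r ≤ 1 + l := by
      refine le_of_sq_le_sq ?_ (by positivity)
      nlinarith
    nlinarith

/-- Gaussian measures in a small ball around a nondegenerate Gaussian measure are
nondegenerate. -/
theorem exists_gauss_of_mem_wBall (hl : 0 < l) (hlL : l ≤ L) (hr : 0 ≤ r) (hrl : r ^ 2 ≤ l / 16)
    {p : Vec d} {T : Matrix (Fin d) (Fin d) ℝ} (hT : SpecIn l L T)
    {ξ : Measure (Vec d)} (hξ : ξ ∈ wBall (multivariateGaussian p T) r) (hG : IsGaussian ξ) :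
    ∃ z, ξ = gauss z ∧ SpecIn (l / 4) (4 * L) z.2 ∧ bures z.1 z.2 p T < r ^ 2 := by
  obtain ⟨q, Q, hQ, rfl⟩ := exists_eq_multivariateGaussian ξ
  have hW := hξ.2.2
  have hTp := hT.posSemidef hl.le
  have hL : 0 ≤ L := hl.le.trans hlL
  have hspec : SpecIn (l / 4) (4 * L) Q := by
    refine ⟨hQ.1, fun v => ?_, fun v => ?_⟩
    · have h1 := inner_op_le_of_W2_lt hQ hTp hr (by rwa [W2_comm]) v
      have h2 := hT.lower v
      have hv : 0 ≤ ‖v‖ ^ 2 := by positivity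
      have := mul_le_mul_of_nonneg_right hrl hv
      linarith
    · have h1 := inner_op_le_of_W2_lt hTp hQ hr hW v
      have h2 := hT.upper v
      have hv : 0 ≤ ‖v‖ ^ 2 := by positivity
      have := mul_le_mul_of_nonneg_right hrl hv
      have := mul_le_mul_of_nonneg_right hlL hv
      linarith [mul_nonneg hL hv]
  refine ⟨(q, Q), rfl, hspec, ?_⟩
  have h2 := ENNReal.pow_right_strictMono two_ne_zero hW
  simp only at h2
  rw [W2_comm, ← ENNReal.ofReal_pow hr, W2_sq_multivariateGaussian (by positivity) (by positivity)
    hspec (hT.mono (by linarith) (by linarith))] at h2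
  exact (ENNReal.ofReal_lt_ofReal_iff_of_nonneg (bures_nonneg (by positivity) (by positivity)
    hspec (hT.mono (by linarith) (by linarith)) _ _)).1 h2

theorem gauss_mem_wBall {a b : ℝ} (ha : 0 < a) (hb : 0 ≤ b) (hr : 0 < r) {p : Vec d}
    {T : Matrix (Fin d) (Fin d) ℝ} (hT : SpecIn a b T) (hz : SpecIn a b z.2)
    (h : bures z.1 z.2 p T < r ^ 2) : gauss z ∈ wBall (multivariateGaussian p T) r := by
  refine ⟨inferInstance, ?_, ?_⟩
  · rw [lintegral_enorm_sq (memLp_two_multivariateGaussian _ _)]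
    exact ENNReal.ofReal_lt_top
  · refine (ENNReal.pow_right_strictMono two_ne_zero).lt_iff_lt.1 ?_
    rw [W2_comm, W2_sq_multivariateGaussian ha hb hz hT, ← ENNReal.ofReal_pow hr.le,
      ENNReal.ofReal_lt_ofReal_iff (by positivity)]
    exact h

theorem bures_self {a b : ℝ} (ha : 0 < a) (hb : 0 ≤ b) {p : Vec d}
    {T : Matrix (Fin d) (Fin d) ℝ} (hT : SpecIn a b T) : bures p T p T = 0 := by
  have h := W2_sq_multivariateGaussian ha hb hT hT p p
  rw [W2_self] at h
  have h1 : bures p T p T ≤ 0 := by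
    rw [← ENNReal.ofReal_eq_zero, ← h]; simp
  exact le_antisymm h1 (bures_nonneg ha hb hT hT _ _)

/-- The Wasserstein distance dominates the distance of the means, so that the triangle inequality
for means suffices. -/
theorem disjoint_wBall {m m' : Vec d} {S S' : Matrix (Fin d) (Fin d) ℝ} (hr : 0 ≤ r)
    (h : 2 * r ≤ ‖m - m'‖) :
    Disjoint (wBall (multivariateGaussian m S) r) (wBall (multivariateGaussian m' S') r) := by
  rw [Set.disjoint_left]
  rintro ν ⟨hp, h2, h1⟩ ⟨-, -, h3⟩
  have hν : MemLp (fun x => x) 2 ν := by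
    refine ⟨aestronglyMeasurable_id, ?_⟩
    rw [eLpNorm_lt_top_iff_lintegral_rpow_enorm_lt_top two_ne_zero ENNReal.ofNat_ne_top]
    simpa using h2
  have k1 := norm_mean_sub_lt (memLp_two_multivariateGaussian m S) hν hr h1
  have k2 := norm_mean_sub_lt (memLp_two_multivariateGaussian m' S') hν hr h3
  rw [integral_id_multivariateGaussian] at k1 k2
  have : ‖m - m'‖ < 2 * r := by
    calc ‖m - m'‖ = ‖(m - ∫ x, x ∂ν) - (m' - ∫ x, x ∂ν)‖ := by congr 1; abel
      _ ≤ _ := norm_sub_le _ _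
      _ < _ := by linarith
  linarith

/-- Well-separated Gaussian patterns are stored, if the foreign weights `exp (-β d l / 2)` are small
compared with a fixed polynomial in `N`, `d` and `β`. The update maps the whole Wasserstein ball
into a smaller norm ball of parameters, on which it is a contraction. -/
theorem exists_isStored_of_separated (hl : 0 < l) (hlL : l ≤ L) :
    ∃ C : ℝ, 0 < C ∧ ∀ (d N : ℕ) (β : ℝ) (m : Fin N → Vec d)
      (S : Fin N → Matrix (Fin d) (Fin d) ℝ), 1 ≤ d → 0 < β →
      (∀ j, SpecIn l L (S j)) → (∀ j k, ‖m j - m k‖ ≤ d * (1 + 4 * L)) →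
      (∀ j k, j ≠ k → d * l ≤ ‖m j - m k‖ ^ 2) → 1 / (β * N) ≤ l / 16 →
      C * (N ^ 2 * (1 + β * d) * d * Real.exp (-(β * (d * l / 2)))) ≤ 1 →
      ∀ i, IsStored β (fun j => multivariateGaussian (m j) (S j))
        (fun j => wBall (multivariateGaussian (m j) (S j)) (1 / √(β * N))) i := by
  have hL : 0 < L := hl.trans_le hlL
  have ha : 0 < l / 4 := by positivity
  have hb : 0 ≤ 4 * L := by positivity
  set a := l / 4 with hadef
  set b := 4 * L with hbdef
  set κ := 2 * (1 + 4 * L + 1 + l) + (1 + 2 * (b / a) + b ^ 3 / a ^ 3) with hκ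
  have hκ1 : 1 ≤ κ := by
    have : 0 ≤ 2 * (1 + 4 * L + 1 + l) + (2 * (b / a) + b ^ 3 / a ^ 3) := by positivity
    rw [hκ]; linarith
  obtain ⟨C, hC, hcon⟩ := exists_contraction (a := a) (b := b) (c₀ := 1 + 4 * L)
    (c₁ := 1 + 4 * L + 1 + l) (K := 2 * κ) ha hb (by positivity) (by positivity) (by positivity)
  refine ⟨C, hC, fun d N β m S hd hβ hS hU hsep hrl hsmall i => ?_⟩
  have hd1 : (1 : ℝ) ≤ d := by exact_mod_cast hd
  have hN1 : (1 : ℝ) ≤ N := by exact_mod_cast (Fin.pos i)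
  have hβN : 0 < β * N := by positivity
  set r := 1 / √(β * N) with hr
  have hr0 : 0 < r := by positivity
  have hr2 : r ^ 2 = 1 / (β * N) := by rw [hr, div_pow, Real.sq_sqrt hβN.le, one_pow]
  rw [← hr2] at hrl
  have hS' : ∀ j, SpecIn a b (S j) := fun j => (hS j).mono (by linarith) (by linarith)
  obtain ⟨hlip, hrange⟩ := hcon d N β (Real.exp (-(β * (d * l / 2)))) m S i hd hβ
    (Real.exp_pos _).le hS' (fun j => hU j i) hsmall
  set F := updateParam β m S
  -- the radius `ρ` is so small that the norm ball lies inside the Wasserstein ball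
  set ρ := 1 / (2 * κ * (β * N * d)) with hρ
  have hρr : d * κ * ρ = r ^ 2 / 2 := by rw [hρ, hr2]; field_simp
  have hρ0 : 0 < ρ := by positivity
  have hρl : ρ ≤ l / 32 := by
    have : ρ ≤ d * κ * ρ := by
      have : 1 ≤ d * κ := by nlinarith
      nlinarith
    linarith
  have hnear : ∀ z : Vec d × Matrix (Fin d) (Fin d) ℝ, SpecIn a b z.2 →
      bures z.1 z.2 (m i) (S i) < r ^ 2 →
      Near a b β (Real.exp (-(β * (d * l / 2)))) (d * (1 + 4 * L + 1 + l)) m S i z :=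
    fun z hz hlt => near_of_bures_lt hl hL.le hd hβ hr0.le hrl hS' hU hsep hz hlt
  -- the invariant set on which the update contracts
  set B : Set (Vec d × Matrix (Fin d) (Fin d) ℝ) :=
    {z | z.2.IsHermitian ∧ ‖z - (m i, S i)‖ ≤ ρ}
  have hBspec : ∀ z ∈ B, SpecIn a b z.2 := fun z hz => by
    have h1 : ‖z.2 - S i‖ ≤ ρ := (norm_snd_le (z - (m i, S i))).trans hz.2
    exact ((hS i).of_norm_sub_le hz.1 h1).mono (by linarith) (by linarith)
  have hBdist : ∀ z ∈ B, ∀ w ∈ B, |bures z.1 z.2 w.1 w.2 - bures w.1 w.2 w.1 w.2|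
      ≤ d * κ * ‖z - w‖ := fun z hz w hw => by
    have h1 : ‖z.1 - m i‖ ≤ ρ := (norm_fst_le (z - (m i, S i))).trans hz.2
    have h2 : ‖w.1 - m i‖ ≤ ρ := (norm_fst_le (w - (m i, S i))).trans hw.2
    have h3 : ‖z.1 - w.1‖ ≤ d * (1 + 4 * L + 1 + l) := by
      calc ‖z.1 - w.1‖ = ‖(z.1 - m i) - (w.1 - m i)‖ := by congr 1; abel
        _ ≤ ρ + ρ := (norm_sub_le _ _).trans (add_le_add h1 h2)
        _ ≤ _ := by nlinarith
    refine (abs_bures_sub_le ha hb (hBspec z hz) (hBspec w hw) (hBspec w hw) h3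
      (by rw [sub_self, norm_zero]; positivity)).trans ?_
    have k1 : ‖z.1 - w.1‖ ≤ ‖z - w‖ := norm_fst_le (z - w)
    have k2 : ‖z.2 - w.2‖ ≤ ‖z - w‖ := norm_snd_le (z - w)
    have e : d * κ * ‖z - w‖ = 2 * (d * (1 + 4 * L + 1 + l)) * ‖z - w‖
        + d * (1 + 2 * (b / a) + b ^ 3 / a ^ 3) * ‖z - w‖ := by rw [hκ]; ring
    rw [e]
    gcongr
  have hcen : ((m i, S i) : Vec d × Matrix (Fin d) (Fin d) ℝ) ∈ B :=
    ⟨(hS i).herm, by rw [sub_self, norm_zero]; exact hρ0.le⟩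
  have hBlt : ∀ z ∈ B, bures z.1 z.2 (m i) (S i) < r ^ 2 := fun z hz => by
    have h1 := hBdist z hz _ hcen
    simp only at h1
    rw [bures_self ha hb (hS' i), sub_zero] at h1
    have h2 : d * κ * ‖z - (m i, S i)‖ ≤ d * κ * ρ := by
      have := hz.2
      gcongr
    have := (le_abs_self _).trans h1
    have hr2 : 0 < r ^ 2 := by positivity
    linarith
  have hFB : ∀ z, SpecIn a b z.2 → bures z.1 z.2 (m i) (S i) < r ^ 2 → F z ∈ B := fun z hz hlt => by
    refine ⟨?_, hrange z (hnear z hz hlt)⟩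
    have h1 : (avgTransport β m S z)ᴴ = avgTransport β m S z := by
      rw [Matrix.conjTranspose_eq_transpose_of_trivial, avgTransport_transpose ha hb hS' hz]
    have := Matrix.isHermitian_mul_mul_conjTranspose (avgTransport β m S z) hz.herm
    rwa [h1] at this
  have hmaps : Set.MapsTo F B B := fun z hz => hFB z (hBspec z hz) (hBlt z hz)
  have hcontr : ∀ z ∈ B, ∀ w ∈ B, ‖F z - F w‖ ≤ 1 / 2 * ‖z - w‖ := fun z hz w hw =>
    hlip z w (hnear z (hBspec z hz) (hBlt z hz)) (hnear w (hBspec w hw) (hBlt w hw))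
  have hcomplete : IsComplete B := by
    have : CompleteSpace (Matrix (Fin d) (Fin d) ℝ) := FiniteDimensional.complete ℝ _
    refine IsClosed.isComplete ?_
    have h1 : IsClosed {z : Vec d × Matrix (Fin d) (Fin d) ℝ | z.2.IsHermitian} :=
      isClosed_eq (continuous_snd.matrix_conjTranspose) continuous_snd
    have h2 : IsClosed {z : Vec d × Matrix (Fin d) (Fin d) ℝ | ‖z - (m i, S i)‖ ≤ ρ} :=
      isClosed_le (continuous_id.sub continuous_const).norm continuous_const
    exact h1.inter h2
  have hCW : ContractingWith (1 / 2) (hmaps.restrict F B B) := by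
    refine ⟨by norm_num, LipschitzWith.of_dist_le_mul fun z w => ?_⟩
    rw [Subtype.dist_eq, Subtype.dist_eq, dist_eq_norm, dist_eq_norm]
    simpa using hcontr z z.2 w w.2
  obtain ⟨y, hyB, hyfix, -, -⟩ := hCW.exists_fixedPoint' hcomplete hmaps hcen (edist_ne_top _ _)
  have hupd : ∀ z, SpecIn a b z.2 →
      update β (fun j => multivariateGaussian (m j) (S j)) (gauss z) = gauss (F z) :=
    fun z hz => update_gauss ha hb hS' hz
  have hiter : ∀ z ∈ B, ∀ n, F^[n] z ∈ B ∧ ‖F^[n] z - y‖ ≤ (1 / 2) ^ n * ‖z - y‖ ∧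
      (update β (fun j => multivariateGaussian (m j) (S j)))^[n] (gauss z) = gauss (F^[n] z) :=
    fun z hz n => by
      induction n with
      | zero => exact ⟨hz, by simp, rfl⟩
      | succ n ih =>
        obtain ⟨h1, h2, h3⟩ := ih
        rw [Function.iterate_succ_apply', Function.iterate_succ_apply', h3, hupd _ (hBspec _ h1)]
        refine ⟨hmaps h1, ?_, rfl⟩
        have := hcontr _ h1 y hyB
        rw [hyfix.eq] at this
        rw [pow_succ]
        linarith
  have hball : ∀ z ∈ B, gauss z ∈ wBall (multivariateGaussian (m i) (S i)) r := fun z hz =>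
    gauss_mem_wBall ha hb hr0 (hS' i) (hBspec z hz) (hBlt z hz)
  refine ⟨⟨gauss y, hball y hyB, inferInstance, ?_, ?_, ?_⟩, ?_⟩
  · rw [hupd y (hBspec y hyB), hyfix.eq]
  · intro Z hZ hG hfix
    obtain ⟨z, rfl, hz, hlt⟩ := exists_gauss_of_mem_wBall hl hlL hr0.le hrl (hS i) hZ hG
    rw [hupd z hz] at hfix
    have h1 := hFB z hz hlt
    obtain ⟨e1, e2⟩ := multivariateGaussian_injective ((hBspec _ h1).posSemidef ha.le)
      (hz.posSemidef ha.le) hfix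
    have hFz : F z = z := Prod.ext e1 e2
    rw [hFz] at h1
    have h2 := hcontr z h1 y hyB
    rw [hFz, hyfix.eq] at h2
    have h3 : ‖z - y‖ = 0 := le_antisymm (by linarith) (norm_nonneg _)
    rw [sub_eq_zero.1 (norm_eq_zero.1 h3)]
  · intro ξ hξ hG
    obtain ⟨z, rfl, hz, hlt⟩ := exists_gauss_of_mem_wBall hl hlL hr0.le hrl (hS i) hξ hG
    have h1 := hFB z hz hlt
    rw [← tendsto_add_atTop_iff_nat 1]
    have hW : ∀ n, W2 ((update β (fun j => multivariateGaussian (m j) (S j)))^[n + 1] (gauss z))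
        (gauss y) ^ 2 ≤ ENNReal.ofReal (d * κ * ((1 / 2) ^ n * ‖F z - y‖)) := fun n => by
      obtain ⟨k1, k2, k3⟩ := hiter _ h1 n
      rw [Function.iterate_succ_apply, hupd z hz, k3,
        W2_sq_multivariateGaussian ha hb (hBspec _ k1) (hBspec y hyB)]
      refine ENNReal.ofReal_le_ofReal ?_
      have k4 := hBdist _ k1 y hyB
      rw [bures_self ha hb (hBspec y hyB), sub_zero] at k4
      exact ((le_abs_self _).trans k4).trans (by gcongr)
    have hlim : Tendsto (fun n : ℕ => ENNReal.ofReal (d * κ * ((1 / 2) ^ n * ‖F z - y‖))) atTop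
        (𝓝 0) := by
      rw [← ENNReal.ofReal_zero]
      refine ENNReal.tendsto_ofReal ?_
      have := (tendsto_pow_atTop_nhds_zero_of_lt_one (r := (1 / 2 : ℝ)) (by norm_num)
        (by norm_num)).mul_const (‖F z - y‖)
      simpa using this.const_mul (d * κ)
    have hsq := tendsto_of_tendsto_of_tendsto_of_le_of_le tendsto_const_nhds hlim
      (fun n => zero_le) hW
    have hroot := ((ENNReal.continuous_rpow_const (y := (1 / 2 : ℝ))).tendsto 0).comp hsq
    rw [ENNReal.zero_rpow_of_pos (by norm_num)] at hroot
    refine hroot.congr fun n => ?_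
    simp only [Function.comp_apply]
    rw [← ENNReal.rpow_natCast, ← ENNReal.rpow_mul]
    norm_num
  · intro j hj
    refine disjoint_wBall hr0.le ?_
    refine le_of_sq_le_sq ?_ (norm_nonneg _)
    have := hsep i j hj.symm
    nlinarith

end Storage

/-! ### The sampling distribution -/

section Sampling

open scoped RealInnerProductSpace Pointwise

theorem isClosed_spectrumPolytope (d : ℕ) (lmin lmax R : ℝ) :
    IsClosed (spectrumPolytope d lmin lmax R) := by
  have e : spectrumPolytope d lmin lmax R = {l : Vec d | ∑ k, l k = R ^ 2 / 2} ∩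
      ⋂ k, ({l : Vec d | lmin ≤ l k} ∩ {l : Vec d | l k ≤ lmax}) := by
    ext l; simp [spectrumPolytope]
  rw [e]
  refine IsClosed.inter (isClosed_eq (by fun_prop) continuous_const)
    (isClosed_iInter fun k => IsClosed.inter ?_ ?_)
  · exact isClosed_le continuous_const (by fun_prop)
  · exact isClosed_le (by fun_prop) continuous_const

/-- The polytope of spectra has positive and finite `(d - 1)`-dimensional Hausdorff measure: it is
the isometric image of a compact neighbourhood of the origin in the hyperplane orthogonal to the
all-ones vector. -/
theorem hausdorffMeasure_spectrumPolytope {d : ℕ} (hd : 1 ≤ d) {lmin lmax R : ℝ}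
    (h : lmin < lmax) (hR : R ^ 2 = d * (lmax + lmin)) :
    Measure.hausdorffMeasure ((d : ℝ) - 1) (spectrumPolytope d lmin lmax R) ≠ 0 ∧
    Measure.hausdorffMeasure ((d : ℝ) - 1) (spectrumPolytope d lmin lmax R) ≠ ∞ := by
  obtain ⟨n, rfl⟩ : ∃ n, d = n + 1 := ⟨d - 1, by omega⟩
  set one : Vec (n + 1) := WithLp.toLp 2 (fun _ => 1) with hone
  have hone0 : one ≠ 0 := fun h0 => by
    have := congrArg (fun v : Vec (n + 1) => v 0) h0
    simp [hone] at this
  set V : Submodule ℝ (Vec (n + 1)) := (Submodule.span ℝ {one})ᗮ with hV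
  have hfin : Module.finrank ℝ V = n := by
    have : Fact (Module.finrank ℝ (Vec (n + 1)) = n + 1) := ⟨by simp⟩
    exact Submodule.finrank_orthogonal_span_singleton hone0
  have hmem : ∀ v : Vec (n + 1), v ∈ V ↔ ∑ k, v k = 0 := fun v => by
    rw [hV, Submodule.mem_orthogonal_singleton_iff_inner_right, PiLp.inner_apply]
    simp [hone]
  set c : ℝ := (lmax + lmin) / 2 with hc
  set f : V → Vec (n + 1) := fun v => c • one + (v : Vec (n + 1)) with hf
  have hiso : Isometry f := Isometry.of_dist_eq fun v w => by
    simp [hf, dist_add_left, Subtype.dist_eq]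
  have hfk : ∀ (v : V) k, f v k = c + (v : Vec (n + 1)) k := fun v k => by simp [hf, hone]
  set P : Set V := f ⁻¹' (spectrumPolytope (n + 1) lmin lmax R) with hP
  have hcsum : ∑ _k : Fin (n + 1), c = R ^ 2 / 2 := by
    rw [hR, hc]
    simp only [Finset.sum_const, Finset.card_univ, Fintype.card_fin, nsmul_eq_mul]
    ring
  have himage : f '' P = spectrumPolytope (n + 1) lmin lmax R := by
    rw [hP, Set.image_preimage_eq_iff]
    intro l hl
    have h1 : l - c • one ∈ V := by
      rw [hmem]
      have := hl.1
      simp only [PiLp.sub_apply, PiLp.smul_apply, hone, smul_eq_mul, mul_one,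
        Finset.sum_sub_distrib]
      rw [this, hcsum, sub_self]
    exact ⟨⟨_, h1⟩, by simp [hf]⟩
  have hmeas : Measure.hausdorffMeasure (((n + 1 : ℕ) : ℝ) - 1)
      (spectrumPolytope (n + 1) lmin lmax R)
      = Measure.hausdorffMeasure (Module.finrank ℝ V : ℝ) P := by
    rw [← himage, hfin]
    have : (((n + 1 : ℕ) : ℝ) - 1) = (n : ℝ) := by push_cast; ring
    rw [this, hiso.hausdorffMeasure_image (Or.inl (by positivity))]
  rw [hmeas]
  constructor
  · set ε := (lmax - lmin) / 2 with hε
    have hsub : Metric.ball (0 : V) ε ⊆ P := fun v hv => by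
      have hv' : ‖(v : Vec (n + 1))‖ < ε := by simpa using hv
      refine ⟨?_, fun k => ?_⟩
      · simp_rw [hfk, Finset.sum_add_distrib]
        rw [(hmem v).1 v.2, add_zero, hcsum]
      · have := (PiLp.norm_apply_le (v : Vec (n + 1)) k).trans hv'.le
        rw [Real.norm_eq_abs, abs_le] at this
        rw [hfk, hc]
        constructor <;> linarith
    have hpos : 0 < Measure.hausdorffMeasure (Module.finrank ℝ V : ℝ) (Metric.ball (0 : V) ε) :=
      Metric.isOpen_ball.measure_pos _ (Metric.nonempty_ball.2 (by rw [hε]; linarith))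
    exact (hpos.trans_le (measure_mono hsub)).ne'
  · have hcl : IsClosed P := (isClosed_spectrumPolytope _ _ _ _).preimage hiso.continuous
    have hbd : Bornology.IsBounded P := by
      have h1 : Bornology.IsBounded (spectrumPolytope (n + 1) lmin lmax R) := by
        refine isBounded_iff_forall_norm_le.2
          ⟨√(∑ _k : Fin (n + 1), (|lmin| + |lmax|) ^ 2), fun l hl => ?_⟩
        rw [EuclideanSpace.norm_eq]
        refine Real.sqrt_le_sqrt (Finset.sum_le_sum fun k _ => ?_)
        have h2 := hl.2 k
        gcongr
        rw [Real.norm_eq_abs, abs_le]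
        constructor
        · linarith [neg_abs_le lmin, abs_nonneg lmax]
        · linarith [le_abs_self lmax, abs_nonneg lmin]
      exact hiso.antilipschitz.isBounded_preimage h1
    have hcpt : IsCompact P := Metric.isCompact_of_isClosed_isBounded hcl hbd
    exact hcpt.measure_lt_top.ne

theorem isProbabilityMeasure_uniformPolytope {d : ℕ} (hd : 1 ≤ d) {lmin lmax R : ℝ}
    (h : lmin < lmax) (hR : R ^ 2 = d * (lmax + lmin)) :
    IsProbabilityMeasure (uniformPolytope d lmin lmax R) := by
  obtain ⟨h0, h1⟩ := hausdorffMeasure_spectrumPolytope hd h hR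
  exact cond_isProbabilityMeasure_of_finite h0 h1

theorem ae_uniformPolytope (d : ℕ) (lmin lmax R : ℝ) :
    ∀ᵐ l ∂(uniformPolytope d lmin lmax R), l ∈ spectrumPolytope d lmin lmax R :=
  ae_cond_mem (isClosed_spectrumPolytope d lmin lmax R).measurableSet

theorem isProbabilityMeasure_uniformUnitSphere {d : ℕ} (hd : 1 ≤ d) :
    IsProbabilityMeasure (uniformUnitSphere d) := by
  refine ⟨?_⟩
  have : Nonempty (Fin d) := ⟨⟨0, hd⟩⟩
  rw [uniformUnitSphere, Measure.smul_apply, smul_eq_mul]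
  refine ENNReal.inv_mul_cancel ?_ (measure_ne_top _ _)
  rw [Measure.measure_univ_ne_zero]
  exact Measure.toSphere_ne_zero _

theorem measurable_smul_sphere (d : ℕ) (ρ : ℝ) :
    Measurable (fun u : Metric.sphere (0 : Vec d) 1 => ρ • (u : Vec d)) := by fun_prop

theorem isProbabilityMeasure_uniformSphere {d : ℕ} (hd : 1 ≤ d) (ρ : ℝ) :
    IsProbabilityMeasure (uniformSphere d ρ) := by
  have := isProbabilityMeasure_uniformUnitSphere hd
  exact Measure.isProbabilityMeasure_map (measurable_smul_sphere d ρ).aemeasurable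

theorem ae_uniformSphere (d : ℕ) {ρ : ℝ} (hρ : 0 ≤ ρ) :
    ∀ᵐ u ∂(uniformSphere d ρ), ‖u‖ = ρ := by
  rw [uniformSphere, ae_map_iff (measurable_smul_sphere d ρ).aemeasurable
    (measurableSet_eq_fun (by fun_prop) (by fun_prop))]
  refine ae_of_all _ fun u => ?_
  rw [norm_smul, Real.norm_eq_abs, abs_of_nonneg hρ, mem_sphere_zero_iff_norm.1 u.2, mul_one]

/-- Spherical caps have exponentially small measure: the cone over the cap at height `t` is
contained in a ball of radius `√(1 - t²)`. -/
theorem uniformSphere_cap_le {d : ℕ} (hd : 1 ≤ d) {ρ t : ℝ} (hρ : 0 < ρ) (ht : 0 ≤ t)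
    (ht2 : t ^ 2 ≤ 1 / 2) {v : Vec d} (hv : ‖v‖ = ρ) :
    uniformSphere d ρ {u | t * ρ ^ 2 ≤ ⟪v, u⟫} ≤ ENNReal.ofReal (Real.exp (-(d * t ^ 2 / 2))) := by
  have : Nonempty (Fin d) := ⟨⟨0, hd⟩⟩
  set e : Vec d := ρ⁻¹ • v with he
  have hen : ‖e‖ = 1 := by
    rw [he, norm_smul, hv, norm_inv, Real.norm_eq_abs, abs_of_pos hρ, inv_mul_cancel₀ hρ.ne']
  have hmeas : MeasurableSet {u : Vec d | t * ρ ^ 2 ≤ ⟪v, u⟫} :=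
    measurableSet_le measurable_const (by fun_prop)
  set A : Set (Metric.sphere (0 : Vec d) 1) := {u | t ≤ ⟪e, (u : Vec d)⟫} with hA
  have hAm : MeasurableSet A := measurableSet_le measurable_const (by fun_prop)
  have hpre : (fun u : Metric.sphere (0 : Vec d) 1 => ρ • (u : Vec d)) ⁻¹'
      {u | t * ρ ^ 2 ≤ ⟪v, u⟫} = A := by
    ext u
    simp only [Set.mem_preimage, Set.mem_ofPred_eq, hA, he, real_inner_smul_left,
      real_inner_smul_right]
    rw [inv_mul_eq_div, le_div_iff₀ hρ]
    constructor <;> intro h <;> nlinarith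
  rw [uniformSphere, Measure.map_apply (measurable_smul_sphere d ρ) hmeas, hpre, uniformUnitSphere,
    Measure.smul_apply, smul_eq_mul, Measure.toSphere_apply' _ hAm, Measure.toSphere_apply_univ]
  set q := √(1 - t ^ 2) with hq
  have hsub : Set.Ioo (0 : ℝ) 1 • ((↑) '' A : Set (Vec d)) ⊆ Metric.closedBall (t • e) q := by
    rintro _ ⟨s, hs, _, ⟨u, hu, rfl⟩, rfl⟩
    have hu1 : ‖(u : Vec d)‖ = 1 := mem_sphere_zero_iff_norm.1 u.2
    have hu2 : t ≤ ⟪e, (u : Vec d)⟫ := hu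
    rw [Metric.mem_closedBall, dist_eq_norm, hq]
    refine Real.le_sqrt_of_sq_le ?_
    simp only
    rw [norm_sub_sq_real, norm_smul, norm_smul, hu1, hen, real_inner_smul_left,
      real_inner_smul_right, real_inner_comm, Real.norm_eq_abs, Real.norm_eq_abs,
      abs_of_pos hs.1, abs_of_nonneg ht]
    have h1 : s * (t * t) ≤ s * (t * ⟪e, (u : Vec d)⟫) :=
      mul_le_mul_of_nonneg_left (mul_le_mul_of_nonneg_left hu2 ht) hs.1.le
    nlinarith [mul_nonneg hs.1.le (sub_nonneg.2 hs.2.le), hs.1, hs.2]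
  have hvol : (volume : Measure (Vec d)) (Set.Ioo (0 : ℝ) 1 • ((↑) '' A : Set (Vec d)))
      ≤ ENNReal.ofReal (q ^ d) * volume (Metric.ball (0 : Vec d) 1) := by
    refine (measure_mono hsub).trans (le_of_eq ?_)
    rw [Measure.addHaar_closedBall _ _ (Real.sqrt_nonneg _), finrank_euclideanSpace_fin]
  have hb0 : (volume : Measure (Vec d)) (Metric.ball 0 1) ≠ 0 :=
    (Metric.measure_ball_pos _ _ one_pos).ne'
  have hbt : (volume : Measure (Vec d)) (Metric.ball 0 1) ≠ ∞ := measure_ball_lt_top.ne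
  have hd0 : (Module.finrank ℝ (Vec d) : ℝ≥0∞) ≠ 0 := by
    simp; omega
  set β := (volume : Measure (Vec d)) (Metric.ball 0 1)
  set D : ℝ≥0∞ := (Module.finrank ℝ (Vec d) : ℝ≥0∞)
  have hDt : D ≠ ∞ := ENNReal.natCast_ne_top _
  have hexp : q ^ d ≤ Real.exp (-(d * t ^ 2 / 2)) := by
    have h1 : q ≤ Real.exp (-(t ^ 2 / 2)) := by
      rw [hq, Real.sqrt_le_left (Real.exp_pos _).le, ← Real.exp_nat_mul]
      have := Real.add_one_le_exp (-t ^ 2)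
      have e : ((2 : ℕ) : ℝ) * -(t ^ 2 / 2) = -t ^ 2 := by push_cast; ring
      rw [e]
      linarith
    calc q ^ d ≤ Real.exp (-(t ^ 2 / 2)) ^ d := by
          gcongr
      _ = _ := by rw [← Real.exp_nat_mul]; congr 1; ring
  calc (D * β)⁻¹ * (D * volume (Set.Ioo (0 : ℝ) 1 • ((↑) '' A : Set (Vec d))))
      ≤ (D * β)⁻¹ * (D * (ENNReal.ofReal (q ^ d) * β)) := by gcongr
    _ = ((D * β)⁻¹ * (D * β)) * ENNReal.ofReal (q ^ d) := by ring
    _ = ENNReal.ofReal (q ^ d) := by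
        rw [ENNReal.inv_mul_cancel (mul_ne_zero hd0 hb0) (ENNReal.mul_ne_top hDt hbt), one_mul]
    _ ≤ _ := ENNReal.ofReal_le_ofReal hexp

variable {d N : ℕ} {lmin lmax R : ℝ}

theorem isProbabilityMeasure_sampleLaw (hd : 1 ≤ d) (h : lmin < lmax)
    (hR : R ^ 2 = d * (lmax + lmin)) : IsProbabilityMeasure (sampleLaw d N lmin lmax R) := by
  have := isProbabilityMeasure_uniformPolytope hd h hR
  have := isProbabilityMeasure_uniformSphere hd (R / √2)
  unfold sampleLaw
  infer_instance

/-- The support of the sampling distribution. -/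
def sampleSupport (d N : ℕ) (lmin lmax R : ℝ) : Set (Fin N → Vec d × Vec d) :=
  {s | ∀ i, (s i).1 ∈ spectrumPolytope d lmin lmax R ∧ ‖(s i).2‖ = R / √2}

theorem measurableSet_sampleSupport : MeasurableSet (sampleSupport d N lmin lmax R) := by
  have e : sampleSupport d N lmin lmax R = ⋂ i, ({s | (s i).1 ∈ spectrumPolytope d lmin lmax R} ∩
      {s | ‖(s i).2‖ = R / √2}) := by
    ext s; simp [sampleSupport]
  rw [e]
  refine MeasurableSet.iInter fun i => MeasurableSet.inter ?_ ?_
  · have : Measurable fun s : Fin N → Vec d × Vec d => (s i).1 := by fun_prop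
    exact this (isClosed_spectrumPolytope d lmin lmax R).measurableSet
  · exact measurableSet_eq_fun (by fun_prop) measurable_const

theorem ae_sampleLaw_mem_support (hd : 1 ≤ d) (h : lmin < lmax) (hR0 : 0 ≤ R)
    (hR : R ^ 2 = d * (lmax + lmin)) :
    ∀ᵐ s ∂(sampleLaw d N lmin lmax R), s ∈ sampleSupport d N lmin lmax R := by
  have := isProbabilityMeasure_uniformPolytope hd h hR
  have := isProbabilityMeasure_uniformSphere hd (R / √2)
  have h1 : ∀ᵐ z ∂((uniformPolytope d lmin lmax R).prod (uniformSphere d (R / √2))),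
      z.1 ∈ spectrumPolytope d lmin lmax R ∧ ‖z.2‖ = R / √2 := by
    have k1 := Measure.quasiMeasurePreserving_fst (μ := uniformPolytope d lmin lmax R)
      (ν := uniformSphere d (R / √2)) |>.ae (ae_uniformPolytope d lmin lmax R)
    have k2 := Measure.quasiMeasurePreserving_snd (μ := uniformPolytope d lmin lmax R)
      (ν := uniformSphere d (R / √2)) |>.ae (ae_uniformSphere d (ρ := R / √2) (by positivity))
    exact k1.and k2
  refine ae_all_iff.2 fun i => ?_
  have h2 := (Measure.tendsto_eval_ae_ae (μ := fun _ : Fin N =>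
    (uniformPolytope d lmin lmax R).prod (uniformSphere d (R / √2))) (i := i)).eventually h1
  exact h2

/-- Two distinct mean vectors are independent, so that the cap bound applies to their angle. -/
theorem sampleLaw_inner_ge_le (hd : 1 ≤ d) (h : lmin < lmax) (hR0 : 0 < R)
    (hR : R ^ 2 = d * (lmax + lmin)) {t : ℝ} (ht : 0 ≤ t) (ht2 : t ^ 2 ≤ 1 / 2) {i j : Fin N}
    (hij : i ≠ j) :
    sampleLaw d N lmin lmax R {s | t * (R / √2) ^ 2 ≤ ⟪(s i).2, (s j).2⟫}
      ≤ ENNReal.ofReal (Real.exp (-(d * t ^ 2 / 2))) := by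
  have := isProbabilityMeasure_uniformPolytope hd h hR
  have := isProbabilityMeasure_uniformSphere hd (R / √2)
  have hρ : 0 < R / √2 := by positivity
  set σ := uniformSphere d (R / √2)
  have hind : IndepFun (fun s : Fin N → Vec d × Vec d => (s i).2) (fun s => (s j).2)
      (sampleLaw d N lmin lmax R) := by
    have := iIndepFun_pi (μ := fun _ : Fin N => (uniformPolytope d lmin lmax R).prod σ)
      (X := fun _ z => z.2) (fun _ => measurable_snd.aemeasurable)
    exact this.indepFun hij
  have hmap : ∀ k : Fin N, (sampleLaw d N lmin lmax R).map (fun s => (s k).2) = σ := fun k => by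
    have h1 := (measurePreserving_eval
      (fun _ : Fin N => (uniformPolytope d lmin lmax R).prod σ) k).map_eq
    have h2 : (fun s : Fin N → Vec d × Vec d => (s k).2) = Prod.snd ∘ Function.eval k := rfl
    rw [h2, ← Measure.map_map measurable_snd (measurable_pi_apply k), sampleLaw, h1,
      Measure.map_snd_prod, measure_univ, one_smul]
  have := isProbabilityMeasure_sampleLaw (N := N) hd h hR
  have hmk : ∀ k : Fin N, Measurable fun s : Fin N → Vec d × Vec d => (s k).2 := fun k => by
    fun_prop
  have hprod := (indepFun_iff_map_prod_eq_prod_map_map (hmk i).aemeasurable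
    (hmk j).aemeasurable).1 hind
  rw [hmap, hmap] at hprod
  have hset : MeasurableSet {z : Vec d × Vec d | t * (R / √2) ^ 2 ≤ ⟪z.1, z.2⟫} :=
    measurableSet_le measurable_const (by fun_prop)
  have e : {s : Fin N → Vec d × Vec d | t * (R / √2) ^ 2 ≤ ⟪(s i).2, (s j).2⟫}
      = (fun s => ((s i).2, (s j).2)) ⁻¹' {z | t * (R / √2) ^ 2 ≤ ⟪z.1, z.2⟫} := rfl
  rw [e, ← Measure.map_apply (by fun_prop) hset, hprod, Measure.prod_apply hset]
  calc _ ≤ ∫⁻ _v, ENNReal.ofReal (Real.exp (-(d * t ^ 2 / 2))) ∂σ := by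
        refine lintegral_mono_ae ?_
        filter_upwards [ae_uniformSphere d hρ.le] with v hv
        exact uniformSphere_cap_le hd hρ ht ht2 hv
    _ = _ := by simp

/-- The event that all samples lie in the support of the sampling distribution and all pairs of
mean vectors have angle with cosine less than `t`. -/
def goodEvent (d N : ℕ) (lmin lmax R t : ℝ) : Set (Fin N → Vec d × Vec d) :=
  sampleSupport d N lmin lmax R ∩
    {s | ∀ i j, i ≠ j → ⟪(s i).2, (s j).2⟫ < t * (R / √2) ^ 2}

theorem measurableSet_goodEvent (t : ℝ) : MeasurableSet (goodEvent d N lmin lmax R t) := by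
  refine measurableSet_sampleSupport.inter ?_
  have e : {s : Fin N → Vec d × Vec d | ∀ i j, i ≠ j → ⟪(s i).2, (s j).2⟫ < t * (R / √2) ^ 2}
      = ⋂ i, ⋂ j, ⋂ (_ : i ≠ j), {s | ⟪(s i).2, (s j).2⟫ < t * (R / √2) ^ 2} := by
    ext s; simp
  rw [e]
  exact MeasurableSet.iInter fun i => MeasurableSet.iInter fun j => MeasurableSet.iInter fun _ =>
    measurableSet_lt (by fun_prop) measurable_const

/-- Union bound over the pairs of mean vectors. -/
theorem le_sampleLaw_goodEvent (hd : 1 ≤ d) (h : lmin < lmax) (hR0 : 0 < R)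
    (hR : R ^ 2 = d * (lmax + lmin)) {t p : ℝ} (ht : 0 ≤ t) (ht2 : t ^ 2 ≤ 1 / 2)
    (hp : (N : ℝ) ^ 2 * Real.exp (-(d * t ^ 2 / 2)) ≤ p) :
    ENNReal.ofReal (1 - p) ≤ sampleLaw d N lmin lmax R (goodEvent d N lmin lmax R t) := by
  have := isProbabilityMeasure_sampleLaw (N := N) hd h hR
  set μ := sampleLaw d N lmin lmax R
  set δ := Real.exp (-(d * t ^ 2 / 2))
  have hp0 : 0 ≤ p := le_trans (by positivity) hp
  have hc : μ (goodEvent d N lmin lmax R t)ᶜ ≤ ENNReal.ofReal p := by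
    have hsub : (goodEvent d N lmin lmax R t)ᶜ ⊆ (sampleSupport d N lmin lmax R)ᶜ ∪
        ⋃ i, ⋃ j, ⋃ (_ : i ≠ j), {s | t * (R / √2) ^ 2 ≤ ⟪(s i).2, (s j).2⟫} := by
      intro s hs
      by_cases hs1 : s ∈ sampleSupport d N lmin lmax R
      · right
        by_contra hcon
        refine hs ⟨hs1, fun i j hij => ?_⟩
        by_contra hlt
        exact hcon (by simp only [Set.mem_iUnion]; exact ⟨i, j, hij, not_lt.1 hlt⟩)
      · left; exact hs1
    have h0 : μ (sampleSupport d N lmin lmax R)ᶜ = 0 :=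
      ae_sampleLaw_mem_support hd h hR0.le hR
    have h1 : ∀ i j : Fin N, μ (⋃ (_ : i ≠ j), {s | t * (R / √2) ^ 2 ≤ ⟪(s i).2, (s j).2⟫})
        ≤ ENNReal.ofReal δ := fun i j => by
      by_cases hij : i = j
      · simp [hij]
      · simpa [hij] using sampleLaw_inner_ge_le hd h hR0 hR ht ht2 hij
    calc _ ≤ μ (sampleSupport d N lmin lmax R)ᶜ +
          μ (⋃ i, ⋃ j, ⋃ (_ : i ≠ j), {s | t * (R / √2) ^ 2 ≤ ⟪(s i).2, (s j).2⟫}) :=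
          (measure_mono hsub).trans (measure_union_le _ _)
      _ ≤ 0 + ∑ _i : Fin N, ∑ _j : Fin N, ENNReal.ofReal δ := by
          rw [h0]
          gcongr
          refine (measure_iUnion_fintype_le _ _).trans (Finset.sum_le_sum fun i _ => ?_)
          exact (measure_iUnion_fintype_le _ _).trans (Finset.sum_le_sum fun j _ => h1 i j)
      _ = ENNReal.ofReal (N ^ 2 * δ) := by
          rw [ENNReal.ofReal_mul (by positivity), ENNReal.ofReal_pow (by positivity)]
          simp
          ring
      _ ≤ ENNReal.ofReal p := ENNReal.ofReal_le_ofReal hp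
  have h3 : 1 - ENNReal.ofReal p ≤ μ (goodEvent d N lmin lmax R t) := by
    rw [tsub_le_iff_right, ← measure_univ (μ := μ),
      ← measure_add_measure_compl (measurableSet_goodEvent t)]
    gcongr
  rwa [ENNReal.ofReal_sub _ hp0, ENNReal.ofReal_one]

end Sampling

/-! ### Overlaps of Gaussian densities -/

section Overlap

open scoped RealInnerProductSpace NNReal

/-- The overlap of two one-dimensional Gaussian densities, by completing the square. -/
theorem integral_gaussianPDFReal_mul (m m' : ℝ) {v v' : ℝ≥0} (hv : 0 < v) (hv' : 0 < v') :
    ∫ x, gaussianPDFReal m v x * gaussianPDFReal m' v' x = gaussianPDFReal m' (v + v') m := by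
  have hv1 : (0 : ℝ) < v := by exact_mod_cast hv
  have hv1' : (0 : ℝ) < v' := by exact_mod_cast hv'
  set τ : ℝ≥0 := v * v' / (v + v') with hτ
  have hτ0 : τ ≠ 0 := by positivity
  set c : ℝ := (m * v' + m' * v) / (v + v') with hc
  have key : ∀ x, gaussianPDFReal m v x * gaussianPDFReal m' v' x
      = gaussianPDFReal m' (v + v') m * gaussianPDFReal c τ x := fun x => by
    simp only [gaussianPDFReal]
    have e1 : (√(2 * Real.pi * v))⁻¹ * (√(2 * Real.pi * v'))⁻¹
        = (√(2 * Real.pi * ((v + v' : ℝ≥0) : ℝ)))⁻¹ * (√(2 * Real.pi * (τ : ℝ)))⁻¹ := by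
      rw [← mul_inv, ← mul_inv, ← Real.sqrt_mul (by positivity), ← Real.sqrt_mul (by positivity)]
      congr 2
      rw [hτ]
      push_cast
      field_simp
    have e2 : -(x - m) ^ 2 / (2 * (v : ℝ)) + -(x - m') ^ 2 / (2 * (v' : ℝ))
        = -(m - m') ^ 2 / (2 * ((v + v' : ℝ≥0) : ℝ)) + -(x - c) ^ 2 / (2 * (τ : ℝ)) := by
      rw [hτ, hc]
      push_cast
      field_simp
      ring
    rw [mul_mul_mul_comm, e1, ← Real.exp_add, e2, Real.exp_add]
    ring
  simp_rw [key]
  rw [integral_const_mul, integral_gaussianPDFReal_eq_one _ hτ0, mul_one]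

variable {ι : Type*} [Fintype ι]

theorem pi_gaussianReal_eq_withDensity (m : ι → ℝ) {v : ι → ℝ≥0} (hv : ∀ k, v k ≠ 0) :
    Measure.pi (fun k => gaussianReal (m k) (v k))
      = volume.withDensity (fun x => ENNReal.ofReal (∏ k, gaussianPDFReal (m k) (v k) (x k))) := by
  refine Measure.pi_eq fun s hs => ?_
  have hnn : ∀ x : ι → ℝ, 0 ≤ ∏ k, gaussianPDFReal (m k) (v k) (x k) := fun x =>
    Finset.prod_nonneg fun k _ => gaussianPDFReal_nonneg _ _ _
  rw [withDensity_apply _ (MeasurableSet.univ_pi hs), volume_pi, Measure.restrict_pi_pi,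
    ← ofReal_integral_eq_lintegral_ofReal, integral_fintype_prod_eq_prod,
    ENNReal.ofReal_prod_of_nonneg]
  · refine Finset.prod_congr rfl fun k _ => ?_
    rw [gaussianReal_apply_eq_integral _ (hv k)]
  · exact fun k _ => integral_nonneg fun x => gaussianPDFReal_nonneg _ _ _
  · exact Integrable.fintype_prod fun k => (integrable_gaussianPDFReal (m k) (v k)).restrict
  · exact ae_of_all _ hnn

theorem integral_rnDeriv_pi_gaussianReal (m m' : ι → ℝ) {v v' : ι → ℝ≥0} (hv : ∀ k, 0 < v k)
    (hv' : ∀ k, 0 < v' k) :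
    ∫ x, ((Measure.pi fun k => gaussianReal (m k) (v k)).rnDeriv volume x).toReal
        * ((Measure.pi fun k => gaussianReal (m' k) (v' k)).rnDeriv volume x).toReal
      = ∏ k, gaussianPDFReal (m' k) (v k + v' k) (m k) := by
  have hae : ∀ (m : ι → ℝ) {v : ι → ℝ≥0}, (∀ k, 0 < v k) → ∀ᵐ x ∂(volume : Measure (ι → ℝ)),
      ((Measure.pi fun k => gaussianReal (m k) (v k)).rnDeriv volume x).toReal
        = ∏ k, gaussianPDFReal (m k) (v k) (x k) := fun m v hv => by
    rw [pi_gaussianReal_eq_withDensity m fun k => (hv k).ne']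
    have hmeas : Measurable fun x : ι → ℝ =>
        ENNReal.ofReal (∏ k, gaussianPDFReal (m k) (v k) (x k)) := by
      refine (Finset.measurable_prod _ fun k _ => ?_).ennreal_ofReal
      exact (measurable_gaussianPDFReal _ _).comp (measurable_pi_apply k)
    filter_upwards [Measure.rnDeriv_withDensity volume hmeas] with x hx
    rw [hx, ENNReal.toReal_ofReal (Finset.prod_nonneg fun k _ => gaussianPDFReal_nonneg _ _ _)]
  have h1 : ∀ᵐ x ∂(volume : Measure (ι → ℝ)),
      ((Measure.pi fun k => gaussianReal (m k) (v k)).rnDeriv volume x).toReal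
        * ((Measure.pi fun k => gaussianReal (m' k) (v' k)).rnDeriv volume x).toReal
      = ∏ k, (gaussianPDFReal (m k) (v k) (x k) * gaussianPDFReal (m' k) (v' k) (x k)) := by
    filter_upwards [hae m hv, hae m' hv'] with x hx hx'
    rw [hx, hx', Finset.prod_mul_distrib]
  rw [integral_congr_ae h1, integral_fintype_prod_volume_eq_prod
    (fun k y => gaussianPDFReal (m k) (v k) y * gaussianPDFReal (m' k) (v' k) y)]
  exact Finset.prod_congr rfl fun k _ => integral_gaussianPDFReal_mul _ _ (hv k) (hv' k)

variable {d : ℕ}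

theorem norm_op_orthogonal {U : Matrix (Fin d) (Fin d) ℝ}
    (hU : U ∈ Matrix.orthogonalGroup (Fin d) ℝ) (v : Vec d) : ‖op U v‖ = ‖v‖ := by
  have h : Uᵀ * U = 1 := (Matrix.mem_orthogonalGroup_iff' (Fin d) ℝ).1 hU
  have : ‖op U v‖ ^ 2 = ‖v‖ ^ 2 := by
    rw [← real_inner_self_eq_norm_sq, inner_op_left, ← op_mul_apply, h]
    simp [op]
  exact (pow_left_inj₀ (norm_nonneg _) (norm_nonneg _) two_ne_zero).1 this

/-- The isometry of Euclidean space given by an orthogonal matrix. -/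
noncomputable def orthogonalIsometry {U : Matrix (Fin d) (Fin d) ℝ}
    (hU : U ∈ Matrix.orthogonalGroup (Fin d) ℝ) : Vec d ≃ₗᵢ[ℝ] Vec d :=
  LinearIsometry.toLinearIsometryEquiv ⟨(op U).toLinearMap, norm_op_orthogonal hU⟩ rfl

/-- A Gaussian measure whose covariance is diagonalized by `U` is the image under `U` of a product
of one-dimensional Gaussian measures. -/
theorem multivariateGaussian_eq_map_pi {U : Matrix (Fin d) (Fin d) ℝ}
    (hU : U ∈ Matrix.orthogonalGroup (Fin d) ℝ) (m : Vec d) {lam : Fin d → ℝ}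
    (hlam : ∀ k, 0 ≤ lam k) :
    multivariateGaussian m (U * Matrix.diagonal lam * Uᵀ)
      = (Measure.pi fun k => gaussianReal (op Uᵀ m k) (lam k).toNNReal).map
          (fun x => op U (WithLp.toLp 2 x)) := by
  have hd : (Matrix.diagonal lam).PosSemidef := Matrix.posSemidef_diagonal_iff.2 hlam
  have h1 : (Measure.pi fun k => gaussianReal (op Uᵀ m k) (lam k).toNNReal).map (WithLp.toLp 2)
      = multivariateGaussian (op Uᵀ m) (Matrix.diagonal lam) := by
    apply Measure.ext_of_charFun (E := Vec d)
    ext t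
    rw [charFun_multivariateGaussian hd, charFun_pi]
    simp_rw [charFun_gaussianReal]
    rw [← Complex.exp_sum, Finset.sum_sub_distrib]
    congr 2
    · rw [PiLp.inner_apply]
      push_cast
      rw [Finset.sum_mul]
      refine Finset.sum_congr rfl fun k _ => ?_
      simp
      ring
    · rw [dotProduct, Complex.ofReal_sum, Finset.sum_div]
      refine Finset.sum_congr rfl fun k _ => ?_
      rw [Matrix.mulVec_diagonal, Real.coe_toNNReal _ (hlam k)]
      push_cast
      ring
  have h2 := map_affine_multivariateGaussian hd (op Uᵀ m) m U
  have h3 : (fun x : Vec d => m + op U (x - op Uᵀ m)) = op U := by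
    ext1 x
    have h : U * Uᵀ = 1 := (Matrix.mem_orthogonalGroup_iff (Fin d) ℝ).1 hU
    rw [map_sub, ← op_mul_apply, h]
    simp [op]
  rw [← h2, h3, ← h1, Measure.map_map (by fun_prop) (by fun_prop)]
  rfl

/-- The common eigenbasis reduces the overlap to one-dimensional overlaps. -/
theorem l2Inner_eq_prod {U : Matrix (Fin d) (Fin d) ℝ}
    (hU : U ∈ Matrix.orthogonalGroup (Fin d) ℝ) (m m' : Vec d) {lam lam' : Fin d → ℝ}
    (hlam : ∀ k, 0 < lam k) (hlam' : ∀ k, 0 < lam' k) :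
    l2Inner (multivariateGaussian m (U * Matrix.diagonal lam * Uᵀ))
        (multivariateGaussian m' (U * Matrix.diagonal lam' * Uᵀ))
      = ∏ k, gaussianPDFReal (op Uᵀ m' k) ((lam k).toNNReal + (lam' k).toNNReal)
          (op Uᵀ m k) := by
  set e : (Fin d → ℝ) ≃ᵐ Vec d :=
    (MeasurableEquiv.toLp 2 (Fin d → ℝ)).trans (orthogonalIsometry hU).toMeasurableEquiv
  have hemp : MeasurePreserving e volume volume :=
    (orthogonalIsometry hU).measurePreserving.comp (PiLp.volume_preserving_toLp (Fin d))
  have hfun : (fun x : Fin d → ℝ => op U (WithLp.toLp 2 x)) = e := rfl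
  have hemb := e.measurableEmbedding
  rw [multivariateGaussian_eq_map_pi hU m fun k => (hlam k).le,
    multivariateGaussian_eq_map_pi hU m' fun k => (hlam' k).le, hfun, l2Inner,
    ← hemp.integral_comp hemb]
  have hrn : ∀ μ : Measure (Fin d → ℝ), SigmaFinite μ → ∀ᵐ x ∂(volume : Measure (Fin d → ℝ)),
      (μ.map e).rnDeriv volume (e x) = μ.rnDeriv volume x := fun μ _ => by
    have := hemb.rnDeriv_map μ volume
    rwa [hemp.map_eq] at this
  rw [← integral_rnDeriv_pi_gaussianReal _ _ (fun k => Real.toNNReal_pos.2 (hlam k))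
    (fun k => Real.toNNReal_pos.2 (hlam' k))]
  refine integral_congr_ae ?_
  filter_upwards [hrn (Measure.pi fun k => gaussianReal (op Uᵀ m k) (lam k).toNNReal)
    inferInstance, hrn (Measure.pi fun k => gaussianReal (op Uᵀ m' k) (lam' k).toNNReal)
    inferInstance] with x hx hx'
  rw [hx, hx']

/-- Lower bound for the separation of two Gaussian measures with a common eigenbasis. -/
theorem le_neg_log_l2Inner {U : Matrix (Fin d) (Fin d) ℝ}
    (hU : U ∈ Matrix.orthogonalGroup (Fin d) ℝ) (m m' : Vec d) {lam lam' : Fin d → ℝ} {l L : ℝ}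
    (hl : 0 < l) (hlam : ∀ k, l ≤ lam k ∧ lam k ≤ L) (hlam' : ∀ k, l ≤ lam' k ∧ lam' k ≤ L) :
    (d : ℝ) / 2 * Real.log (4 * Real.pi * l) + ‖m - m'‖ ^ 2 / (4 * L)
      ≤ -Real.log (l2Inner (multivariateGaussian m (U * Matrix.diagonal lam * Uᵀ))
        (multivariateGaussian m' (U * Matrix.diagonal lam' * Uᵀ))) := by
  have hp : ∀ k, 0 < lam k := fun k => hl.trans_le (hlam k).1
  have hp' : ∀ k, 0 < lam' k := fun k => hl.trans_le (hlam' k).1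
  have hsum : ∀ k, 0 < (lam k).toNNReal + (lam' k).toNNReal := fun k =>
    add_pos (Real.toNNReal_pos.2 (hp k)) (Real.toNNReal_pos.2 (hp' k))
  rw [l2Inner_eq_prod hU m m' hp hp', Real.log_prod
    fun k _ => (gaussianPDFReal_pos _ _ _ (hsum k).ne').ne', ← Finset.sum_neg_distrib]
  have hterm : ∀ k, 1 / 2 * Real.log (4 * Real.pi * l) + (op Uᵀ m k - op Uᵀ m' k) ^ 2 / (4 * L)
      ≤ -Real.log (gaussianPDFReal (op Uᵀ m' k) ((lam k).toNNReal + (lam' k).toNNReal)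
          (op Uᵀ m k)) := fun k => by
    have hs : (((lam k).toNNReal + (lam' k).toNNReal : ℝ≥0) : ℝ) = lam k + lam' k := by
      rw [NNReal.coe_add, Real.coe_toNNReal _ (hp k).le, Real.coe_toNNReal _ (hp' k).le]
    have hpos : 0 < lam k + lam' k := add_pos (hp k) (hp' k)
    rw [gaussianPDFReal, hs, Real.log_mul (by positivity) (Real.exp_pos _).ne', Real.log_exp,
      Real.log_inv, Real.log_sqrt (by positivity)]
    have h1 : Real.log (4 * Real.pi * l) ≤ Real.log (2 * Real.pi * (lam k + lam' k)) := by
      apply Real.log_le_log (by positivity)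
      nlinarith [Real.pi_pos, (hlam k).1, (hlam' k).1]
    have h2 : (op Uᵀ m k - op Uᵀ m' k) ^ 2 / (4 * L)
        ≤ (op Uᵀ m k - op Uᵀ m' k) ^ 2 / (2 * (lam k + lam' k)) :=
      div_le_div_of_nonneg_left (sq_nonneg _) (by positivity)
        (by linarith [(hlam k).2, (hlam' k).2])
    rw [neg_div]
    linarith
  have hnorm : ‖m - m'‖ ^ 2 = ∑ k, (op Uᵀ m k - op Uᵀ m' k) ^ 2 := by
    have hUt : Uᵀ ∈ Matrix.orthogonalGroup (Fin d) ℝ := by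
      rw [Matrix.mem_orthogonalGroup_iff, Matrix.transpose_transpose]
      exact (Matrix.mem_orthogonalGroup_iff' (Fin d) ℝ).1 hU
    rw [← norm_op_orthogonal hUt, EuclideanSpace.real_norm_sq_eq, map_sub]
    rfl
  calc _ = ∑ k, (1 / 2 * Real.log (4 * Real.pi * l)
        + (op Uᵀ m k - op Uᵀ m' k) ^ 2 / (4 * L)) := by
        rw [Finset.sum_add_distrib, ← Finset.sum_div, ← hnorm]
        simp
        ring
    _ ≤ _ := Finset.sum_le_sum fun k _ => hterm k

end Overlap

/-! ### Sampled patterns -/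

section Patterns

open scoped RealInnerProductSpace

variable {d N : ℕ} {lmin lmax R : ℝ} {U : Matrix (Fin d) (Fin d) ℝ}

theorem specIn_conj_diagonal (hU : U ∈ Matrix.orthogonalGroup (Fin d) ℝ) {lam : Fin d → ℝ}
    (h : ∀ k, lmin ≤ lam k ∧ lam k ≤ lmax) :
    SpecIn lmin lmax (U * Matrix.diagonal lam * Uᵀ) := by
  have hUt : Uᵀ ∈ Matrix.orthogonalGroup (Fin d) ℝ := by
    rw [Matrix.mem_orthogonalGroup_iff, Matrix.transpose_transpose]
    exact (Matrix.mem_orthogonalGroup_iff' (Fin d) ℝ).1 hU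
  have hq : ∀ v : Vec d, ⟪v, op (U * Matrix.diagonal lam * Uᵀ) v⟫
      = ∑ k, lam k * (op Uᵀ v k) ^ 2 := fun v => by
    rw [op_mul_apply, op_mul_apply, real_inner_comm, inner_op_left, real_inner_comm,
      Matrix.inner_toEuclideanCLM, dotProduct]
    refine Finset.sum_congr rfl fun k _ => ?_
    rw [Matrix.mulVec_diagonal]
    ring
  have hn : ∀ v : Vec d, ‖v‖ ^ 2 = ∑ k, (op Uᵀ v k) ^ 2 := fun v => by
    rw [← norm_op_orthogonal hUt, EuclideanSpace.real_norm_sq_eq]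
  refine ⟨?_, fun v => ?_, fun v => ?_⟩
  · have := Matrix.isHermitian_mul_mul_conjTranspose U (Matrix.isHermitian_diagonal lam)
    rwa [Matrix.conjTranspose_eq_transpose_of_trivial] at this
  · rw [hq, hn, Finset.mul_sum]
    exact Finset.sum_le_sum fun k _ => mul_le_mul_of_nonneg_right (h k).1 (sq_nonneg _)
  · rw [hq, hn, Finset.mul_sum]
    exact Finset.sum_le_sum fun k _ => mul_le_mul_of_nonneg_right (h k).2 (sq_nonneg _)

/-- Mean and trace of the covariance contribute `R² / 2` each. -/
theorem W2_dirac_patterns (hlmin : 0 ≤ lmin) (hR : 0 ≤ R)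
    (hU : U ∈ Matrix.orthogonalGroup (Fin d) ℝ) {s : Fin N → Vec d × Vec d}
    (hs : s ∈ sampleSupport d N lmin lmax R) (i : Fin N) :
    W2 (Measure.dirac 0) (patterns U s i) = ENNReal.ofReal R := by
  have hS := specIn_conj_diagonal hU (hs i).1.2
  have h : Uᵀ * U = 1 := (Matrix.mem_orthogonalGroup_iff' (Fin d) ℝ).1 hU
  have htr : (U * Matrix.diagonal (fun k => (s i).1 k) * Uᵀ).trace = R ^ 2 / 2 := by
    rw [Matrix.trace_mul_comm, ← mul_assoc, h, one_mul, Matrix.trace_diagonal, (hs i).1.1]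
  have h2 := W2_dirac_sq (hS.posSemidef hlmin) (s i).2
  rw [htr, (hs i).2, div_pow, Real.sq_sqrt zero_le_two, add_halves, ENNReal.ofReal_pow hR] at h2
  exact (ENNReal.pow_right_strictMono two_ne_zero).injective h2

theorem onWassersteinSphere_patterns (hlmin : 0 ≤ lmin) (hR : 0 ≤ R)
    (hU : U ∈ Matrix.orthogonalGroup (Fin d) ℝ) {s : Fin N → Vec d × Vec d}
    (hs : s ∈ sampleSupport d N lmin lmax R) :
    OnWassersteinSphere lmin lmax R (patterns U s) := by
  have h : Uᵀ * U = 1 := (Matrix.mem_orthogonalGroup_iff' (Fin d) ℝ).1 hU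
  refine ⟨fun i => (s i).2, fun i => U * Matrix.diagonal (fun k => (s i).1 k) * Uᵀ,
    fun i => ?_, fun i j => ?_⟩
  · have hS := specIn_conj_diagonal hU (hs i).1.2
    exact ⟨hS.posSemidef hlmin, (specIn_iff.1 hS).2, rfl, W2_dirac_patterns hlmin hR hU hs i⟩
  · have key : ∀ x y : Fin d → ℝ, U * Matrix.diagonal x * Uᵀ * (U * Matrix.diagonal y * Uᵀ)
        = U * Matrix.diagonal (fun k => x k * y k) * Uᵀ := fun x y => by
      calc _ = U * Matrix.diagonal x * (Uᵀ * U) * Matrix.diagonal y * Uᵀ := by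
            simp only [mul_assoc]
        _ = _ := by rw [h, mul_one, mul_assoc U, Matrix.diagonal_mul_diagonal]
    rw [commute_iff_eq, key, key]
    simp_rw [mul_comm]

theorem MW_patterns (hlmin : 0 ≤ lmin) (hR : 0 ≤ R)
    (hU : U ∈ Matrix.orthogonalGroup (Fin d) ℝ) {s : Fin N → Vec d × Vec d}
    (hs : s ∈ sampleSupport d N lmin lmax R) (hN : 1 ≤ N) : MW (patterns U s) = R := by
  have : Nonempty (Fin N) := ⟨⟨0, hN⟩⟩
  unfold MW
  simp_rw [W2_dirac_patterns hlmin hR hU hs, ENNReal.toReal_ofReal hR, ciSup_const]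

theorem norm_sub_sq_of_mem_goodEvent {t : ℝ} {s : Fin N → Vec d × Vec d}
    (hs : s ∈ goodEvent d N lmin lmax R t) {i j : Fin N} (hij : i ≠ j) :
    R ^ 2 * (1 - t) ≤ ‖(s i).2 - (s j).2‖ ^ 2 := by
  have h := hs.2 i j hij
  rw [norm_sub_sq_real, (hs.1 i).2, (hs.1 j).2]
  rw [div_pow, Real.sq_sqrt zero_le_two] at *
  linarith

/-- A crude bound, linear in `d`, on the distance of two mean vectors; the true order is `√d`. -/
theorem norm_sub_le_of_mem_sampleSupport (hd : 1 ≤ d) (hlmax : 0 < lmax) (hle : lmin ≤ lmax)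
    (hR : R ^ 2 = d * (lmax + lmin)) {s : Fin N → Vec d × Vec d}
    (hs : s ∈ sampleSupport d N lmin lmax R) (i j : Fin N) :
    ‖(s i).2 - (s j).2‖ ≤ d * (1 + 4 * lmax) := by
  have hd' : (1 : ℝ) ≤ d := by exact_mod_cast hd
  have h1 : ‖(s i).2 - (s j).2‖ ≤ 2 * (R / √2) := by
    refine (norm_sub_le _ _).trans ?_
    rw [(hs i).2, (hs j).2]
    linarith
  refine h1.trans (le_of_sq_le_sq ?_ (by positivity))
  calc (2 * (R / √2)) ^ 2 = 2 * (d * (lmax + lmin)) := by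
        rw [mul_pow, div_pow, Real.sq_sqrt zero_le_two, hR]; ring
    _ ≤ 2 * (d * (lmax + lmax)) := by gcongr
    _ = (d : ℝ) * (4 * lmax) := by ring
    _ ≤ (d : ℝ) ^ 2 * (1 + 4 * lmax) ^ 2 := by
        refine mul_le_mul (by nlinarith) (by nlinarith) (by positivity) (by positivity)
    _ = _ := by ring

/-- The separation condition holds on the good event. The overlap of two patterns is at most
`(4π lmin)^{-d/2} exp (-‖m_i - m_j‖² / (4 lmax))`; the loss of `(d/2) log γ = d (1 - α) / 4` in the
normalising constant is made up by the exponent `≥ d (1 - α / 2) / 4`, which leaves `d α / 8` for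
the two logarithmic terms. -/
theorem separated_patterns {β γ α : ℝ} (hlmin : 0 < lmin) (hlmax : lmin < lmax)
    (hγ : γ = lmax / lmin) (hα : α = 1 - 2 * Real.log γ) (hα0 : 0 < α) (hα1 : α < 1)
    (hβ : 3 * α < β * lmin) (hβ0 : 0 < β) (hd : 1 ≤ d) (hN : 1 ≤ N)
    (hNexp : (N : ℝ) ≤ Real.exp ((d : ℝ) * α ^ 2 / 16))
    (hlog : Real.log (6 * (lmax + lmin) * (β * d)) ≤ α / 16 * lmin * (β * d))
    (hR0 : 0 ≤ R) (hR2 : R ^ 2 = d * (lmax + lmin))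
    (hU : U ∈ Matrix.orthogonalGroup (Fin d) ℝ) {s : Fin N → Vec d × Vec d}
    (hs : s ∈ goodEvent d N lmin lmax R (α / 2)) :
    Separated lmin lmax β (patterns U s) := by
  have hL : 0 < lmax := hlmin.trans hlmax
  have hγ0 : 0 < γ := by rw [hγ]; positivity
  have hd0 : (0 : ℝ) < d := by exact_mod_cast hd
  have hN0 : (0 : ℝ) < N := by exact_mod_cast hN
  intro i j hij
  have hlow := le_neg_log_l2Inner hU (s i).2 (s j).2 hlmin (hs.1 i).1.2 (hs.1 j).1.2
  refine le_trans ?_ hlow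
  rw [MW_patterns hlmin.le hR0 hU hs.1 hN, hR2]
  have e1 : (N : ℝ) ^ 3 * β * (4 * (d * (lmax + lmin)) + 2 * d * (lmax + lmin))
      = N ^ 3 * (6 * (lmax + lmin) * (β * d)) := by ring
  have e2 : Real.log ((N : ℝ) ^ 3 * β * (4 * (d * (lmax + lmin)) + 2 * d * (lmax + lmin)))
      = 3 * Real.log N + Real.log (6 * (lmax + lmin) * (β * d)) := by
    rw [e1, Real.log_mul (by positivity) (by positivity), Real.log_pow]
    norm_num
  have h1 : Real.log N ≤ d * α ^ 2 / 16 := by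
    have := Real.log_le_log hN0 hNexp
    rwa [Real.log_exp] at this
  have h2 : 1 / (β * lmin) * (3 * Real.log N + Real.log (6 * (lmax + lmin) * (β * d)))
      ≤ d * α / 16 + d * α / 16 := by
    rw [one_div_mul_eq_div, div_le_iff₀ (by positivity)]
    have k1 : 3 * Real.log N ≤ d * α / 16 * (β * lmin) := by
      calc 3 * Real.log N ≤ 3 * (d * α ^ 2 / 16) := by linarith
        _ = d * α / 16 * (3 * α) := by ring
        _ ≤ _ := by gcongr
    have k2 : Real.log (6 * (lmax + lmin) * (β * d)) ≤ d * α / 16 * (β * lmin) :=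
      hlog.trans (le_of_eq (by ring))
    linarith
  have h3 : Real.log (4 * Real.pi * lmax) = Real.log (4 * Real.pi * lmin) + Real.log γ := by
    rw [← Real.log_mul (by positivity) (by positivity), hγ]
    congr 1
    field_simp
  have h4 : d * (1 - α / 2) / 4 ≤ ‖(s i).2 - (s j).2‖ ^ 2 / (4 * lmax) := by
    rw [le_div_iff₀ (by positivity)]
    refine le_trans ?_ (norm_sub_sq_of_mem_goodEvent hs hij.symm)
    have : 0 ≤ d * (1 - α / 2) * lmin := by
      have : 0 < 1 - α / 2 := by linarith
      positivity
    rw [hR2]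
    linarith
  have h5 : Real.log γ = (1 - α) / 2 := by rw [hα]; ring
  rw [e2, h3, h5]
  linarith

end Patterns

/-! ### Growth conditions on the dimension -/

section Asymptotics

theorem eventually_mul_exp_neg_le {c C : ℝ} (hc : 0 < c) :
    ∀ᶠ x : ℝ in atTop, C * ((1 + x) * x * Real.exp (-(x * c))) ≤ 1 := by
  have hcx : Tendsto (fun x : ℝ => x * c) atTop atTop := tendsto_id.atTop_mul_const hc
  have h1 := (Real.tendsto_pow_mul_exp_neg_atTop_nhds_zero 1).comp hcx
  have h2 := (Real.tendsto_pow_mul_exp_neg_atTop_nhds_zero 2).comp hcx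
  have h := ((h1.const_mul (1 / c)).add (h2.const_mul (1 / c ^ 2))).const_mul C
  rw [mul_zero, mul_zero, add_zero, mul_zero] at h
  filter_upwards [h.eventually (eventually_le_nhds zero_lt_one)] with x hx
  refine le_trans (le_of_eq ?_) hx
  simp only [Function.comp_apply]
  field_simp

theorem eventually_log_mul_le {c ε : ℝ} (hc : 0 < c) (hε : 0 < ε) :
    ∀ᶠ x : ℝ in atTop, Real.log (c * x) ≤ ε * x := by
  have h := (Real.isLittleO_log_id_atTop.bound (half_pos hε))
  filter_upwards [h, eventually_gt_atTop 0, eventually_ge_atTop (Real.log c / (ε / 2))]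
    with x hx hx0 hxc
  rw [Real.log_mul hc.ne' hx0.ne']
  rw [Real.norm_eq_abs, id, Real.norm_eq_abs, abs_of_pos hx0] at hx
  rw [div_le_iff₀ (half_pos hε)] at hxc
  have := le_abs_self (Real.log x)
  linarith

/-- If `N² ≤ exp (x l / 24)` and `d ≤ x l / (3 α)`, with `x = β d`, the weight bound needed for
storage follows from a condition on `x` alone. The rate `11 / 24` is `1 / 2 - 1 / 24`. -/
theorem mul_exp_le_one_of_le {C N d x α l : ℝ} (hC : 0 ≤ C) (hx : 0 ≤ x) (hα : 0 < α)
    (hN : N ^ 2 ≤ Real.exp (x * l / 24)) (hd : 3 * α * d ≤ x * l) (hd0 : 0 ≤ d)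
    (h : C * (l / (3 * α)) * ((1 + x) * x * Real.exp (-(x * (11 * l / 24)))) ≤ 1) :
    C * (N ^ 2 * (1 + x) * d * Real.exp (-(x * (l / 2)))) ≤ 1 := by
  have h2 : d ≤ x * (l / (3 * α)) := by
    rw [mul_div_assoc', le_div_iff₀ (by positivity)]
    linarith
  refine le_trans ?_ h
  calc C * (N ^ 2 * (1 + x) * d * Real.exp (-(x * (l / 2))))
      ≤ C * (Real.exp (x * l / 24) * (1 + x) * (x * (l / (3 * α)))
        * Real.exp (-(x * (l / 2)))) := by gcongr
    _ = C * (l / (3 * α)) * ((1 + x) * x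
        * (Real.exp (x * l / 24) * Real.exp (-(x * (l / 2))))) := by ring
    _ = _ := by
      rw [← Real.exp_add]
      congr 4
      ring

end Asymptotics

end WDAM

theorem theorem1 (p lmin lmax γ α : ℝ) (hp0 : 0 < p) (hp1 : p < 1)
    (hlmin : 0 < lmin) (hlmax : lmin < lmax)
    (hγ : γ = lmax / lmin) (hα : α = 1 - 2 * Real.log γ)
    (hγe : γ < √(Real.exp 1)) :
    ∃ d₀ : ℕ, ∀ d : ℕ, d₀ < d →
      ∀ U ∈ Matrix.orthogonalGroup (Fin d) ℝ,
      ∀ (R : ℝ) (N : ℕ), R = √((d : ℝ) * (lmax + lmin)) →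
        N = ⌊√(p / 2) * Real.exp ((d : ℝ) * α ^ 2 / 16)⌋₊ →
        IsProbabilityMeasure (WDAM.sampleLaw d N lmin lmax R) ∧
        (∀ᵐ s ∂(WDAM.sampleLaw d N lmin lmax R),
          WDAM.OnWassersteinSphere lmin lmax R (WDAM.patterns U s)) ∧
        ∀ β : ℝ, 3 * α / lmin < β →
          (∀ᵐ s ∂(WDAM.sampleLaw d N lmin lmax R),
            WDAM.BetaConstraint lmin lmax β (WDAM.patterns U s)) ∧
          ∃ G : Set (Fin N → WDAM.Vec d × WDAM.Vec d), MeasurableSet G ∧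
            ENNReal.ofReal (1 - p) ≤ WDAM.sampleLaw d N lmin lmax R G ∧
            ∀ s ∈ G,
              WDAM.Separated lmin lmax β (WDAM.patterns U s) ∧
              ∀ i, WDAM.IsStored β (WDAM.patterns U s)
                (fun j => WDAM.wBall (WDAM.patterns U s j) (1 / √(β * N))) i := by
  have hL : 0 < lmax := hlmin.trans hlmax
  have hγ1 : 1 < γ := by rw [hγ, one_lt_div hlmin]; exact hlmax
  have hlogγ : 0 < Real.log γ := Real.log_pos hγ1
  have hlogγ2 : Real.log γ < 1 / 2 := by
    have := Real.log_lt_log (by linarith) hγe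
    rwa [Real.log_sqrt (Real.exp_pos 1).le, Real.log_exp] at this
  have hα0 : 0 < α := by rw [hα]; linarith
  have hα1 : α < 1 := by rw [hα]; linarith
  obtain ⟨C, hC, hstore⟩ := WDAM.exists_isStored_of_separated hlmin hlmax.le
  -- conditions on the dimension, part of them through `x = β d ≥ 3 α d / lmin`
  have hE1 := WDAM.eventually_mul_exp_neg_le (c := 11 * lmin / 24) (C := C * (lmin / (3 * α)))
    (by positivity)
  have hE2 := WDAM.eventually_log_mul_le (c := 6 * (lmax + lmin)) (ε := α / 16 * lmin)
    (by positivity) (by positivity)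
  obtain ⟨x₀, hx₀⟩ := eventually_atTop.1 (hE1.and hE2)
  have hT1 : Tendsto (fun d : ℕ => 3 * α / lmin * (d : ℝ)) atTop atTop :=
    tendsto_natCast_atTop_atTop.const_mul_atTop (by positivity)
  have hT2 : Tendsto (fun d : ℕ => √(p / 2) * Real.exp ((d : ℝ) * α ^ 2 / 16)) atTop atTop := by
    refine Tendsto.const_mul_atTop (by positivity) (Real.tendsto_exp_atTop.comp ?_)
    have : Tendsto (fun d : ℕ => (d : ℝ) * (α ^ 2 / 16)) atTop atTop :=
      tendsto_natCast_atTop_atTop.atTop_mul_const (by positivity)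
    exact this.congr fun d => by ring
  have hT3 : Tendsto (fun d : ℕ => 3 * α / lmin * (6 * (lmax + lmin)) * (d : ℝ)) atTop atTop :=
    tendsto_natCast_atTop_atTop.const_mul_atTop (by positivity)
  obtain ⟨d₀, hd₀⟩ := eventually_atTop.1 ((hT1.eventually_ge_atTop x₀).and
    ((hT2.eventually_ge_atTop (16 / (3 * α) + 1)).and ((hT3.eventually_gt_atTop (Real.exp 2)).and
      (eventually_ge_atTop 1))))
  refine ⟨d₀, fun d hd U hU R N hR hN => ?_⟩
  obtain ⟨hdx, hdN, hdβ, hd1⟩ := hd₀ d hd.le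
  have hd1' : (1 : ℝ) ≤ d := by exact_mod_cast hd1
  have hR2 : R ^ 2 = d * (lmax + lmin) := by rw [hR, Real.sq_sqrt (by positivity)]
  have hR0 : 0 < R := by rw [hR]; positivity
  -- bounds for the number of patterns
  have hNle : (N : ℝ) ≤ √(p / 2) * Real.exp ((d : ℝ) * α ^ 2 / 16) := by
    rw [hN]; exact Nat.floor_le (by positivity)
  have hNge : 16 / (3 * α) ≤ N := by
    have := Nat.lt_floor_add_one (√(p / 2) * Real.exp ((d : ℝ) * α ^ 2 / 16))
    rw [← hN] at this
    linarith
  have hN0 : (0 : ℝ) < N := lt_of_lt_of_le (by positivity) hNge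
  have hN1 : 1 ≤ N := by exact_mod_cast hN0
  have hN1' : (1 : ℝ) ≤ N := by exact_mod_cast hN1
  have hNexp : (N : ℝ) ≤ Real.exp ((d : ℝ) * α ^ 2 / 16) := by
    refine hNle.trans (mul_le_of_le_one_left (Real.exp_pos _).le ?_)
    rw [← Real.sqrt_one]
    exact Real.sqrt_le_sqrt (by linarith)
  have hN2 : (N : ℝ) ^ 2 ≤ p / 2 * Real.exp ((d : ℝ) * α ^ 2 / 8) := by
    calc (N : ℝ) ^ 2 ≤ (√(p / 2) * Real.exp ((d : ℝ) * α ^ 2 / 16)) ^ 2 := by gcongr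
      _ = _ := by
        rw [mul_pow, Real.sq_sqrt (by positivity), ← Real.exp_nat_mul]
        congr 2
        push_cast
        ring
  have hsupp := WDAM.ae_sampleLaw_mem_support (N := N) hd1 hlmax hR0.le hR2
  refine ⟨WDAM.isProbabilityMeasure_sampleLaw hd1 hlmax hR2, ?_, fun β hβ => ?_⟩
  · filter_upwards [hsupp] with s hs
    exact WDAM.onWassersteinSphere_patterns hlmin.le hR0.le hU hs
  have hβ0 : 0 < β := lt_trans (by positivity) hβ
  have hβl : 3 * α < β * lmin := (div_lt_iff₀ hlmin).1 hβ
  set x := β * d with hx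
  have hxd : 3 * α * d ≤ x * lmin := by
    rw [hx]
    calc 3 * α * d ≤ β * lmin * d := by gcongr
      _ = β * d * lmin := by ring
  have hx0 : x₀ ≤ x := by
    refine hdx.trans ?_
    rw [hx]
    gcongr
  have hxpos : 0 < x := by positivity
  obtain ⟨hE1x, hE2x⟩ := hx₀ x hx0
  refine ⟨?_, WDAM.goodEvent d N lmin lmax R (α / 2), WDAM.measurableSet_goodEvent _, ?_, ?_⟩
  · filter_upwards [hsupp] with s hs
    unfold WDAM.BetaConstraint
    rw [WDAM.MW_patterns hlmin.le hR0.le hU hs hN1, hR2, div_lt_iff₀ (by positivity)]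
    have h1 : 3 * α / lmin * (6 * (lmax + lmin)) * d ≤ β * (6 * (lmax + lmin)) * d := by gcongr
    have h2 : (1 : ℝ) ≤ N ^ 3 := one_le_pow₀ hN1'
    calc Real.exp 2 < β * (6 * (lmax + lmin)) * d := hdβ.trans_le h1
      _ ≤ β * (6 * (lmax + lmin)) * d * N ^ 3 := le_mul_of_one_le_right (by positivity) h2
      _ = _ := by ring
  · -- at cosine `t = α / 2` the cap bound `exp (-d α² / 8)` cancels the growth of `N²`
    refine WDAM.le_sampleLaw_goodEvent hd1 hlmax hR0 hR2 (by positivity) (by nlinarith) ?_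
    calc (N : ℝ) ^ 2 * Real.exp (-(d * (α / 2) ^ 2 / 2))
        ≤ p / 2 * Real.exp ((d : ℝ) * α ^ 2 / 8) * Real.exp (-(d * (α / 2) ^ 2 / 2)) := by gcongr
      _ = p / 2 := by
        rw [mul_assoc, ← Real.exp_add]
        have : (d : ℝ) * α ^ 2 / 8 + -(d * (α / 2) ^ 2 / 2) = 0 := by ring
        rw [this, Real.exp_zero, mul_one]
      _ ≤ p := by linarith
  · intro s hs
    have hlog : Real.log (6 * (lmax + lmin) * (β * d)) ≤ α / 16 * lmin * (β * d) := hE2x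
    refine ⟨WDAM.separated_patterns hlmin hlmax hγ hα hα0 hα1 hβl hβ0 hd1 hN1 hNexp hlog hR0.le
      hR2 hU hs, ?_⟩
    refine hstore d N β (fun i => (s i).2)
      (fun i => U * Matrix.diagonal (fun k => (s i).1 k) * Uᵀ) hd1 hβ0
      (fun j => WDAM.specIn_conj_diagonal hU (hs.1 j).1.2)
      (WDAM.norm_sub_le_of_mem_sampleSupport hd1 hL hlmax.le hR2 hs.1) (fun j k hjk => ?_) ?_ ?_
    · refine le_trans ?_ (WDAM.norm_sub_sq_of_mem_goodEvent hs hjk)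
      rw [hR2]
      calc (d : ℝ) * lmin = d * (2 * lmin) * (1 / 2) := by ring
        _ ≤ d * (lmax + lmin) * (1 - α / 2) := by gcongr <;> linarith
    · rw [div_le_iff₀ (by positivity)]
      have h1 : 3 * α * N ≤ β * lmin * N := by gcongr
      have h2 : 16 ≤ N * (3 * α) := (div_le_iff₀ (by positivity)).1 hNge
      linarith
    · have h1 : (N : ℝ) ^ 2 ≤ Real.exp (x * lmin / 24) := by
        calc (N : ℝ) ^ 2 ≤ Real.exp ((d : ℝ) * α ^ 2 / 16) ^ 2 := by gcongr
          _ = Real.exp (d * α * α / 8) := by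
            rw [← Real.exp_nat_mul]; congr 1; push_cast; ring
          _ ≤ _ := by
            apply Real.exp_le_exp.2
            have : d * α * α ≤ d * α * 1 := by gcongr
            linarith
      have e : -(β * (d * lmin / 2)) = -(x * (lmin / 2)) := by rw [hx]; ring
      rw [e]
      exact WDAM.mul_exp_le_one_of_le hC.le hxpos.le hα0 h1 hxd (by positivity) hE1x
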